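/- Let $N\ge 2$ be an integer, $0<\alpha<N$, $c>0$, $\gamma<0$, $\mu<0$, and let $\frac{N+\alpha}{N}<p<2_\alpha^*$ and $2<q<2^*$, where $2_\alpha^*=\frac{N+\alpha}{N-2}$ and $2^*=\frac{2N}{N-2}$ if $N\ge 3$, and $2_\alpha^*=2^*=\infty$ if $N=2$. Let $$I_\alpha(x)=\frac{\Gamma(\frac{N-\alpha}{2})}{\pi^{N/2}2^\alpha\Gamma(\frac{\alpha}{2})}\,\frac{1}{|x|^{N-\alpha}}\qquad(x\in\mathbb{R}^N\setminus\{0\})$$ be the Riesz potential. For real-valued $u\in H^1(\mathbb{R}^N)$ put $$E_{\gamma,\mu}(u)=\frac12\int_{\mathbb{R}^N}|\nabla u|^2\,dx-\frac{\gamma}{2p}\int_{\mathbb{R}^N}(I_\alpha*|u|^p)|u|^p\,dx-\frac{\mu}{q}\int_{\mathbb{R}^N}|u|^q\,dx,$$ and let $S(c)=\{u\in H^1(\mathbb{R}^N):\int_{\mathbb{R}^N}|u|^2\,dx=c\}$. Then: (1) $E_{\gamma,\mu}$ has no critical point on $S(c)$, i.e. there is no $u\in S(c)$ with $E_{\gamma,\mu}'(u)[v]=0$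 for all $v\in H^1(\mathbb{R}^N)$ with $\int_{\mathbb{R}^N}uv\,dx=0$. (2) The problem $$-\Delta u+\lambda u=\gamma(I_\alpha*|u|^p)|u|^{p-2}u+\mu|u|^{q-2}u\ \text{ in }\mathbb{R}^N,\qquad \int_{\mathbb{R}^N}|u|^2\,dx=c$$ has no solution: there are no $\lambda\in\mathbb{R}$ and $u\in S(c)$ such that $u$ is a weak solution of the equation (tested against functions in $C_c^\infty(\mathbb{R}^N)$). (3) For every $u\in S(c)$, with $u_t(x)=t^{N/2}u(tx)$, the fibering map $t\in(0,\infty)\mapsto E_{\gamma,\mu}(u_t)$ is strictly increasing. -/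

import Mathlib

open MeasureTheory Set
open scoped ContDiff

noncomputable section

namespace Choquard

/-- The Euclidean space `ℝ^N`. -/
abbrev Space (N : ℕ) := EuclideanSpace ℝ (Fin N)

/-- Test functions: real-valued smooth functions with compact support on `ℝ^N`. -/
def IsTest {N : ℕ} (φ : Space N → ℝ) : Prop :=
  ContDiff ℝ ∞ φ ∧ HasCompactSupport φ

/-- `g` is the weak (distributional) gradient of `u` on `ℝ^N`:
`∫ u ∂_v φ = - ∫ ⟨g, v⟩ φ` for all test functions `φ` and all directions `v`. -/
def IsWeakGradient {N : ℕ} (u : Space N → ℝ) (g : Space N → Space N) : Prop :=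
  ∀ φ : Space N → ℝ, IsTest φ → ∀ v : Space N,
    ∫ x, u x * fderiv ℝ φ x v = - ∫ x, inner ℝ (g x) v * φ x

theorem IsTest.memLp {N : ℕ} {φ : Space N → ℝ} (hφ : IsTest φ) :
    MemLp φ 2 (volume : Measure (Space N)) :=
  hφ.1.continuous.memLp_of_hasCompactSupport hφ.2

theorem IsTest.memLp_fderiv {N : ℕ} {φ : Space N → ℝ} (hφ : IsTest φ) (v : Space N) :
    MemLp (fun x => fderiv ℝ φ x v) 2 (volume : Measure (Space N)) :=
  ((hφ.1.continuous_fderiv (by simp)).clm_apply continuous_const).memLp_of_hasCompactSupport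
    (hφ.2.fderiv_apply (𝕜 := ℝ) v)

theorem IsTest.integrable_left {N : ℕ} {φ : Space N → ℝ} (hφ : IsTest φ) (v : Space N)
    (u : Lp ℝ 2 (volume : Measure (Space N))) :
    Integrable (fun x => u x * fderiv ℝ φ x v) :=
  (Lp.memLp u).integrable_mul (hφ.memLp_fderiv v)

theorem IsTest.integrable_right {N : ℕ} {φ : Space N → ℝ} (hφ : IsTest φ) (v : Space N)
    (g : Lp (Space N) 2 (volume : Measure (Space N))) :
    Integrable (fun x => inner ℝ (g x) v * φ x) :=
  ((Lp.memLp g).inner_const v).integrable_mul hφ.memLp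

/-- The real Sobolev space `H¹(ℝ^N)`, realised as the space of pairs `(u, ∇u)` in
`L²(ℝ^N) × L²(ℝ^N; ℝ^N)` with `∇u` the weak gradient of `u`.  The inherited norm is
`‖u‖_{H¹} = (‖u‖₂² + ‖∇u‖₂²)^{1/2}`. -/
def H1 (N : ℕ) : Submodule ℝ (WithLp 2 (Lp ℝ 2 (volume : Measure (Space N)) ×
    Lp (Space N) 2 (volume : Measure (Space N)))) where
  carrier := {w | IsWeakGradient (fun x => w.fst x) (fun x => w.snd x)}
  zero_mem' := by
    intro φ _ v
    have h1 : ∫ x, (0 : Lp ℝ 2 (volume : Measure (Space N))) x * fderiv ℝ φ x v = 0 := by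
      refine integral_eq_zero_of_ae ?_
      filter_upwards [Lp.coeFn_zero ℝ 2 (volume : Measure (Space N))] with x hx
      simp
    have h2 : ∫ x, inner ℝ ((0 : Lp (Space N) 2 (volume : Measure (Space N))) x) v * φ x = 0 := by
      refine integral_eq_zero_of_ae ?_
      filter_upwards [Lp.coeFn_zero (Space N) 2 (volume : Measure (Space N))] with x hx
      simp
    simp only [WithLp.zero_fst, WithLp.zero_snd]
    rw [h1, h2, neg_zero]
  add_mem' := by
    intro a b ha hb φ hφ v
    have h1 : ∫ x, (a + b).fst x * fderiv ℝ φ x v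
        = ∫ x, (a.fst x * fderiv ℝ φ x v + b.fst x * fderiv ℝ φ x v) := by
      refine integral_congr_ae ?_
      filter_upwards [Lp.coeFn_add a.fst b.fst] with x hx
      rw [WithLp.add_fst, hx, Pi.add_apply, add_mul]
    have h2 : ∫ x, inner ℝ ((a + b).snd x) v * φ x
        = ∫ x, (inner ℝ (a.snd x) v * φ x + inner ℝ (b.snd x) v * φ x) := by
      refine integral_congr_ae ?_
      filter_upwards [Lp.coeFn_add a.snd b.snd] with x hx
      rw [WithLp.add_snd, hx, Pi.add_apply, inner_add_left, add_mul]
    have ha' := ha φ hφ v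
    have hb' := hb φ hφ v
    simp only at ha' hb' ⊢
    rw [h1, h2, integral_add (hφ.integrable_left v _) (hφ.integrable_left v _),
      integral_add (hφ.integrable_right v _) (hφ.integrable_right v _), ha', hb']
    ring
  smul_mem' := by
    intro r a ha φ hφ v
    have h1 : ∫ x, (r • a).fst x * fderiv ℝ φ x v
        = ∫ x, r * (a.fst x * fderiv ℝ φ x v) := by
      refine integral_congr_ae ?_
      filter_upwards [Lp.coeFn_smul r a.fst] with x hx
      rw [WithLp.smul_fst, hx, Pi.smul_apply, smul_eq_mul, mul_assoc]
    have h2 : ∫ x, inner ℝ ((r • a).snd x) v * φ x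
        = ∫ x, r * (inner ℝ (a.snd x) v * φ x) := by
      refine integral_congr_ae ?_
      filter_upwards [Lp.coeFn_smul r a.snd] with x hx
      rw [WithLp.smul_snd, hx, Pi.smul_apply, real_inner_smul_left, mul_assoc]
    have ha' := ha φ hφ v
    simp only at ha' ⊢
    rw [h1, h2, integral_const_mul, integral_const_mul, ha']
    ring

variable {N : ℕ}

/-- The function underlying an element of `H¹(ℝ^N)`. -/
def fn (u : H1 N) : Space N → ℝ := fun x => u.1.fst x

/-- The weak gradient of an element of `H¹(ℝ^N)`. -/
def grad (u : H1 N) : Space N → Space N := fun x => u.1.snd x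

/-- The element of `H¹(ℝ^N)` given by a square integrable function with a square integrable
weak gradient. -/
def mkH1 (f : Space N → ℝ) (g : Space N → Space N) (hf : MemLp f 2 (volume : Measure (Space N)))
    (hg : MemLp g 2 (volume : Measure (Space N))) (h : IsWeakGradient f g) : H1 N :=
  ⟨WithLp.toLp 2 (hf.toLp f, hg.toLp g), by
    intro φ hφ v
    have h1 : ∫ x, hf.toLp f x * fderiv ℝ φ x v = ∫ x, f x * fderiv ℝ φ x v := by
      refine integral_congr_ae ?_
      filter_upwards [hf.coeFn_toLp] with x hx
      rw [hx]
    have h2 : ∫ x, inner ℝ (hg.toLp g x) v * φ x = ∫ x, inner ℝ (g x) v * φ x := by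
      refine integral_congr_ae ?_
      filter_upwards [hg.coeFn_toLp] with x hx
      rw [hx]
    exact h1.trans ((h φ hφ v).trans (congrArg Neg.neg h2.symm))⟩

theorem memLp_comp_dilation {F : Type*} [NormedAddCommGroup F] {f : Space N → F}
    (hf : MemLp f 2 (volume : Measure (Space N))) {t : ℝ} (ht : 0 < t) :
    MemLp (fun x => f (t • x)) 2 (volume : Measure (Space N)) := by
  have hmap : Measure.map (fun x : Space N => t • x) volume
      = ENNReal.ofReal |(t ^ Module.finrank ℝ (Space N))⁻¹| • volume :=
    Measure.map_addHaar_smul volume ht.ne'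
  have h2 : MemLp f 2 (Measure.map (fun x : Space N => t • x) volume) := by
    rw [hmap]
    exact hf.smul_measure ENNReal.ofReal_ne_top
  exact h2.comp_of_map (measurable_const_smul t).aemeasurable

theorem IsWeakGradient.dilation {f : Space N → ℝ} {g : Space N → Space N}
    (h : IsWeakGradient f g) {t : ℝ} (ht : 0 < t) (a : ℝ) :
    IsWeakGradient (fun x => a * f (t • x)) (fun x => (a * t) • g (t • x)) := by
  intro φ hφ v
  have hψ : IsTest (fun y : Space N => φ (t⁻¹ • y)) :=
    ⟨hφ.1.comp (contDiff_const_smul t⁻¹), hφ.2.comp_smul (inv_ne_zero ht.ne')⟩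
  have hd : ∀ x : Space N, fderiv ℝ φ x v
      = t * fderiv ℝ (fun y : Space N => φ (t⁻¹ • y)) (t • x) v := by
    intro x
    rw [fderiv_comp_smul, inv_smul_smul₀ ht.ne', smul_apply, smul_eq_mul,
      mul_inv_cancel_left₀ ht.ne']
  have key := h _ hψ v
  have h1 : ∫ x, a * f (t • x) * fderiv ℝ φ x v
      = a * t * (|(t ^ Module.finrank ℝ (Space N))⁻¹| *
        ∫ y, f y * fderiv ℝ (fun y : Space N => φ (t⁻¹ • y)) y v) := by
    rw [← smul_eq_mul (|_|), ← Measure.integral_comp_smul volume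
      (fun y => f y * fderiv ℝ (fun y : Space N => φ (t⁻¹ • y)) y v) t, ← integral_const_mul]
    refine integral_congr_ae (Filter.Eventually.of_forall fun x => ?_)
    simp only [hd x]
    ring
  have h2 : ∫ x, inner ℝ ((a * t) • g (t • x)) v * φ x
      = a * t * (|(t ^ Module.finrank ℝ (Space N))⁻¹| *
        ∫ y, inner ℝ (g y) v * φ (t⁻¹ • y)) := by
    rw [← smul_eq_mul (|_|), ← Measure.integral_comp_smul volume
      (fun y => inner ℝ (g y) v * φ (t⁻¹ • y)) t, ← integral_const_mul]
    refine integral_congr_ae (Filter.Eventually.of_forall fun x => ?_)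
    simp only [inv_smul_smul₀ ht.ne', real_inner_smul_left]
    ring
  rw [h1, h2, key]
  ring

/-- The dilation `u_t(x) = t^{N/2} u(t x)`, `t > 0`, as an element of `H¹(ℝ^N)`; its weak gradient
is `t^{N/2} t (∇u)(t x)`. -/
def dilate (t : ℝ) (ht : 0 < t) (u : H1 N) : H1 N :=
  mkH1 (fun x => t ^ ((N : ℝ) / 2) * fn u (t • x))
    (fun x => (t ^ ((N : ℝ) / 2) * t) • grad u (t • x))
    ((memLp_comp_dilation (Lp.memLp u.1.fst) ht).const_mul _)
    ((memLp_comp_dilation (Lp.memLp u.1.snd) ht).const_smul (t ^ ((N : ℝ) / 2) * t))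
    (IsWeakGradient.dilation u.2 ht _)

/-- The Riesz potential kernel
`I_α(x) = Γ((N-α)/2) / (π^{N/2} 2^α Γ(α/2)) · |x|^{-(N-α)}`, `x ≠ 0`. -/
def rieszKernel (α : ℝ) (x : Space N) : ℝ :=
  Real.Gamma (((N : ℝ) - α) / 2) /
    (Real.pi ^ ((N : ℝ) / 2) * (2 : ℝ) ^ α * Real.Gamma (α / 2)) / ‖x‖ ^ ((N : ℝ) - α)

/-- The convolution `(I_α * |f|^p)(x)`. -/
def hartree (α p : ℝ) (f : Space N → ℝ) (x : Space N) : ℝ :=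
  ∫ y, rieszKernel α (x - y) * |f y| ^ p

/-- The energy functional
`E(u) = 1/2 ∫ |∇u|² - γ/(2p) ∫ (I_α * |u|^p) |u|^p - μ/q ∫ |u|^q` on `H¹(ℝ^N)`. -/
def energy (α p q γ μ : ℝ) (u : H1 N) : ℝ :=
  1 / 2 * (∫ x, ‖grad u x‖ ^ 2)
    - γ / (2 * p) * (∫ x, hartree α p (fn u) x * |fn u x| ^ p)
    - μ / q * (∫ x, |fn u x| ^ q)

/-- The mass constraint `S(c) = {u ∈ H¹(ℝ^N) : ∫ |u|² = c}`. -/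
def massSphere (N : ℕ) (c : ℝ) : Set (H1 N) :=
  {u | (∫ x, |fn u x| ^ 2) = c}

/-- `u` is a critical point of the energy restricted to `S(c)`: it lies on `S(c)`, and the
(Fréchet) derivative of the energy at `u` vanishes on the tangent space
`T_u S(c) = {v ∈ H¹ : ∫ u v = 0}`.  The energy is of class `C¹` on `H¹` for the exponents considered,
so `fderiv` is its genuine derivative there. -/
def IsCriticalPoint (α p q γ μ c : ℝ) (u : H1 N) : Prop :=
  u ∈ massSphere N c ∧
    ∀ v : H1 N, (∫ x, fn u x * fn v x) = 0 → fderiv ℝ (energy α p q γ μ) u v = 0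

/-- `u ∈ H¹(ℝ^N)` is a weak solution of
`-Δu + lam u = γ (I_α * |u|^p) |u|^{p-2} u + μ |u|^{q-2} u` in `ℝ^N`
(tested against smooth compactly supported functions). -/
def IsWeakSolution (α p q γ μ lam : ℝ) (u : H1 N) : Prop :=
  ∀ φ : Space N → ℝ, IsTest φ →
    (∫ x, fderiv ℝ φ x (grad u x)) + lam * (∫ x, fn u x * φ x)
      = γ * (∫ x, hartree α p (fn u) x * (|fn u x| ^ (p - 2) * fn u x) * φ x)
        + μ * (∫ x, |fn u x| ^ (q - 2) * fn u x * φ x)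

/-- `(u, lam)` solves the problem `(P_c)`: `u` is a weak solution of the equation with
frequency `lam`, and `∫ |u|² = c`. -/
def IsNormalizedSolution (α p q γ μ c lam : ℝ) (u : H1 N) : Prop :=
  IsWeakSolution α p q γ μ lam u ∧ u ∈ massSphere N c

end Choquard

end

/-!
The energy is convex. Both exponents exceed one, `γ` and `μ` are negative, and the Riesz kernel is
positive definite (`two_mul_interaction_le`), being a superposition of Gaussians, each of which is
a convolution square. Hence, if `u` is a critical point under the mass constraint, or a weak
solution, with multiplier `lam`, then `E(v) - E(u) ≥ -lam ⟨u, v - u⟩` for every `v ∈ H¹`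
(`energy_sub_ge`).

This is contradicted by an almost mass-preserving expansion of `u`. Taking for `v` a dilation of `u`
would require differentiating `⟨u, v - u⟩`, that is, decay of `x ⬝ ∇u`; instead space is stretched
by `y ↦ (y_i + σ η(y_i))_i` with `η` bounded and `η'` close to one on a large ball, zero at
infinity (`Profile.stretch`, `arctanProfile`), and `v = (1 + σ)^(-N/2) u ∘ Ψ⁻¹`
(`Profile.transport`). To first order in `σ → 0`,
* the Dirichlet term drops by a fixed multiple of `σ ‖∇u‖²` (`Profile.norm_sq_snd_transport_le`);
* the power term does not grow (`Profile.integral_powMul_transport_le`), and the nonlocal term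
  grows only through pairs of points outside a large ball (`Profile.rieszForm_transport_le`), which
  is where `p > (N + α) / N` enters;
* `‖v‖² - ‖u‖²` is a small multiple of `σ` (`Profile.norm_sq_fst_sub_transport_le`), and
  `‖v - u‖ = O(σ)` in `L²` (`Profile.norm_fst_transport_sub_le`), so `⟨u, v - u⟩` is a small
  multiple of `σ`.
Letting `σ → 0` and then the ball exhaust the space gives `∇u = 0`, thus `u = 0`
(`fn_ae_eq_zero_of_constrained`). No regularity or decay of `u` is needed.
The upper bounds on `p` and `q` only serve to make the energy finite and differentiable
(`exists_sobolev`, `exists_interaction_le`).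

For the first statement the derivative of the energy on `H¹` has to be computed
(`hasFDerivAt_energy`); for the second the weak formulation is extended from test functions to `H¹`
by density (`IsWeakSolution.energyDeriv_add_eq_zero`). The fibering map is
`t²/2 A - γ/(2p) t^(Np-N-α) B - μ/q t^(Nq/2-N) C` with `A > 0` and `B, C ≥ 0`
(`energy_dilate`), which increases strictly.
-/

open MeasureTheory Set
open scoped ContDiff

noncomputable section

namespace Choquard

open Filter Topology ENNReal
open scoped NNReal

variable {N : ℕ}

/-! ### Mollification in `L²` -/

/-- Translations are continuous in `L²`. -/
theorem exists_eLpNorm_translate_sub_le {F : Type*} [NormedAddCommGroup F] {f : Space N → F}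
    (hf : MemLp f 2 (volume : Measure (Space N))) {ε : ℝ≥0∞} (hε : ε ≠ 0) :
    ∃ δ > 0, ∀ s : Space N, ‖s‖ < δ →
      eLpNorm (fun x => f (x - s) - f x) 2 (volume : Measure (Space N)) ≤ ε := by
  let g : Space N → C(Space N, Space N) := fun s => ⟨fun x => x - s, by fun_prop⟩
  have hg : Continuous g :=
    (ContinuousMap.curry ⟨fun z : Space N × Space N => z.2 - z.1, by fun_prop⟩).continuous
  have hgm : ∀ s, MeasurePreserving (g s) (volume : Measure (Space N)) volume :=
    fun s => measurePreserving_sub_right volume s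
  have key : Continuous fun s => Lp.compMeasurePreserving (g s) (hgm s) (hf.toLp f) :=
    Continuous.compMeasurePreservingLp continuous_const hg hgm (by simp)
  have h0 := (EMetric.tendsto_nhds.1 (key.tendsto 0)) ε (pos_iff_ne_zero.2 hε)
  obtain ⟨δ, hδ, h⟩ := Metric.eventually_nhds_iff.1 h0
  refine ⟨δ, hδ, fun s hs => ?_⟩
  have h1 := h (y := s) (by simpa using hs)
  rw [Lp.edist_def] at h1
  refine le_trans (le_of_eq (eLpNorm_congr_ae ?_)) h1.le
  have e1 := Lp.coeFn_compMeasurePreserving (hf.toLp f) (hgm s)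
  have e2 := Lp.coeFn_compMeasurePreserving (hf.toLp f) (hgm 0)
  have e3 := (hgm s).quasiMeasurePreserving.ae_eq_comp hf.coeFn_toLp
  have e4 := (hgm 0).quasiMeasurePreserving.ae_eq_comp hf.coeFn_toLp
  filter_upwards [e1, e2, e3, e4] with x h1 h2 h3 h4
  simp only [Pi.sub_apply, h1, h2, h3, h4]
  simp [g]

/-- Jensen's inequality for the square, against a weight of total mass at most one. -/
theorem sq_lintegral_mul_le {X : Type*} [MeasurableSpace X] {μ : Measure X} {w h : X → ℝ≥0∞}
    (hw : AEMeasurable w μ) (hh : AEMeasurable h μ) (h1 : ∫⁻ x, w x ∂μ ≤ 1) :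
    (∫⁻ x, w x * h x ∂μ) ^ 2 ≤ ∫⁻ x, w x * h x ^ 2 ∂μ := by
  have := ENNReal.lintegral_mul_norm_pow_le (μ := μ) (f := w) (g := fun x => w x * h x ^ 2)
    hw (hw.mul (hh.pow_const 2)) (p := 1 / 2) (q := 1 / 2) (by norm_num) (by norm_num)
    (by norm_num)
  have e : ∀ x, w x ^ (1 / 2 : ℝ) * (w x * h x ^ 2) ^ (1 / 2 : ℝ) = w x * h x := by
    intro x
    rw [ENNReal.mul_rpow_of_nonneg _ _ (by norm_num), ← mul_assoc,
      ← ENNReal.rpow_add_of_nonneg _ _ (by norm_num) (by norm_num), ← ENNReal.rpow_natCast,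
      ← ENNReal.rpow_mul]
    norm_num
  simp only [e] at this
  calc (∫⁻ x, w x * h x ∂μ) ^ 2 ≤ (1 * (∫⁻ x, w x * h x ^ 2 ∂μ) ^ (1 / 2 : ℝ)) ^ 2 := by
        gcongr
        refine this.trans ?_
        gcongr
        calc _ ≤ (1 : ℝ≥0∞) ^ (1 / 2 : ℝ) := by gcongr
          _ = 1 := by simp
    _ = _ := by
        rw [one_mul, ← ENNReal.rpow_natCast, ← ENNReal.rpow_mul]; norm_num

theorem eLpNorm_two_sq {X F : Type*} [MeasurableSpace X] [NormedAddCommGroup F] {μ : Measure X}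
    (g : X → F) : eLpNorm g 2 μ ^ 2 = ∫⁻ x, ‖g x‖ₑ ^ 2 ∂μ := by
  have := eLpNorm_nnreal_pow_eq_lintegral (μ := μ) (f := g) (p := 2) (by norm_num)
  rw [← ENNReal.rpow_natCast]
  refine Eq.trans ?_ (this.trans ?_)
  · norm_num
  · refine lintegral_congr fun x => ?_
    rw [← ENNReal.rpow_natCast]; norm_num

section Mollify

variable {F : Type*} [NormedAddCommGroup F] [NormedSpace ℝ F]

/-- The mollification `ρ * f`. -/
def mollify (ρ : Space N → ℝ) (f : Space N → F) : Space N → F :=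
  convolution ρ f (ContinuousLinearMap.lsmul ℝ ℝ) volume

theorem mollify_apply (ρ : Space N → ℝ) (f : Space N → F) (x : Space N) :
    mollify ρ f x = ∫ s, ρ s • f (x - s) := rfl

theorem mollify_apply' (ρ : Space N → ℝ) (f : Space N → F) (x : Space N) :
    mollify ρ f x = ∫ t, ρ (x - t) • f t := by
  rw [mollify_apply, ← integral_sub_left_eq_self _ volume x]
  simp

/-- Mollifying displaces `f` in `L²` no more than translations by points of the support
of `ρ` do. -/
theorem eLpNorm_mollify_sub_le [CompleteSpace F] {ρ : Space N → ℝ} (hρ : Continuous ρ)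
    (hρs : HasCompactSupport ρ) (hρ0 : ∀ x, 0 ≤ ρ x) (hρ1 : ∫ x, ρ x = 1) {f : Space N → F}
    (hf : MemLp f 2 (volume : Measure (Space N))) {ε : ℝ≥0∞}
    (h : ∀ s, ρ s ≠ 0 → eLpNorm (fun x => f (x - s) - f x) 2 (volume : Measure (Space N)) ≤ ε) :
    eLpNorm (fun x => mollify ρ f x - f x) 2 (volume : Measure (Space N)) ≤ ε := by
  have hint : Integrable ρ := hρ.integrable_of_hasCompactSupport hρs
  have hloc : LocallyIntegrable f volume := hf.locallyIntegrable (by norm_num)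
  have hone : ∫⁻ s, ENNReal.ofReal (ρ s) = 1 := by
    rw [← ofReal_integral_eq_lintegral_ofReal hint (ae_of_all _ hρ0), hρ1, ENNReal.ofReal_one]
  have hpt : ∀ x, ‖mollify ρ f x - f x‖ₑ ^ 2
      ≤ ∫⁻ s, ENNReal.ofReal (ρ s) * ‖f (x - s) - f x‖ₑ ^ 2 := by
    intro x
    have hi1 : Integrable fun s => ρ s • f (x - s) :=
      (hρs.convolutionExists_left (ContinuousLinearMap.lsmul ℝ ℝ) hρ hloc) x
    have e1 : mollify ρ f x - f x = ∫ s, ρ s • (f (x - s) - f x) := by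
      simp only [smul_sub]
      rw [integral_sub hi1 (hint.smul_const _), integral_smul_const, hρ1, one_smul, mollify_apply]
    rw [e1]
    calc ‖∫ s, ρ s • (f (x - s) - f x)‖ₑ ^ 2
        ≤ (∫⁻ s, ‖ρ s • (f (x - s) - f x)‖ₑ) ^ 2 := by
          gcongr; exact enorm_integral_le_lintegral_enorm _
      _ = (∫⁻ s, ENNReal.ofReal (ρ s) * ‖f (x - s) - f x‖ₑ) ^ 2 := by
          simp only [enorm_smul, Real.enorm_eq_ofReal (hρ0 _)]
      _ ≤ _ := by
          refine sq_lintegral_mul_le hρ.measurable.ennreal_ofReal.aemeasurable ?_ hone.le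
          exact ((hf.aestronglyMeasurable.comp_measurePreserving
            (Measure.measurePreserving_sub_left volume x)).sub aestronglyMeasurable_const).enorm
  have hmeas : AEMeasurable (fun z : Space N × Space N =>
      ENNReal.ofReal (ρ z.2) * ‖f (z.1 - z.2) - f z.1‖ₑ ^ 2) (volume.prod volume) := by
    refine ((hρ.measurable.ennreal_ofReal.comp measurable_snd).aemeasurable).mul
      (AEMeasurable.pow_const ?_ 2)
    have h1 : AEStronglyMeasurable (fun z : Space N × Space N => f (z.1 - z.2))
        (volume.prod volume) :=
      hf.aestronglyMeasurable.comp_quasiMeasurePreserving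
        (quasiMeasurePreserving_sub_of_right_invariant volume volume)
    exact (h1.sub (hf.aestronglyMeasurable.comp_fst)).enorm
  have : eLpNorm (fun x => mollify ρ f x - f x) 2 (volume : Measure (Space N)) ^ 2 ≤ ε ^ 2 := by
    rw [eLpNorm_two_sq]
    calc _ ≤ ∫⁻ x, ∫⁻ s, ENNReal.ofReal (ρ s) * ‖f (x - s) - f x‖ₑ ^ 2 := lintegral_mono hpt
      _ = ∫⁻ s, ∫⁻ x, ENNReal.ofReal (ρ s) * ‖f (x - s) - f x‖ₑ ^ 2 :=
          lintegral_lintegral_swap hmeas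
      _ ≤ ∫⁻ s, ENNReal.ofReal (ρ s) * ε ^ 2 := by
          refine lintegral_mono fun s => ?_
          simp only
          rw [lintegral_const_mul' _ _ ENNReal.ofReal_ne_top]
          by_cases hs : ρ s = 0
          · simp [hs]
          · gcongr
            rw [← eLpNorm_two_sq (fun x => f (x - s) - f x)]
            gcongr
            exact h s hs
      _ = ε ^ 2 := by
          rw [lintegral_mul_const _ hρ.measurable.ennreal_ofReal, hone, one_mul]
  exact (ENNReal.pow_le_pow_left_iff (by norm_num)).1 this

end Mollify

theorem contDiff_mollify {ρ : Space N → ℝ} (hρ : IsTest ρ) {u : Space N → ℝ}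
    (hu : LocallyIntegrable u volume) : ContDiff ℝ ∞ (mollify ρ u) :=
  hρ.2.contDiff_convolution_left _ hρ.1 hu

/-- The gradient of a mollification is the mollification of the weak gradient. -/
theorem fderiv_mollify {ρ : Space N → ℝ} (hρ : IsTest ρ) {u : Space N → ℝ} {g : Space N → Space N}
    (hu : LocallyIntegrable u volume) (hg : LocallyIntegrable g volume) (h : IsWeakGradient u g)
    (x v : Space N) :
    fderiv ℝ (mollify ρ u) x v = inner ℝ (mollify ρ g x) v := by
  have hρ1 : ContDiff ℝ 1 ρ := hρ.1.of_le (by norm_cast)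
  have h1 := (hρ.2.hasFDerivAt_convolution_right
    (ContinuousLinearMap.lsmul ℝ ℝ).flip hu hρ1 x).fderiv
  have hd : fderiv ℝ (mollify ρ u) x v = ∫ t, u t * fderiv ℝ ρ (x - t) v := by
    unfold mollify
    rw [← convolution_flip, h1, convolution_precompR_apply _ hu (hρ.2.fderiv ℝ)
      (hρ1.continuous_fderiv one_ne_zero), convolution_def]
    simp [mul_comm]
  have hφ : IsTest fun t => ρ (x - t) :=
    ⟨hρ.1.comp (contDiff_const.sub contDiff_id), hρ.2.comp_homeomorph (Homeomorph.subLeft x)⟩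
  have hφd : ∀ t, fderiv ℝ (fun t => ρ (x - t)) t v = - fderiv ℝ ρ (x - t) v := by
    intro t
    have h1 := ((hρ1.differentiable one_ne_zero (x - t)).hasFDerivAt.comp t
      ((hasFDerivAt_id t).const_sub x)).fderiv
    simp only [Function.comp_def] at h1
    rw [h1]; simp
  have hw := h _ hφ v
  simp only [hφd, mul_neg, integral_neg, neg_inj] at hw
  rw [hd, hw, mollify_apply']
  have hi : Integrable fun t => ρ (x - t) • g t := by
    exact hg.integrable_smul_left_of_hasCompactSupport hφ.1.continuous hφ.2
  rw [real_inner_comm, ← integral_inner hi v]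
  refine integral_congr_ae (ae_of_all _ fun t => ?_)
  simp only [inner_smul_right, real_inner_comm v]
  rw [mul_comm]

/-! ### The Sobolev space: test functions and density -/

theorem IsTest.differentiable {φ : Space N → ℝ} (hφ : IsTest φ) : Differentiable ℝ φ :=
  hφ.1.differentiable (by simp)

theorem inner_gradient (φ : Space N → ℝ) (x v : Space N) :
    inner ℝ (gradient φ x) v = fderiv ℝ φ x v := by
  simp [gradient]

theorem IsTest.continuous_gradient {φ : Space N → ℝ} (hφ : IsTest φ) :
    Continuous (gradient φ) :=
  (InnerProductSpace.toDual ℝ (Space N)).symm.continuous.comp (hφ.1.continuous_fderiv (by simp))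

theorem IsTest.hasCompactSupport_gradient {φ : Space N → ℝ} (hφ : IsTest φ) :
    HasCompactSupport (gradient φ) :=
  (hφ.2.fderiv ℝ).comp_left (g := (InnerProductSpace.toDual ℝ (Space N)).symm) (map_zero _)

theorem IsTest.memLp_gradient {φ : Space N → ℝ} (hφ : IsTest φ) (r : ℝ≥0∞) :
    MemLp (gradient φ) r (volume : Measure (Space N)) :=
  hφ.continuous_gradient.memLp_of_hasCompactSupport hφ.hasCompactSupport_gradient

theorem IsTest.isWeakGradient {φ : Space N → ℝ} (hφ : IsTest φ) :
    IsWeakGradient φ (gradient φ) := by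
  intro ψ hψ v
  simp only [inner_gradient]
  refine integral_mul_fderiv_eq_neg_fderiv_mul_of_integrable ?_ ?_ ?_ ?_ ?_
  · exact (hφ.memLp_fderiv v).integrable_mul hψ.memLp
  · exact hφ.memLp.integrable_mul (hψ.memLp_fderiv v)
  · exact hφ.memLp.integrable_mul hψ.memLp
  · exact fun x _ => hφ.differentiable x
  · exact fun x _ => hψ.differentiable x

/-- A test function as an element of `H¹`, with its classical gradient. -/
def testH1 (φ : Space N → ℝ) (hφ : IsTest φ) : H1 N :=
  mkH1 φ (gradient φ) hφ.memLp (hφ.memLp_gradient 2) hφ.isWeakGradient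

theorem fn_mkH1 {f : Space N → ℝ} {g : Space N → Space N}
    (hf : MemLp f 2 (volume : Measure (Space N)))
    (hg : MemLp g 2 (volume : Measure (Space N))) (h : IsWeakGradient f g) :
    fn (mkH1 f g hf hg h) =ᵐ[volume] f := hf.coeFn_toLp

theorem grad_mkH1 {f : Space N → ℝ} {g : Space N → Space N}
    (hf : MemLp f 2 (volume : Measure (Space N)))
    (hg : MemLp g 2 (volume : Measure (Space N))) (h : IsWeakGradient f g) :
    grad (mkH1 f g hf hg h) =ᵐ[volume] g := hg.coeFn_toLp

theorem fn_testH1 {φ : Space N → ℝ} (hφ : IsTest φ) : fn (testH1 φ hφ) =ᵐ[volume] φ :=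
  fn_mkH1 _ _ _

theorem grad_testH1 {φ : Space N → ℝ} (hφ : IsTest φ) :
    grad (testH1 φ hφ) =ᵐ[volume] gradient φ := grad_mkH1 _ _ _

theorem memLp_fn (u : H1 N) : MemLp (fn u) 2 (volume : Measure (Space N)) := Lp.memLp u.1.fst

theorem memLp_grad (u : H1 N) : MemLp (grad u) 2 (volume : Measure (Space N)) := Lp.memLp u.1.snd

theorem isWeakGradient (u : H1 N) : IsWeakGradient (fn u) (grad u) := u.2

theorem fn_sub (u v : H1 N) : fn (u - v) =ᵐ[volume] fun x => fn u x - fn v x :=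
  Lp.coeFn_sub u.1.fst v.1.fst

theorem grad_sub (u v : H1 N) : grad (u - v) =ᵐ[volume] fun x => grad u x - grad v x :=
  Lp.coeFn_sub u.1.snd v.1.snd

theorem fn_add (u v : H1 N) : fn (u + v) =ᵐ[volume] fun x => fn u x + fn v x :=
  Lp.coeFn_add u.1.fst v.1.fst

theorem fn_smul (a : ℝ) (u : H1 N) : fn (a • u) =ᵐ[volume] fun x => a * fn u x :=
  Lp.coeFn_smul a u.1.fst

theorem eLpNorm_fn (u : H1 N) :
    eLpNorm (fn u) 2 (volume : Measure (Space N)) = ENNReal.ofReal ‖u.1.fst‖ := by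
  rw [Lp.norm_def, ENNReal.ofReal_toReal (Lp.eLpNorm_ne_top _)]; rfl

theorem eLpNorm_grad (u : H1 N) :
    eLpNorm (grad u) 2 (volume : Measure (Space N)) = ENNReal.ofReal ‖u.1.snd‖ := by
  rw [Lp.norm_def, ENNReal.ofReal_toReal (Lp.eLpNorm_ne_top _)]; rfl

theorem norm_sq_eq (u : H1 N) : ‖u‖ ^ 2 = ‖u.1.fst‖ ^ 2 + ‖u.1.snd‖ ^ 2 := by
  rw [← Submodule.norm_coe, WithLp.prod_norm_sq_eq_of_L2]

theorem norm_fst_le (u : H1 N) : ‖u.1.fst‖ ≤ ‖u‖ := by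
  refine le_of_sq_le_sq ?_ (norm_nonneg _)
  rw [norm_sq_eq]; linarith [sq_nonneg ‖u.1.snd‖]

theorem norm_snd_le (u : H1 N) : ‖u.1.snd‖ ≤ ‖u‖ := by
  refine le_of_sq_le_sq ?_ (norm_nonneg _)
  rw [norm_sq_eq]; linarith [sq_nonneg ‖u.1.fst‖]

theorem norm_le_add (u : H1 N) : ‖u‖ ≤ ‖u.1.fst‖ + ‖u.1.snd‖ := by
  refine le_of_sq_le_sq ?_ (by positivity)
  rw [norm_sq_eq]
  nlinarith [norm_nonneg u.1.fst, norm_nonneg u.1.snd]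

section Cutoff

/-- A fixed smooth cutoff, equal to one on the unit ball and supported in the ball of radius two. -/
def cutoff (N : ℕ) : ContDiffBump (0 : Space N) := ⟨1, 2, one_pos, one_lt_two⟩

/-- The cutoff `cutoff N` rescaled to the ball of radius `n + 1`. -/
def cutoffAt (N n : ℕ) (x : Space N) : ℝ := cutoff N (((n : ℝ) + 1)⁻¹ • x)

theorem isTest_cutoffAt (n : ℕ) : IsTest (cutoffAt N n) :=
  ⟨(cutoff N).contDiff.comp (contDiff_const_smul _),
    (cutoff N).hasCompactSupport.comp_smul (by positivity)⟩

theorem abs_cutoffAt_le (n : ℕ) (x : Space N) : |cutoffAt N n x| ≤ 1 := by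
  rw [cutoffAt, abs_of_nonneg (cutoff N).nonneg]; exact (cutoff N).le_one

theorem tendsto_cutoffAt (x : Space N) : Tendsto (fun n => cutoffAt N n x) atTop (𝓝 1) := by
  refine tendsto_const_nhds.congr' ?_
  filter_upwards [eventually_ge_atTop ⌈‖x‖⌉₊] with n hn
  symm
  refine (cutoff N).one_of_mem_closedBall ?_
  have h1 : ‖x‖ ≤ n := (Nat.le_ceil _).trans (by exact_mod_cast hn)
  simp only [mem_closedBall_zero_iff, norm_smul, cutoff]
  rw [Real.norm_of_nonneg (by positivity), inv_mul_le_one₀ (by positivity)]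
  linarith

theorem exists_norm_gradient_cutoffAt_le (N : ℕ) :
    ∃ C : ℝ, 0 ≤ C ∧ ∀ n (x : Space N), ‖gradient (cutoffAt N n) x‖ ≤ C * ((n : ℝ) + 1)⁻¹ := by
  have hc : Continuous (fderiv ℝ (cutoff N)) :=
    ((cutoff N).contDiff (n := 1)).continuous_fderiv one_ne_zero
  obtain ⟨C, hC⟩ := hc.bounded_above_of_compact_support ((cutoff N).hasCompactSupport.fderiv ℝ)
  refine ⟨C, (norm_nonneg _).trans (hC 0), fun n x => ?_⟩
  have : ‖gradient (cutoffAt N n) x‖ = ‖fderiv ℝ (cutoffAt N n) x‖ := by simp [gradient]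
  rw [this]
  have h2 : fderiv ℝ (cutoffAt N n) x
      = ((n : ℝ) + 1)⁻¹ • fderiv ℝ (cutoff N) (((n : ℝ) + 1)⁻¹ • x) :=
    fderiv_comp_smul ..
  rw [h2, norm_smul, Real.norm_of_nonneg (by positivity), mul_comm]
  gcongr
  exact hC _

theorem tendsto_eLpNorm_cutoffAt_smul_sub {F : Type*} [NormedAddCommGroup F] [NormedSpace ℝ F]
    {f : Space N → F} (hf : MemLp f 2 (volume : Measure (Space N))) :
    Tendsto (fun n => eLpNorm (fun x => cutoffAt N n x • f x - f x) 2
      (volume : Measure (Space N))) atTop (𝓝 0) := by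
  have key : Tendsto (fun n => ∫⁻ x, ‖cutoffAt N n x • f x - f x‖ₑ ^ 2) atTop
      (𝓝 (∫⁻ _ : Space N, 0)) := by
    refine tendsto_lintegral_of_dominated_convergence' (fun x => (2 * ‖f x‖ₑ) ^ 2) ?_ ?_ ?_ ?_
    · intro n
      exact ((((isTest_cutoffAt n).1.continuous.aestronglyMeasurable).smul
        hf.aestronglyMeasurable).sub hf.aestronglyMeasurable).enorm.pow_const 2
    · intro n
      refine ae_of_all _ fun x => ?_
      simp only
      gcongr
      rw [two_mul]
      refine (enorm_sub_le ..).trans ?_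
      gcongr
      rw [enorm_smul]
      calc _ ≤ 1 * ‖f x‖ₑ := by
            gcongr
            rw [Real.enorm_eq_ofReal_abs]
            exact ENNReal.ofReal_le_one.2 (abs_cutoffAt_le n x)
        _ = _ := one_mul _
    · simp only [mul_pow]
      rw [lintegral_const_mul' _ _ (by simp), ← eLpNorm_two_sq]
      exact ENNReal.mul_ne_top (by simp) (ENNReal.pow_ne_top hf.2.ne)
    · refine ae_of_all _ fun x => ?_
      have h1 : Tendsto (fun n => cutoffAt N n x • f x - f x) atTop (𝓝 0) := by
        simpa using ((tendsto_cutoffAt x).smul_const (f x)).sub_const (f x)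
      simpa [Function.comp_def] using (ENNReal.continuous_pow 2).tendsto _ |>.comp h1.enorm
  simp only [← eLpNorm_two_sq, lintegral_zero] at key
  have := (ENNReal.continuous_rpow_const (y := 1 / 2)).tendsto _ |>.comp key
  simp only [Function.comp_def] at this
  convert! this using 2
  · rw [← ENNReal.rpow_natCast, ← ENNReal.rpow_mul]; norm_num
  · simp

end Cutoff

/-- Smooth functions in `H¹` are approximated by test functions, by truncation. -/
theorem exists_isTest_near_of_contDiff {U : Space N → ℝ} {G : Space N → Space N}
    (hU : ContDiff ℝ ∞ U) (hG : ∀ x v, fderiv ℝ U x v = inner ℝ (G x) v)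
    (hU2 : MemLp U 2 (volume : Measure (Space N))) (hG2 : MemLp G 2 (volume : Measure (Space N)))
    {ε : ℝ≥0∞} (hε : ε ≠ 0) :
    ∃ φ : Space N → ℝ, IsTest φ ∧
      eLpNorm (fun x => φ x - U x) 2 (volume : Measure (Space N)) ≤ ε ∧
      eLpNorm (fun x => gradient φ x - G x) 2 (volume : Measure (Space N)) ≤ ε := by
  obtain ⟨C, hC0, hC⟩ := exists_norm_gradient_cutoffAt_le N
  have t1 := tendsto_eLpNorm_cutoffAt_smul_sub hU2
  have t2 := tendsto_eLpNorm_cutoffAt_smul_sub hG2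
  have t3 : Tendsto (fun n : ℕ => ENNReal.ofReal (C * ((n : ℝ) + 1)⁻¹)
      * eLpNorm U 2 (volume : Measure (Space N))) atTop (𝓝 0) := by
    have h0 : Tendsto (fun n : ℕ => C * ((n : ℝ) + 1)⁻¹) atTop (𝓝 0) := by
      simpa using (tendsto_one_div_add_atTop_nhds_zero_nat (𝕜 := ℝ)).const_mul C
    have h1 := ENNReal.tendsto_ofReal h0
    rw [ENNReal.ofReal_zero] at h1
    simpa using ENNReal.Tendsto.mul_const h1 (Or.inr hU2.2.ne)
  have t4 := t2.add t3
  rw [add_zero] at t4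
  have e1 := t1.eventually (Iic_mem_nhds (pos_iff_ne_zero.2 hε))
  have e2 := t4.eventually (Iic_mem_nhds (pos_iff_ne_zero.2 hε))
  obtain ⟨n, hn1, hn2⟩ := (e1.and e2).exists
  have hgr : ∀ x, gradient (fun x => cutoffAt N n x * U x) x
      = cutoffAt N n x • G x + U x • gradient (cutoffAt N n) x := by
    intro x
    refine ext_inner_right ℝ fun v => ?_
    rw [inner_gradient, inner_add_left, real_inner_smul_left, real_inner_smul_left, inner_gradient,
      ← hG, fderiv_fun_mul (isTest_cutoffAt n).differentiable.differentiableAt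
        (hU.differentiable (by simp)).differentiableAt]
    simp
  refine ⟨fun x => cutoffAt N n x * U x, ⟨(isTest_cutoffAt n).1.mul hU,
    (isTest_cutoffAt n).2.mul_right⟩, hn1, ?_⟩
  refine le_trans ?_ hn2
  have : (fun x => gradient (fun x => cutoffAt N n x * U x) x - G x)
      = (fun x => cutoffAt N n x • G x - G x) + fun x => U x • gradient (cutoffAt N n) x := by
    ext1 x; rw [hgr]; simp only [Pi.add_apply]; abel
  rw [this]
  refine (eLpNorm_add_le ?_ ?_ (by norm_num)).trans ?_
  · exact (((isTest_cutoffAt n).1.continuous.aestronglyMeasurable).smul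
        hG2.aestronglyMeasurable).sub hG2.aestronglyMeasurable
  · exact hU2.aestronglyMeasurable.smul
      (isTest_cutoffAt n).continuous_gradient.aestronglyMeasurable
  · gcongr
    refine eLpNorm_le_mul_eLpNorm_of_ae_le_mul (ae_of_all _ fun x => ?_) 2
    rw [norm_smul, mul_comm]
    gcongr
    exact hC n x

theorem exists_isTest_near (u : H1 N) {ε : ℝ≥0∞} (hε : ε ≠ 0) :
    ∃ φ : Space N → ℝ, IsTest φ ∧
      eLpNorm (fun x => φ x - fn u x) 2 (volume : Measure (Space N)) ≤ ε ∧
      eLpNorm (fun x => gradient φ x - grad u x) 2 (volume : Measure (Space N)) ≤ ε := by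
  have hε2 : ε / 2 ≠ 0 := by simp [hε]
  obtain ⟨δ₁, hδ₁, h₁⟩ := exists_eLpNorm_translate_sub_le (memLp_fn u) hε2
  obtain ⟨δ₂, hδ₂, h₂⟩ := exists_eLpNorm_translate_sub_le (memLp_grad u) hε2
  have hδ : 0 < min δ₁ δ₂ := lt_min hδ₁ hδ₂
  let b : ContDiffBump (0 : Space N) := ⟨min δ₁ δ₂ / 2, min δ₁ δ₂, by linarith, by linarith⟩
  let ρ : Space N → ℝ := b.normed volume
  have hρ : IsTest ρ := ⟨b.contDiff_normed, b.hasCompactSupport_normed⟩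
  have hsupp : ∀ s, ρ s ≠ 0 → ‖s‖ < min δ₁ δ₂ := by
    intro s hs
    have : s ∈ Function.support ρ := hs
    rw [b.support_normed_eq] at this
    exact mem_ball_zero_iff.1 this
  have n1 := eLpNorm_mollify_sub_le hρ.1.continuous hρ.2 b.nonneg_normed b.integral_normed
    (memLp_fn u) (fun s hs => h₁ s ((hsupp s hs).trans_le (min_le_left _ _)))
  have n2 := eLpNorm_mollify_sub_le hρ.1.continuous hρ.2 b.nonneg_normed b.integral_normed
    (memLp_grad u) (fun s hs => h₂ s ((hsupp s hs).trans_le (min_le_right _ _)))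
  have lf : LocallyIntegrable (fn u) volume := (memLp_fn u).locallyIntegrable (by norm_num)
  have lg : LocallyIntegrable (grad u) volume := (memLp_grad u).locallyIntegrable (by norm_num)
  have aeU : Continuous (mollify ρ (fn u)) := (contDiff_mollify hρ lf).continuous
  have aeG : Continuous (mollify ρ (grad u)) :=
    hρ.2.continuous_convolution_left _ hρ.1.continuous lg
  by_cases hεt : ε = ⊤
  · exact ⟨0, ⟨contDiff_const, HasCompactSupport.zero⟩, by simp [hεt], by simp [hεt]⟩
  have m1 : MemLp (mollify ρ (fn u)) 2 (volume : Measure (Space N)) := by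
    have : MemLp (fun x => mollify ρ (fn u) x - fn u x) 2 (volume : Measure (Space N)) :=
      ⟨aeU.aestronglyMeasurable.sub (memLp_fn u).1,
        n1.trans_lt (ENNReal.div_lt_top hεt (by norm_num))⟩
    simpa [Pi.add_def] using this.add (memLp_fn u)
  have m2 : MemLp (mollify ρ (grad u)) 2 (volume : Measure (Space N)) := by
    have : MemLp (fun x => mollify ρ (grad u) x - grad u x) 2 (volume : Measure (Space N)) :=
      ⟨aeG.aestronglyMeasurable.sub (memLp_grad u).1,
        n2.trans_lt (ENNReal.div_lt_top hεt (by norm_num))⟩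
    simpa [Pi.add_def] using this.add (memLp_grad u)
  obtain ⟨φ, hφ, h3, h4⟩ := exists_isTest_near_of_contDiff (contDiff_mollify hρ lf)
    (fderiv_mollify hρ lf lg (isWeakGradient u)) m1 m2 hε2
  refine ⟨φ, hφ, ?_, ?_⟩
  · calc _ = eLpNorm ((fun x => φ x - mollify ρ (fn u) x)
          + fun x => mollify ρ (fn u) x - fn u x) 2 volume := by
            congr 1; ext x; simp
      _ ≤ ε / 2 + ε / 2 := (eLpNorm_add_le
          (hφ.1.continuous.sub aeU).aestronglyMeasurable
          (aeU.aestronglyMeasurable.sub (memLp_fn u).1) (by norm_num)).trans (add_le_add h3 n1)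
      _ = ε := ENNReal.add_halves ε
  · calc _ = eLpNorm ((fun x => gradient φ x - mollify ρ (grad u) x)
          + fun x => mollify ρ (grad u) x - grad u x) 2 volume := by
            congr 1; ext1 x; simp
      _ ≤ ε / 2 + ε / 2 := (eLpNorm_add_le
          (hφ.continuous_gradient.sub aeG).aestronglyMeasurable
          (aeG.aestronglyMeasurable.sub (memLp_grad u).1) (by norm_num)).trans (add_le_add h4 n2)
      _ = ε := ENNReal.add_halves ε

theorem denseRange_testH1 :
    DenseRange fun φ : {φ : Space N → ℝ // IsTest φ} => testH1 φ.1 φ.2 := by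
  refine Metric.denseRange_iff.2 fun u ε hε => ?_
  obtain ⟨φ, hφ, h1, h2⟩ := exists_isTest_near u (ε := ENNReal.ofReal (ε / 3))
    (by simpa using hε)
  refine ⟨⟨φ, hφ⟩, ?_⟩
  rw [dist_comm, dist_eq_norm]
  refine (norm_le_add _).trans_lt ?_
  have e1 : ‖(testH1 φ hφ - u).1.fst‖ ≤ ε / 3 := by
    rw [← ENNReal.ofReal_le_ofReal_iff (by positivity), ← eLpNorm_fn]
    refine le_trans (le_of_eq (eLpNorm_congr_ae ?_)) h1
    filter_upwards [fn_sub (testH1 φ hφ) u, fn_testH1 hφ] with x h3 h4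
    rw [h3, h4]
  have e2 : ‖(testH1 φ hφ - u).1.snd‖ ≤ ε / 3 := by
    rw [← ENNReal.ofReal_le_ofReal_iff (by positivity), ← eLpNorm_grad]
    refine le_trans (le_of_eq (eLpNorm_congr_ae ?_)) h2
    filter_upwards [grad_sub (testH1 φ hφ) u, grad_testH1 hφ] with x h3 h4
    rw [h3, h4]
  linarith

/-- Every element of `H¹` is the limit of test functions both in `H¹` and almost everywhere. -/
theorem exists_seq_isTest_tendsto (u : H1 N) :
    ∃ φ : ℕ → {φ : Space N → ℝ // IsTest φ},
      Tendsto (fun n => testH1 (φ n).1 (φ n).2) atTop (𝓝 u) ∧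
      ∀ᵐ x, Tendsto (fun n => (φ n).1 x) atTop (𝓝 (fn u x)) := by
  have hu := denseRange_testH1 (N := N) u
  obtain ⟨w, hw, hlim⟩ := mem_closure_iff_seq_limit.1 hu
  choose φ hφ using hw
  have hlim' : Tendsto (fun n => testH1 (φ n).1 (φ n).2) atTop (𝓝 u) := by
    simpa only [hφ] using hlim
  have hL : Tendsto (fun n => (testH1 (φ n).1 (φ n).2).1.fst) atTop (𝓝 u.1.fst) :=
    ((WithLp.prod_continuous_ofLp ..).fst.comp continuous_subtype_val).continuousAt.tendsto.comp
      hlim'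
  obtain ⟨ns, hns, hae⟩ := (tendstoInMeasure_of_tendsto_Lp hL).exists_seq_tendsto_ae
  refine ⟨fun n => φ (ns n), hlim'.comp hns.tendsto_atTop, ?_⟩
  have hall : ∀ᵐ x, ∀ n, fn (testH1 (φ (ns n)).1 (φ (ns n)).2) x = (φ (ns n)).1 x :=
    ae_all_iff.2 fun n => fn_testH1 _
  filter_upwards [hae, hall] with x h1 h2
  refine h1.congr fun n => ?_
  exact h2 n

/-! ### Sobolev inequalities -/

theorem eLpNorm_test_le {φ : Space N → ℝ} (hφ : IsTest φ) :
    eLpNorm φ 2 (volume : Measure (Space N)) ≤ ENNReal.ofReal ‖testH1 φ hφ‖ := by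
  rw [← eLpNorm_congr_ae (fn_testH1 hφ), eLpNorm_fn]
  exact ENNReal.ofReal_le_ofReal (norm_fst_le _)

theorem eLpNorm_fderiv_eq_gradient (φ : Space N → ℝ) (r : ℝ≥0∞) :
    eLpNorm (fderiv ℝ φ) r (volume : Measure (Space N)) = eLpNorm (gradient φ) r volume :=
  eLpNorm_congr_norm_ae (ae_of_all _ fun x => by simp [gradient])

theorem eLpNorm_gradient_test {φ : Space N → ℝ} (hφ : IsTest φ) :
    eLpNorm (gradient φ) 2 (volume : Measure (Space N))
      = ENNReal.ofReal ‖(testH1 φ hφ).1.snd‖ := by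
  rw [← eLpNorm_congr_ae (grad_testH1 hφ), eLpNorm_grad]

/-- The critical Gagliardo-Nirenberg-Sobolev inequality. -/
theorem exists_lintegral_enorm_rpow_test_le_of_three_le (hN : 3 ≤ N) :
    ∃ C : ℝ≥0, ∀ (φ : Space N → ℝ) (hφ : IsTest φ),
      ∫⁻ x, ‖φ x‖ₑ ^ (2 * (N : ℝ) / ((N : ℝ) - 2)) ≤
        C * ENNReal.ofReal ‖testH1 φ hφ‖ ^ (2 * (N : ℝ) / ((N : ℝ) - 2)) := by
  have hN' : (3 : ℝ) ≤ N := by exact_mod_cast hN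
  set R : ℝ := 2 * (N : ℝ) / ((N : ℝ) - 2) with hR
  have hR0 : 0 < R := div_pos (by linarith) (by linarith)
  let R' : ℝ≥0 := ⟨R, hR0.le⟩
  refine ⟨(SNormLESNormFDerivOfEqConst ℝ (volume : Measure (Space N)) 2) ^ R, fun φ hφ => ?_⟩
  have h := eLpNorm_le_eLpNorm_fderiv_of_eq (volume : Measure (Space N)) (u := φ) (F := ℝ)
    (hφ.1.of_le (by norm_cast)) hφ.2 (p := 2) (p' := R') (by norm_num) (by simp; omega)
    (by
      change R⁻¹ = _
      rw [hR]
      simp only [finrank_euclideanSpace, Fintype.card_fin]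
      have : (N : ℝ) - 2 ≠ 0 := by linarith
      push_cast
      field_simp)
  have h2 := eLpNorm_nnreal_pow_eq_lintegral (μ := (volume : Measure (Space N))) (f := φ)
    (p := R') (by intro h; have := congrArg NNReal.toReal h; exact hR0.ne' this)
  change eLpNorm φ R' volume ^ R = ∫⁻ x, ‖φ x‖ₑ ^ R at h2
  rw [← h2, ENNReal.coe_rpow_of_nonneg _ hR0.le, ← ENNReal.mul_rpow_of_nonneg _ _ hR0.le]
  refine ENNReal.rpow_le_rpow (h.trans ?_) hR0.le
  push_cast
  gcongr
  rw [eLpNorm_fderiv_eq_gradient, eLpNorm_gradient_test hφ]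
  exact ENNReal.ofReal_le_ofReal (norm_snd_le _)

/-- The Gagliardo-Nirenberg inequality with exponent one, applied to a power of a test function. -/
theorem exists_eLpNorm_pow_test_le (hN : 2 ≤ N) :
    ∃ C : ℝ≥0, ∀ (m : ℕ) (φ : Space N → ℝ), IsTest φ →
      eLpNorm (fun x => φ x ^ (m + 1)) (NNReal.conjExponent N) (volume : Measure (Space N)) ≤
        C * (m + 1) * eLpNorm (fun x => φ x ^ m) 2 volume * eLpNorm (gradient φ) 2 volume := by
  have hconj : NNReal.HolderConjugate (Module.finrank ℝ (Space N)) (NNReal.conjExponent N) := by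
    rw [finrank_euclideanSpace, Fintype.card_fin]
    exact .conjExponent (by exact_mod_cast hN)
  refine ⟨eLpNormLESNormFDerivOneConst (volume : Measure (Space N)) (NNReal.conjExponent N),
    fun m φ hφ => ?_⟩
  have hcd : ContDiff ℝ 1 fun x => φ x ^ (m + 1) := (hφ.1.pow (m + 1)).of_le (by norm_cast)
  have hcs : HasCompactSupport fun x => φ x ^ (m + 1) :=
    hφ.2.comp_left (g := fun t : ℝ => t ^ (m + 1)) (by simp)
  refine (eLpNorm_le_eLpNorm_fderiv_one volume hcd hcs hconj).trans ?_
  rw [mul_assoc, mul_assoc]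
  gcongr
  have hd : fderiv ℝ (fun x => φ x ^ (m + 1))
      = fun x => (((m : ℝ) + 1) * φ x ^ m) • fderiv ℝ φ x := by
    ext1 x
    rw [fderiv_fun_pow _ (hφ.differentiable x)]
    simp
  rw [hd]
  have hb : eLpNorm (fun x => (((m : ℝ) + 1) * φ x ^ m) • fderiv ℝ φ x) 1
      (volume : Measure (Space N)) ≤ eLpNorm (fun x => ((m : ℝ) + 1) * φ x ^ m) 2 volume *
        eLpNorm (fderiv ℝ φ) 2 volume :=
    eLpNorm_smul_le_mul_eLpNorm (p := 2) (q := 2) (r := 1)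
      (f := fderiv ℝ φ) (φ := fun x => ((m : ℝ) + 1) * φ x ^ m)
      (hφ.1.continuous_fderiv (by simp)).aestronglyMeasurable
      (continuous_const.mul (hφ.1.continuous.pow m)).aestronglyMeasurable
  refine hb.trans ?_
  rw [eLpNorm_fderiv_eq_gradient, ← mul_assoc]
  gcongr
  have : eLpNorm (fun x => ((m : ℝ) + 1) * φ x ^ m) 2 (volume : Measure (Space N))
      = ‖(m : ℝ) + 1‖ₑ * eLpNorm (fun x => φ x ^ m) 2 volume :=
    by
    rw [← eLpNorm_const_smul]; rfl
  rw [this, Real.enorm_eq_ofReal (by positivity),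
    ENNReal.ofReal_add (by positivity) (by positivity)]
  simp

/-- In dimension two there is no critical exponent: the exponent-one Sobolev inequality is iterated
along the powers of `φ`. -/
theorem exists_lintegral_enorm_rpow_test_le_of_two (m : ℕ) :
    ∃ C : ℝ≥0, ∀ (φ : Space 2 → ℝ) (hφ : IsTest φ),
      ∫⁻ x, ‖φ x‖ₑ ^ (2 * ((m : ℝ) + 1)) ≤
        C * ENNReal.ofReal ‖testH1 φ hφ‖ ^ (2 * ((m : ℝ) + 1)) := by
  have hex : NNReal.conjExponent ((2 : ℕ) : ℝ≥0) = 2 := by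
    ext; simp [NNReal.conjExponent]; norm_num
  have key : ∃ C : ℝ≥0, ∀ (φ : Space 2 → ℝ) (hφ : IsTest φ),
      eLpNorm (fun x => φ x ^ (m + 1)) 2 (volume : Measure (Space 2)) ≤
        C * ENNReal.ofReal ‖testH1 φ hφ‖ ^ (m + 1) := by
    induction m with
    | zero => exact ⟨1, fun φ hφ => by simpa using eLpNorm_test_le hφ⟩
    | succ m ih =>
      obtain ⟨C, hC⟩ := ih
      obtain ⟨D, hD⟩ := exists_eLpNorm_pow_test_le (N := 2) le_rfl
      rw [hex] at hD
      refine ⟨D * (((m + 1 : ℕ) : ℝ≥0) + 1) * C, fun φ hφ => ?_⟩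
      refine (hD (m + 1) φ hφ).trans ?_
      rw [eLpNorm_gradient_test hφ]
      calc _ ≤ (D : ℝ≥0∞) * (((m + 1 : ℕ) : ℝ≥0∞) + 1) *
              (C * ENNReal.ofReal ‖testH1 φ hφ‖ ^ (m + 1)) * ENNReal.ofReal ‖testH1 φ hφ‖ := by
            gcongr
            · exact hC φ hφ
            · exact norm_snd_le _
        _ = _ := by push_cast; ring
  obtain ⟨C, hC⟩ := key
  refine ⟨C ^ 2, fun φ hφ => ?_⟩
  have e1 : ∫⁻ x, ‖φ x‖ₑ ^ (2 * ((m : ℝ) + 1))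
      = eLpNorm (fun x => φ x ^ (m + 1)) 2 (volume : Measure (Space 2)) ^ 2 := by
    rw [eLpNorm_two_sq]
    refine lintegral_congr fun x => ?_
    rw [enorm_pow, ← pow_mul, ← ENNReal.rpow_natCast]
    congr 1; push_cast; ring
  have e2 : ENNReal.ofReal ‖testH1 φ hφ‖ ^ (2 * ((m : ℝ) + 1))
      = (ENNReal.ofReal ‖testH1 φ hφ‖ ^ (m + 1)) ^ 2 := by
    rw [← pow_mul, ← ENNReal.rpow_natCast]
    congr 1; push_cast; ring
  rw [e1, e2]
  push_cast
  rw [← mul_pow]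
  gcongr
  exact hC φ hφ

/-- By density and Fatou's lemma, a Sobolev inequality for test functions extends to `H¹`. -/
theorem lintegral_enorm_rpow_le_of_test {r : ℝ} {C : ℝ≥0}
    (h : ∀ (φ : Space N → ℝ) (hφ : IsTest φ), ∫⁻ x, ‖φ x‖ₑ ^ r ≤
      C * ENNReal.ofReal ‖testH1 φ hφ‖ ^ r) (u : H1 N) :
    ∫⁻ x, ‖fn u x‖ₑ ^ r ≤ C * ENNReal.ofReal ‖u‖ ^ r := by
  obtain ⟨φ, hφ, hae⟩ := exists_seq_isTest_tendsto u
  have h1 : ∫⁻ x, ‖fn u x‖ₑ ^ r ≤ liminf (fun n => ∫⁻ x, ‖(φ n).1 x‖ₑ ^ r) atTop := by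
    refine le_trans (lintegral_mono_ae ?_) (lintegral_liminf_le' fun n =>
      ((φ n).2.1.continuous.measurable.enorm.pow_const r).aemeasurable)
    filter_upwards [hae] with x hx
    exact (((ENNReal.continuous_rpow_const (y := r)).tendsto _).comp hx.enorm).liminf_eq.ge
  have h2 : Tendsto (fun n => (C : ℝ≥0∞) * ENNReal.ofReal ‖testH1 (φ n).1 (φ n).2‖ ^ r) atTop
      (𝓝 (C * ENNReal.ofReal ‖u‖ ^ r)) := by
    refine ENNReal.Tendsto.const_mul ?_ (Or.inr ENNReal.coe_ne_top)
    exact ((ENNReal.continuous_rpow_const (y := r)).tendsto _).comp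
      (ENNReal.tendsto_ofReal hφ.norm)
  rw [← h2.liminf_eq]
  exact h1.trans (liminf_le_liminf (Eventually.of_forall fun n => h _ _))

theorem lintegral_enorm_rpow_interpolate {X F : Type*} [MeasurableSpace X] [NormedAddCommGroup F]
    {ν : Measure X} {f : X → F} (hf : AEStronglyMeasurable f ν) {r R : ℝ} (hr : 2 ≤ r)
    (hrR : r ≤ R) {M : ℝ≥0∞} {C : ℝ≥0} (h2 : ∫⁻ x, ‖f x‖ₑ ^ (2 : ℝ) ∂ν ≤ M ^ (2 : ℝ))
    (hR : ∫⁻ x, ‖f x‖ₑ ^ R ∂ν ≤ C * M ^ R) :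
    ∃ C' : ℝ≥0, C' = C ^ ((r - 2) / (R - 2)) ∧ ∫⁻ x, ‖f x‖ₑ ^ r ∂ν ≤ C' * M ^ r := by
  refine ⟨_, rfl, ?_⟩
  rcases hr.eq_or_lt with rfl | hr'
  · simpa using h2
  have hR2 : 0 < R - 2 := by linarith
  set s : ℝ := (r - 2) / (R - 2) with hs
  have hs0 : 0 ≤ s := div_nonneg (by linarith) hR2.le
  have hs1 : 0 ≤ 1 - s := by
    rw [sub_nonneg, hs, div_le_one hR2]; linarith
  have hsum : 2 * (1 - s) + R * s = r := by rw [hs]; field_simp; ring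
  have hH := ENNReal.lintegral_mul_norm_pow_le (μ := ν) (f := fun x => ‖f x‖ₑ ^ (2 : ℝ))
    (g := fun x => ‖f x‖ₑ ^ R) (hf.enorm.pow_const _) (hf.enorm.pow_const _) hs1 hs0 (by ring)
  have e : ∀ a : ℝ≥0∞, (a ^ (2 : ℝ)) ^ (1 - s) * (a ^ R) ^ s = a ^ r := by
    intro a
    rw [← ENNReal.rpow_mul, ← ENNReal.rpow_mul,
      ← ENNReal.rpow_add_of_nonneg _ _ (by positivity) (by nlinarith), hsum]
  simp only [e] at hH
  refine hH.trans ?_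
  calc _ ≤ (M ^ (2 : ℝ)) ^ (1 - s) * (C * M ^ R) ^ s := by gcongr
    _ = _ := by
      rw [ENNReal.mul_rpow_of_nonneg _ _ hs0, mul_left_comm, e, ENNReal.coe_rpow_of_nonneg _ hs0]

theorem lintegral_enorm_sq_fn (u : H1 N) :
    ∫⁻ x, ‖fn u x‖ₑ ^ (2 : ℝ) ≤ ENNReal.ofReal ‖u‖ ^ (2 : ℝ) := by
  have h1 : ∫⁻ x, ‖fn u x‖ₑ ^ (2 : ℝ) = eLpNorm (fn u) 2 volume ^ 2 := by
    rw [eLpNorm_two_sq]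
    simp only [← ENNReal.rpow_natCast]; norm_num
  rw [h1, eLpNorm_fn, ← ENNReal.rpow_natCast]
  push_cast
  gcongr
  exact norm_fst_le u

/-- The Sobolev embedding `H¹ ⊂ Lʳ` for `2 ≤ r ≤ 2*` (`r < ∞`). -/
theorem exists_sobolev (hN : 2 ≤ N) {r : ℝ} (hr : 2 ≤ r)
    (hr' : 3 ≤ N → r ≤ 2 * (N : ℝ) / ((N : ℝ) - 2)) :
    ∃ C : ℝ≥0, ∀ u : H1 N, ∫⁻ x, ‖fn u x‖ₑ ^ r ≤ C * ENNReal.ofReal ‖u‖ ^ r := by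
  obtain ⟨R, C, hrR, hC⟩ : ∃ (R : ℝ) (C : ℝ≥0), r ≤ R ∧ ∀ (φ : Space N → ℝ) (hφ : IsTest φ),
      ∫⁻ x, ‖φ x‖ₑ ^ R ≤ C * ENNReal.ofReal ‖testH1 φ hφ‖ ^ R := by
    rcases hN.eq_or_lt with rfl | hN3
    · obtain ⟨m, hm⟩ := exists_nat_ge r
      obtain ⟨C, hC⟩ := exists_lintegral_enorm_rpow_test_le_of_two m
      exact ⟨_, C, by linarith, hC⟩
    · obtain ⟨C, hC⟩ := exists_lintegral_enorm_rpow_test_le_of_three_le hN3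
      exact ⟨_, C, hr' hN3, hC⟩
  refine ⟨C ^ ((r - 2) / (R - 2)), fun u => ?_⟩
  obtain ⟨C', rfl, h⟩ := lintegral_enorm_rpow_interpolate (memLp_fn u).1 hr hrR
    (lintegral_enorm_sq_fn u) (lintegral_enorm_rpow_le_of_test hC u)
  exact h

/-- An `H¹` function with vanishing gradient is zero: the exponent-one Sobolev inequality for
`φ²` has `‖∇φ‖₂` as a factor on its right side. -/
theorem fn_ae_eq_zero_of_snd_eq_zero (hN : 2 ≤ N) {u : H1 N} (hu : u.1.snd = 0) :
    fn u =ᵐ[volume] 0 := by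
  obtain ⟨C, hC⟩ := exists_eLpNorm_pow_test_le hN
  obtain ⟨φ, hφ, hae⟩ := exists_seq_isTest_tendsto u
  have hn : ∀ n, eLpNorm (fun x => (φ n).1 x ^ 2) (NNReal.conjExponent N)
      (volume : Measure (Space N)) ≤ C * 2 * ENNReal.ofReal ‖testH1 (φ n).1 (φ n).2‖ *
        ENNReal.ofReal ‖(testH1 (φ n).1 (φ n).2).1.snd‖ := by
    intro n
    refine (hC 1 (φ n).1 (φ n).2).trans ?_
    rw [eLpNorm_gradient_test (φ n).2]
    have : (((1 : ℕ) : ℝ≥0∞) + 1) = 2 := by norm_num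
    rw [this]
    gcongr
    simpa using eLpNorm_test_le (φ n).2
  have hsnd : Tendsto (fun n => (testH1 (φ n).1 (φ n).2).1.snd) atTop (𝓝 u.1.snd) :=
    ((WithLp.prod_continuous_ofLp ..).snd.comp continuous_subtype_val).continuousAt.tendsto.comp
      hφ
  have hlim : Tendsto (fun n => (C : ℝ≥0∞) * 2 * ENNReal.ofReal ‖testH1 (φ n).1 (φ n).2‖ *
        ENNReal.ofReal ‖(testH1 (φ n).1 (φ n).2).1.snd‖) atTop (𝓝 0) := by
    have h1 := ENNReal.tendsto_ofReal hφ.norm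
    have h2 := ENNReal.tendsto_ofReal hsnd.norm
    rw [hu, norm_zero] at h2
    have h3 := ENNReal.Tendsto.mul
      (ENNReal.Tendsto.const_mul (a := (C : ℝ≥0∞) * 2) h1 (Or.inr (by finiteness)))
      (Or.inr (by simp)) h2 (Or.inr (by finiteness))
    simpa using h3
  have hfat := Lp.eLpNorm_lim_le_liminf_eLpNorm (p := (NNReal.conjExponent N : ℝ≥0∞))
    (μ := (volume : Measure (Space N))) (f := fun n x => (φ n).1 x ^ 2)
    (fun n => ((φ n).2.1.continuous.pow 2).aestronglyMeasurable) (fun x => fn u x ^ 2)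
    (by filter_upwards [hae] with x hx using hx.pow 2)
  have hzero : eLpNorm (fun x => fn u x ^ 2) (NNReal.conjExponent N)
      (volume : Measure (Space N)) = 0 := by
    refine le_antisymm (hfat.trans ?_) zero_le
    rw [← hlim.liminf_eq]
    exact liminf_le_liminf (Eventually.of_forall hn)
  rw [eLpNorm_eq_zero_iff (f := fun x => fn u x ^ 2) ((memLp_fn u).1.pow 2)] at hzero
  · filter_upwards [hzero] with x hx
    simpa using hx
  · have hc : NNReal.HolderConjugate N (NNReal.conjExponent N) :=
      .conjExponent (by exact_mod_cast hN)
    exact_mod_cast hc.symm.ne_zero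

/-! ### Riesz kernels and a Hardy-Littlewood-Sobolev type bound -/

/-- Young's convolution inequality in trilinear form, from Hölder's inequality with three
factors. -/
theorem young_trilinear {w f g : Space N → ℝ≥0∞} (hw : Measurable w) (hf : AEMeasurable f volume)
    (hg : AEMeasurable g volume) {a r : ℝ} (ha : 1 ≤ a) (hr : 1 ≤ r) (har : 2 / r + 1 / a = 2) :
    ∫⁻ z : Space N × Space N, w (z.1 - z.2) * (f z.1 * g z.2) ≤
      (∫⁻ x, w x ^ a) ^ (1 / a) * ((∫⁻ x, f x ^ r) ^ (1 / r) * (∫⁻ x, g x ^ r) ^ (1 / r)) := by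
  have ha0 : 0 < a := by linarith
  have hr0 : 0 < r := by linarith
  have ea : 0 ≤ 1 - 1 / a := by rw [sub_nonneg, div_le_one ha0]; exact ha
  have er : 0 ≤ 1 - 1 / r := by rw [sub_nonneg, div_le_one hr0]; exact hr
  have hra : 2 * (1 / r) + 1 / a = 2 := by
    rw [mul_one_div]; exact har
  have hf1 : AEMeasurable (fun z : Space N × Space N => f z.1 ^ r) (volume.prod volume) :=
    (hf.comp_quasiMeasurePreserving Measure.quasiMeasurePreserving_fst).pow_const r
  have hg1 : AEMeasurable (fun z : Space N × Space N => g z.2 ^ r) (volume.prod volume) :=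
    (hg.comp_quasiMeasurePreserving Measure.quasiMeasurePreserving_snd).pow_const r
  have hw1 : AEMeasurable (fun z : Space N × Space N => w (z.1 - z.2) ^ a)
      (volume.prod volume) :=
    ((hw.comp (measurable_fst.sub measurable_snd)).pow_const a).aemeasurable
  let F : Fin 3 → Space N × Space N → ℝ≥0∞ := ![fun z => f z.1 ^ r * g z.2 ^ r,
    fun z => f z.1 ^ r * w (z.1 - z.2) ^ a, fun z => w (z.1 - z.2) ^ a * g z.2 ^ r]
  let e : Fin 3 → ℝ := ![1 - 1 / a, 1 - 1 / r, 1 - 1 / r]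
  have hF : ∀ i ∈ Finset.univ, AEMeasurable (F i) (volume.prod volume) := by
    intro i _
    fin_cases i
    · exact hf1.mul hg1
    · exact hf1.mul hw1
    · exact hw1.mul hg1
  have H := ENNReal.lintegral_prod_norm_pow_le (μ := (volume : Measure (Space N)).prod volume)
    Finset.univ hF (p := e) (by
      simp only [Fin.sum_univ_three, e, Matrix.cons_val_zero, Matrix.cons_val_one, Matrix.cons_val]
      linarith)
    (by intro i _; fin_cases i <;> simp [e] <;> first | simpa using ea | simpa using er)
  have hpt : ∀ z : Space N × Space N, ∏ i, F i z ^ e i = w (z.1 - z.2) * (f z.1 * g z.2) := by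
    intro z
    simp only [Fin.prod_univ_three, F, e, Matrix.cons_val_zero, Matrix.cons_val_one,
      Matrix.cons_val]
    rw [ENNReal.mul_rpow_of_nonneg _ _ ea, ENNReal.mul_rpow_of_nonneg _ _ er,
      ENNReal.mul_rpow_of_nonneg _ _ er]
    simp only [← ENNReal.rpow_mul]
    have h1 : f z.1 ^ (r * (1 - 1 / a)) * f z.1 ^ (r * (1 - 1 / r)) = f z.1 := by
      rw [← ENNReal.rpow_add_of_nonneg _ _ (by positivity) (by positivity)]
      convert! ENNReal.rpow_one _
      rw [← mul_add, show 1 - 1 / a + (1 - 1 / r) = 1 / r by linarith, mul_one_div_cancel hr0.ne']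
    have h2 : g z.2 ^ (r * (1 - 1 / a)) * g z.2 ^ (r * (1 - 1 / r)) = g z.2 := by
      rw [← ENNReal.rpow_add_of_nonneg _ _ (by positivity) (by positivity)]
      convert! ENNReal.rpow_one _
      rw [← mul_add, show 1 - 1 / a + (1 - 1 / r) = 1 / r by linarith, mul_one_div_cancel hr0.ne']
    have h3 : w (z.1 - z.2) ^ (a * (1 - 1 / r)) * w (z.1 - z.2) ^ (a * (1 - 1 / r))
        = w (z.1 - z.2) := by
      rw [← ENNReal.rpow_add_of_nonneg _ _ (by positivity) (by positivity)]
      convert! ENNReal.rpow_one _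
      rw [← mul_add, show 1 - 1 / r + (1 - 1 / r) = 1 / a by linarith, mul_one_div_cancel ha0.ne']
    calc _ = (w (z.1 - z.2) ^ (a * (1 - 1 / r)) * w (z.1 - z.2) ^ (a * (1 - 1 / r))) *
          ((f z.1 ^ (r * (1 - 1 / a)) * f z.1 ^ (r * (1 - 1 / r))) *
            (g z.2 ^ (r * (1 - 1 / a)) * g z.2 ^ (r * (1 - 1 / r)))) := by ring
      _ = _ := by rw [h1, h2, h3]
  simp only [hpt] at H
  refine H.trans (le_of_eq ?_)
  simp only [Fin.prod_univ_three, F, e, Matrix.cons_val_zero, Matrix.cons_val_one,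
      Matrix.cons_val]
  have i0 : ∫⁻ z : Space N × Space N, f z.1 ^ r * g z.2 ^ r ∂(volume.prod volume)
      = (∫⁻ x, f x ^ r) * ∫⁻ x, g x ^ r :=
    lintegral_prod_mul (hf.pow_const r) (hg.pow_const r)
  have i1 : ∫⁻ z : Space N × Space N, f z.1 ^ r * w (z.1 - z.2) ^ a ∂(volume.prod volume)
      = (∫⁻ x, f x ^ r) * ∫⁻ x, w x ^ a := by
    rw [lintegral_prod (fun z : Space N × Space N => f z.1 ^ r * w (z.1 - z.2) ^ a) (hf1.mul hw1)]
    have : ∀ x : Space N, ∫⁻ y, f x ^ r * w (x - y) ^ a = f x ^ r * ∫⁻ y, w y ^ a := by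
      intro x
      rw [lintegral_const_mul (f := fun y => w (x - y) ^ a) _
          ((hw.comp (measurable_const.sub measurable_id)).pow_const a),
        lintegral_sub_left_eq_self (fun y => w y ^ a) x]
    simp only [this]
    rw [lintegral_mul_const'' _ (hf.pow_const r)]
  have i2 : ∫⁻ z : Space N × Space N, w (z.1 - z.2) ^ a * g z.2 ^ r ∂(volume.prod volume)
      = (∫⁻ x, w x ^ a) * ∫⁻ x, g x ^ r := by
    rw [lintegral_prod_symm (fun z : Space N × Space N => w (z.1 - z.2) ^ a * g z.2 ^ r)
      (hw1.mul hg1)]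
    have : ∀ y : Space N, ∫⁻ x, w (x - y) ^ a * g y ^ r = (∫⁻ x, w x ^ a) * g y ^ r := by
      intro y
      rw [lintegral_mul_const (f := fun x => w (x - y) ^ a) _
        ((hw.comp (measurable_id.sub measurable_const)).pow_const a)]
      congr 1
      exact lintegral_sub_right_eq_self (fun y => w y ^ a) y
    simp only [this]
    rw [lintegral_const_mul'' _ (hg.pow_const r)]
  rw [i0, i1, i2, ENNReal.mul_rpow_of_nonneg _ _ ea, ENNReal.mul_rpow_of_nonneg _ _ er,
      ENNReal.mul_rpow_of_nonneg _ _ er]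
  have j : ∀ t : ℝ≥0∞, t ^ (1 / r) = t ^ (1 - 1 / a) * t ^ (1 - 1 / r) := fun t => by
    rw [← ENNReal.rpow_add_of_nonneg _ _ ea er]
    congr 1; linarith
  have j' : ∀ t : ℝ≥0∞, t ^ (1 / a) = t ^ (1 - 1 / r) * t ^ (1 - 1 / r) := fun t => by
    rw [← ENNReal.rpow_add_of_nonneg _ _ er er]
    congr 1; linarith
  rw [j (∫⁻ x, f x ^ r), j (∫⁻ x, g x ^ r), j' (∫⁻ x, w x ^ a)]
  ring

theorem integrableOn_norm_rpow_ball (hN : 1 ≤ N) {s : ℝ} (hs : s < N) :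
    IntegrableOn (fun x : Space N => ‖x‖ ^ (-s)) (Metric.ball 0 1) := by
  have : Nonempty (Fin N) := ⟨⟨0, hN⟩⟩
  have h := (integrable_fun_norm_addHaar (volume : Measure (Space N))
    (f := (Iio (1 : ℝ)).indicator fun y => y ^ (-s))).2 ?_
  · rw [← integrable_indicator_iff measurableSet_ball]
    refine h.congr (ae_of_all _ fun x => ?_)
    by_cases hx : ‖x‖ < 1
    · simp [indicator, hx]
    · simp [indicator, hx]
  · rw [finrank_euclideanSpace, Fintype.card_fin]
    have h1 : IntegrableOn (fun y : ℝ => y ^ ((N : ℝ) - 1 - s)) (Ioo 0 1) :=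
      (intervalIntegral.integrableOn_Ioo_rpow_iff one_pos).2 (by linarith)
    have h2 : IntegrableOn (fun y : ℝ => y ^ (N - 1) • (Iio (1 : ℝ)).indicator
        (fun y => y ^ (-s)) y) (Ioo 0 1) := by
      refine h1.congr_fun (fun y hy => ?_) measurableSet_Ioo
      simp only [indicator, mem_Iio, hy.2, if_true, smul_eq_mul]
      rw [← Real.rpow_natCast, ← Real.rpow_add hy.1, Nat.cast_sub hN, Nat.cast_one,
        sub_eq_add_neg (_ - _)]
    refine h2.of_forall_sdiff_eq_zero measurableSet_Ioi fun y hy => ?_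
    have : ¬ y < 1 := fun h => hy.2 ⟨hy.1, h⟩
    simp [indicator, this]

theorem integrableOn_norm_rpow_compl_ball (hN : 1 ≤ N) {s : ℝ} (hs : (N : ℝ) < s) :
    IntegrableOn (fun x : Space N => ‖x‖ ^ (-s)) (Metric.ball 0 1)ᶜ := by
  have : Nonempty (Fin N) := ⟨⟨0, hN⟩⟩
  have h := (integrable_fun_norm_addHaar (volume : Measure (Space N))
    (f := (Ici (1 : ℝ)).indicator fun y => y ^ (-s))).2 ?_
  · rw [← integrable_indicator_iff measurableSet_ball.compl]
    refine h.congr (ae_of_all _ fun x => ?_)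
    by_cases hx : ‖x‖ < 1
    · simp [indicator, hx]
    · simp [indicator, hx, not_lt.1 hx]
  · rw [finrank_euclideanSpace, Fintype.card_fin]
    have h1 : IntegrableOn (fun y : ℝ => y ^ ((N : ℝ) - 1 - s)) (Ici 1) :=
      (integrableOn_Ici_iff_integrableOn_Ioi (by simp)).2
        (integrableOn_Ioi_rpow_of_lt (by linarith) one_pos)
    have h2 : IntegrableOn (fun y : ℝ => y ^ (N - 1) • (Ici (1 : ℝ)).indicator
        (fun y => y ^ (-s)) y) (Ici 1) := by
      refine h1.congr_fun (fun y hy => ?_) measurableSet_Ici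
      have hy0 : 0 < y := lt_of_lt_of_le one_pos hy
      simp only [indicator, hy, if_true, smul_eq_mul]
      rw [← Real.rpow_natCast, ← Real.rpow_add hy0, Nat.cast_sub hN, Nat.cast_one,
        sub_eq_add_neg (_ - _)]
    refine h2.of_forall_sdiff_eq_zero measurableSet_Ioi fun y hy => ?_
    have : ¬ 1 ≤ y := fun h => hy.2 h
    simp [indicator, this]

/-- The normalising constant of the Riesz kernel. -/
def rieszConst (N : ℕ) (α : ℝ) : ℝ :=
  Real.Gamma (((N : ℝ) - α) / 2) /
    (Real.pi ^ ((N : ℝ) / 2) * (2 : ℝ) ^ α * Real.Gamma (α / 2))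

theorem rieszConst_pos {α : ℝ} (hα : 0 < α) (hαN : α < N) : 0 < rieszConst N α := by
  unfold rieszConst
  have h1 := Real.Gamma_pos_of_pos (show 0 < ((N : ℝ) - α) / 2 by linarith)
  have h2 := Real.Gamma_pos_of_pos (show 0 < α / 2 by linarith)
  have := Real.pi_pos
  positivity

theorem rieszKernel_eq (α : ℝ) (x : Space N) :
    rieszKernel α x = rieszConst N α * ‖x‖ ^ (-((N : ℝ) - α)) := by
  rw [Real.rpow_neg (norm_nonneg _), ← div_eq_mul_inv]; rfl

theorem rieszKernel_nonneg {α : ℝ} (hα : 0 < α) (hαN : α < N) (x : Space N) :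
    0 ≤ rieszKernel α x := by
  rw [rieszKernel_eq]
  have := rieszConst_pos hα hαN
  positivity

theorem measurable_rieszKernel (α : ℝ) : Measurable (rieszKernel α : Space N → ℝ) := by
  have : (rieszKernel α : Space N → ℝ) = fun x => rieszConst N α * ‖x‖ ^ (-((N : ℝ) - α)) :=
    funext (rieszKernel_eq α)
  rw [this]
  fun_prop

theorem rieszKernel_neg (α : ℝ) (x : Space N) : rieszKernel α (-x) = rieszKernel α x := by
  simp [rieszKernel]

/-- The Riesz interaction energy `∬ I_α(x - y) f(x) g(y) dx dy` of two nonnegative functions. -/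
def interaction (α : ℝ) (f g : Space N → ℝ≥0∞) : ℝ≥0∞ :=
  ∫⁻ z : Space N × Space N, ENNReal.ofReal (rieszKernel α (z.1 - z.2)) * (f z.1 * g z.2)

/-- A substitute for the Hardy-Littlewood-Sobolev inequality. Splitting the kernel at the unit ball
and applying Young's inequality to each part costs two exponents on either side of the endpoint
`2N / (N + α)`. -/
theorem exists_interaction_le {α r₁ r₂ : ℝ} (hN : 1 ≤ N) (hα : 0 < α) (hαN : α < N)
    (hr₁ : 1 < r₁) (hr₁' : r₁ < 2 * N / (N + α)) (hr₂ : 2 * N / (N + α) < r₂) (hr₂' : r₂ < 2) :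
    ∃ C : ℝ≥0, ∀ f g : Space N → ℝ≥0∞, AEMeasurable f volume → AEMeasurable g volume →
      interaction α f g ≤
        C * ((∫⁻ x, f x ^ r₁) ^ (1 / r₁) * (∫⁻ x, g x ^ r₁) ^ (1 / r₁)
          + (∫⁻ x, f x ^ r₂) ^ (1 / r₂) * (∫⁻ x, g x ^ r₂) ^ (1 / r₂)) := by
  have hN0 : (0 : ℝ) < N := by exact_mod_cast hN
  have hβ : (0 : ℝ) < N - α := by linarith
  have hr₂0 : 1 < r₂ := by linarith
  set B : Set (Space N) := Metric.ball 0 1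
  set k : Space N → ℝ≥0∞ := fun x => ENNReal.ofReal (rieszKernel α x) with hk
  have hkm : Measurable k := (measurable_rieszKernel α).ennreal_ofReal
  have hB : MeasurableSet B := measurableSet_ball
  -- the `a`-th power of the kernel is integrable on `A` as soon as the power of the norm is
  have hpow : ∀ (A : Set (Space N)) (a : ℝ), MeasurableSet A → 0 < a →
      IntegrableOn (fun x : Space N => ‖x‖ ^ (-(((N : ℝ) - α) * a))) A →
      (∫⁻ x, (A.indicator k x) ^ a) ≠ ⊤ := by
    intro A a hA ha hint
    have e1 : ∀ x, (A.indicator k x) ^ a = A.indicator (fun x => ENNReal.ofReal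
        (rieszConst N α ^ a * ‖x‖ ^ (-(((N : ℝ) - α) * a)))) x := by
      intro x
      by_cases hx : x ∈ A
      · simp only [indicator_of_mem hx, hk]
        rw [ENNReal.ofReal_rpow_of_nonneg (rieszKernel_nonneg hα hαN x) ha.le, rieszKernel_eq,
          Real.mul_rpow (rieszConst_pos hα hαN).le (by positivity),
          ← Real.rpow_mul (norm_nonneg _), neg_mul]
      · simp [indicator_of_notMem hx, ha]
    simp only [e1]
    rw [lintegral_indicator hA]
    exact (hint.const_mul _).lintegral_lt_top.ne
  have key : ∀ r : ℝ, 1 < r → r < 2 → 1 ≤ 1 / (2 - 2 / r) ∧ 2 / r + 1 / (1 / (2 - 2 / r)) = 2 := by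
    intro r h1 h2
    have h3 : 2 / r < 2 := by rw [div_lt_iff₀ (by linarith)]; linarith
    have h4 : 1 < 2 / r := by rw [lt_div_iff₀ (by linarith)]; linarith
    refine ⟨?_, by rw [one_div_one_div]; ring⟩
    rw [le_div_iff₀ (by linarith)]; linarith
  obtain ⟨a1, a2⟩ := key r₂ hr₂0 hr₂'
  obtain ⟨b1, b2⟩ := key r₁ hr₁ (by linarith)
  set a := 1 / (2 - 2 / r₂) with ha
  set b := 1 / (2 - 2 / r₁) with hb
  have hr : ∀ r : ℝ, 1 < r → r < 2 → (((N : ℝ) - α) * (1 / (2 - 2 / r)) - N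
      = (N + α) * (2 * N / (N + α) - r) / (2 * (r - 1))) := by
    intro r h1 h2
    have : r - 1 ≠ 0 := by linarith
    have h5 : (N : ℝ) + α ≠ 0 := by positivity
    have h6 : r ≠ 0 := by linarith
    have h7 : 2 - 2 / r ≠ 0 := by
      have h3 : 2 / r < 2 := by rw [div_lt_iff₀ (by linarith)]; linarith
      linarith
    have h8 : 2 - 2 / r = 2 * (r - 1) / r := by field_simp
    rw [h8]
    field_simp
    ring
  have hA : (∫⁻ x, (B.indicator k x) ^ a) ≠ ⊤ := by
    refine hpow B a hB (by linarith) (integrableOn_norm_rpow_ball hN ?_)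
    have := hr r₂ hr₂0 hr₂'
    have h2 : (N + α) * (2 * N / (N + α) - r₂) / (2 * (r₂ - 1)) < 0 :=
      div_neg_of_neg_of_pos (mul_neg_of_pos_of_neg (by positivity) (by linarith)) (by linarith)
    linarith
  have hA' : (∫⁻ x, (Bᶜ.indicator k x) ^ b) ≠ ⊤ := by
    refine hpow Bᶜ b hB.compl (by linarith) (integrableOn_norm_rpow_compl_ball hN ?_)
    have := hr r₁ hr₁ (by linarith)
    have h2 : 0 < (N + α) * (2 * N / (N + α) - r₁) / (2 * (r₁ - 1)) :=
      div_pos (mul_pos (by positivity) (by linarith)) (by linarith)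
    linarith
  set CA := (∫⁻ x, (B.indicator k x) ^ a) ^ (1 / a)
  set CB := (∫⁻ x, (Bᶜ.indicator k x) ^ b) ^ (1 / b)
  have hCA : CA ≠ ⊤ := ENNReal.rpow_ne_top_of_nonneg (by positivity) hA
  have hCB : CB ≠ ⊤ := ENNReal.rpow_ne_top_of_nonneg (by positivity) hA'
  refine ⟨(CA + CB).toNNReal, fun f g hf hg => ?_⟩
  rw [ENNReal.coe_toNNReal (by finiteness)]
  have hsplit : interaction α f g
      = (∫⁻ z : Space N × Space N, Bᶜ.indicator k (z.1 - z.2) * (f z.1 * g z.2))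
        + ∫⁻ z : Space N × Space N, B.indicator k (z.1 - z.2) * (f z.1 * g z.2) := by
    rw [← lintegral_add_left']
    · refine lintegral_congr fun z => ?_
      rw [← add_mul]
      congr 1
      exact (congrFun (indicator_compl_add_self B k) (z.1 - z.2)).symm
    · refine AEMeasurable.mul ?_ ?_
      · exact ((hkm.indicator hB.compl).comp (measurable_fst.sub measurable_snd)).aemeasurable
      · exact (hf.comp_quasiMeasurePreserving Measure.quasiMeasurePreserving_fst).mul
          (hg.comp_quasiMeasurePreserving Measure.quasiMeasurePreserving_snd)
  rw [hsplit, mul_add]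
  gcongr ?_ + ?_
  · refine (young_trilinear (hkm.indicator hB.compl) hf hg b1 hr₁.le b2).trans ?_
    gcongr
    exact le_add_self
  · refine (young_trilinear (hkm.indicator hB) hf hg a1 hr₂0.le a2).trans ?_
    gcongr
    exact le_self_add

/-! ### Interaction energies on `H¹` and positive definiteness of the Riesz kernel -/

/-- Hölder's inequality combined with the Sobolev embedding. -/
theorem exists_lintegral_rpow_mul_le (hN : 2 ≤ N) {p r : ℝ} (hp : 1 < p) (hr : 0 < r)
    (h2 : 2 ≤ p * r) (h2' : 3 ≤ N → p * r ≤ 2 * (N : ℝ) / ((N : ℝ) - 2)) :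
    ∃ C : ℝ≥0, ∀ a b : H1 N,
      (∫⁻ x, (‖fn a x‖ₑ ^ (p - 1) * ‖fn b x‖ₑ) ^ r) ^ (1 / r) ≤
        C * (ENNReal.ofReal ‖a‖ ^ (p - 1) * ENNReal.ofReal ‖b‖) := by
  obtain ⟨C, hC⟩ := exists_sobolev hN h2 h2'
  have hp0 : 0 < p := by linarith
  have hr' : 0 ≤ 1 / r := by positivity
  refine ⟨C ^ (1 / r), fun a b => ?_⟩
  have e1 : 0 ≤ (p - 1) / p := div_nonneg (by linarith) hp0.le
  have e2 : 0 ≤ 1 / p := by positivity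
  have e3 : (p - 1) / p + 1 / p = 1 := by field_simp; ring
  have H := ENNReal.lintegral_mul_norm_pow_le (μ := (volume : Measure (Space N)))
    (f := fun x => ‖fn a x‖ₑ ^ (p * r)) (g := fun x => ‖fn b x‖ₑ ^ (p * r))
    ((memLp_fn a).1.enorm.pow_const _) ((memLp_fn b).1.enorm.pow_const _) e1 e2 e3
  have hid : ∀ s t : ℝ≥0∞, (s ^ (p * r)) ^ ((p - 1) / p) * (t ^ (p * r)) ^ (1 / p)
      = (s ^ (p - 1) * t) ^ r := by
    intro s t
    rw [ENNReal.mul_rpow_of_nonneg _ _ hr.le]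
    simp only [← ENNReal.rpow_mul]
    congr 2 <;> field_simp
  simp only [hid] at H
  have : ∫⁻ x, (‖fn a x‖ₑ ^ (p - 1) * ‖fn b x‖ₑ) ^ r ≤
      C * (ENNReal.ofReal ‖a‖ ^ (p - 1) * ENNReal.ofReal ‖b‖) ^ r := by
    refine H.trans ?_
    refine (mul_le_mul' (ENNReal.rpow_le_rpow (hC a) e1)
      (ENNReal.rpow_le_rpow (hC b) e2)).trans_eq ?_
    generalize ENNReal.ofReal ‖a‖ = s, ENNReal.ofReal ‖b‖ = t
    rw [ENNReal.mul_rpow_of_nonneg _ _ e1, ENNReal.mul_rpow_of_nonneg _ _ e2, ← hid,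
      mul_mul_mul_comm, ← ENNReal.rpow_add_of_nonneg _ _ e1 e2, e3, ENNReal.rpow_one]
  refine (ENNReal.rpow_le_rpow this hr').trans_eq ?_
  generalize ENNReal.ofReal ‖a‖ ^ (p - 1) * ENNReal.ofReal ‖b‖ = m
  rw [ENNReal.mul_rpow_of_nonneg _ _ hr', ← ENNReal.rpow_mul,
    mul_one_div_cancel hr.ne', ENNReal.rpow_one, ENNReal.coe_rpow_of_nonneg _ hr']

set_option maxHeartbeats 1000000 in
/-- The Hardy-Littlewood-Sobolev estimate for products of powers of `H¹` functions. -/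
theorem exists_interaction_H1_le (hN : 2 ≤ N) {α p : ℝ} (hα : 0 < α) (hαN : α < N)
    (hp : ((N : ℝ) + α) / N < p) (hp' : 3 ≤ N → p < ((N : ℝ) + α) / ((N : ℝ) - 2)) :
    ∃ C : ℝ≥0, ∀ a b c d : H1 N,
      interaction α (fun x => ‖fn a x‖ₑ ^ (p - 1) * ‖fn b x‖ₑ)
        (fun x => ‖fn c x‖ₑ ^ (p - 1) * ‖fn d x‖ₑ) ≤
      C * ((ENNReal.ofReal ‖a‖ ^ (p - 1) * ENNReal.ofReal ‖b‖) *
        (ENNReal.ofReal ‖c‖ ^ (p - 1) * ENNReal.ofReal ‖d‖)) := by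
  have hN0 : (2 : ℝ) ≤ N := by exact_mod_cast hN
  have hp1 : 1 < p := lt_trans (by rw [lt_div_iff₀ (by linarith)]; linarith) hp
  set r : ℝ := 2 * N / (N + α) with hr
  have hr1 : 1 < r := by rw [hr, lt_div_iff₀ (by linarith)]; linarith
  have hr2 : r < 2 := by rw [hr, div_lt_iff₀ (by linarith)]; linarith
  have hpr : 2 / p < r := by
    rw [div_lt_iff₀ (by linarith)] at hp
    rw [hr, div_lt_div_iff₀ (by linarith) (by linarith)]; linarith
  have hpr' : 3 ≤ N → r < (2 * (N : ℝ) / ((N : ℝ) - 2)) / p := by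
    intro h
    have h3 : (3 : ℝ) ≤ N := by exact_mod_cast h
    have := hp' h
    rw [lt_div_iff₀ (by linarith)] at this
    rw [hr, div_div, div_lt_div_iff₀ (by linarith) (by nlinarith)]
    nlinarith
  -- exponents on either side of `2N / (N + α)` for which `p r₁` and `p r₂` are still
  -- Sobolev exponents
  obtain ⟨r₁, h11, h12, h13⟩ : ∃ r₁, 1 < r₁ ∧ r₁ < r ∧ 2 / p ≤ r₁ := by
    obtain ⟨t, ht1, ht2⟩ := exists_between (max_lt hr1 hpr)
    exact ⟨t, (le_max_left _ _).trans_lt ht1, ht2, ((le_max_right _ _).trans_lt ht1).le⟩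
  obtain ⟨r₂, h21, h22, h23⟩ : ∃ r₂, r < r₂ ∧ r₂ < 2 ∧
      (3 ≤ N → r₂ ≤ (2 * (N : ℝ) / ((N : ℝ) - 2)) / p) := by
    by_cases h : 3 ≤ N
    · obtain ⟨t, ht1, ht2⟩ := exists_between (lt_min hr2 (hpr' h))
      exact ⟨t, ht1, ht2.trans_le (min_le_left _ _), fun _ => (ht2.trans_le (min_le_right _ _)).le⟩
    · obtain ⟨t, ht1, ht2⟩ := exists_between hr2
      exact ⟨t, ht1, ht2, fun h' => absurd h' h⟩
  have hp0 : 0 < p := by linarith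
  obtain ⟨C, hC⟩ := exists_interaction_le (N := N) (by omega) hα hαN h11 h12 h21 h22
  obtain ⟨C₁, hC₁⟩ := exists_lintegral_rpow_mul_le hN (r := r₁) hp1 (by linarith)
    (by rwa [div_le_iff₀' hp0] at h13)
    (fun h => by
      have := h12.le.trans (hpr' h).le
      rwa [le_div_iff₀' hp0] at this)
  obtain ⟨C₂, hC₂⟩ := exists_lintegral_rpow_mul_le hN (r := r₂) hp1 (by linarith)
    (by
      have := hpr.le.trans h21.le
      rwa [div_le_iff₀' hp0] at this)
    (fun h => by
      have := h23 h
      rwa [le_div_iff₀' hp0] at this)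
  refine ⟨C * (C₁ * C₁ + C₂ * C₂), fun a b c d => ?_⟩
  have hm : ∀ a b : H1 N, AEMeasurable (fun x => ‖fn a x‖ₑ ^ (p - 1) * ‖fn b x‖ₑ) volume :=
    fun a b => ((memLp_fn a).1.enorm.pow_const _).mul (memLp_fn b).1.enorm
  refine (hC _ _ (hm a b) (hm c d)).trans ?_
  calc _ ≤ (C : ℝ≥0∞) * ((C₁ * (ENNReal.ofReal ‖a‖ ^ (p - 1) * ENNReal.ofReal ‖b‖)) *
          (C₁ * (ENNReal.ofReal ‖c‖ ^ (p - 1) * ENNReal.ofReal ‖d‖)) +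
          (C₂ * (ENNReal.ofReal ‖a‖ ^ (p - 1) * ENNReal.ofReal ‖b‖)) *
          (C₂ * (ENNReal.ofReal ‖c‖ ^ (p - 1) * ENNReal.ofReal ‖d‖))) := by
        exact mul_le_mul' le_rfl (add_le_add (mul_le_mul' (hC₁ a b) (hC₁ c d))
          (mul_le_mul' (hC₂ a b) (hC₂ c d)))
    _ = _ := by push_cast; ring

theorem ennreal_two_mul_le (a b : ℝ≥0∞) : 2 * (a * b) ≤ a * a + b * b := by
  wlog h : a ≤ b generalizing a b
  · rw [mul_comm a b, add_comm]
    exact this b a (le_of_not_ge h)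
  obtain ⟨c, rfl⟩ := exists_add_of_le h
  calc 2 * (a * (a + c)) ≤ 2 * (a * (a + c)) + c * c := le_self_add
    _ = _ := by ring

/-- A kernel which is a superposition of squares is positive definite. -/
theorem two_mul_lintegral_le_of_superposition {X Λ : Type*} [MeasurableSpace X]
    [MeasurableSpace Λ] {μ : Measure X} [SFinite μ] {ν : Measure Λ} [SFinite ν]
    {K : X × X → ℝ≥0∞} {W : Λ → ℝ≥0∞} {e : Λ × X → ℝ≥0∞} (hW : Measurable W) (he : Measurable e)
    (hK : ∀ᵐ z ∂μ.prod μ, K z = ∫⁻ l, W l * (e (l, z.1) * e (l, z.2)) ∂ν)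
    {f g : X → ℝ≥0∞} (hf : AEMeasurable f μ) (hg : AEMeasurable g μ) :
    2 * ∫⁻ z, K z * (f z.1 * g z.2) ∂μ.prod μ ≤
      ∫⁻ z, K z * (f z.1 * f z.2) ∂μ.prod μ + ∫⁻ z, K z * (g z.1 * g z.2) ∂μ.prod μ := by
  have key : ∀ f g : X → ℝ≥0∞, AEMeasurable f μ → AEMeasurable g μ →
      ∫⁻ z, K z * (f z.1 * g z.2) ∂μ.prod μ
        = ∫⁻ l, W l * ((∫⁻ x, e (l, x) * f x ∂μ) * ∫⁻ x, e (l, x) * g x ∂μ) ∂ν := by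
    intro f g hf hg
    have hez : ∀ i : X × X → X, Measurable i → Measurable fun q : (X × X) × Λ => e (q.2, i q.1) :=
      fun i hi => he.comp (measurable_snd.prodMk (hi.comp measurable_fst))
    have hfg : AEMeasurable (fun z : X × X => f z.1 * g z.2) (μ.prod μ) :=
      (hf.comp_quasiMeasurePreserving Measure.quasiMeasurePreserving_fst).mul
        (hg.comp_quasiMeasurePreserving Measure.quasiMeasurePreserving_snd)
    have hel : ∀ l, Measurable fun x => e (l, x) := fun l => he.comp measurable_prodMk_left
    calc ∫⁻ z, K z * (f z.1 * g z.2) ∂μ.prod μ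
        = ∫⁻ z, (∫⁻ l, W l * (e (l, z.1) * e (l, z.2)) * (f z.1 * g z.2) ∂ν) ∂μ.prod μ := by
          refine lintegral_congr_ae ?_
          filter_upwards [hK] with z hz
          rw [hz, lintegral_mul_const]
          exact hW.mul ((he.comp measurable_prodMk_right).mul (he.comp measurable_prodMk_right))
      _ = ∫⁻ l, (∫⁻ z, W l * (e (l, z.1) * e (l, z.2)) * (f z.1 * g z.2) ∂μ.prod μ) ∂ν := by
          refine lintegral_lintegral_swap ?_
          refine AEMeasurable.mul ?_
            (hfg.comp_quasiMeasurePreserving Measure.quasiMeasurePreserving_fst)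
          exact ((hW.comp measurable_snd).mul ((hez _ measurable_fst).mul
            (hez _ measurable_snd))).aemeasurable
      _ = _ := by
          refine lintegral_congr fun l => ?_
          rw [← lintegral_prod_mul (f := fun x => e (l, x) * f x) (g := fun x => e (l, x) * g x)
            ((hel l).aemeasurable.mul hf) ((hel l).aemeasurable.mul hg),
            ← lintegral_const_mul'']
          · refine lintegral_congr fun z => ?_
            ring
          · exact (((hel l).aemeasurable.mul hf).comp_quasiMeasurePreserving
              Measure.quasiMeasurePreserving_fst).mul (((hel l).aemeasurable.mul
              hg).comp_quasiMeasurePreserving Measure.quasiMeasurePreserving_snd)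
  have hm : ∀ f : X → ℝ≥0∞, AEMeasurable f μ →
      AEMeasurable (fun l => ∫⁻ x, e (l, x) * f x ∂μ) ν := by
    intro f hf
    exact AEMeasurable.lintegral_prod_right' (f := fun q : Λ × X => e q * f q.2)
      (he.aemeasurable.mul (hf.comp_quasiMeasurePreserving Measure.quasiMeasurePreserving_snd))
  rw [key f g hf hg, key f f hf hf, key g g hg hg, ← lintegral_const_mul' _ _ (by simp),
    ← lintegral_add_left' (f := fun l => W l * ((∫⁻ x, e (l, x) * f x ∂μ) *
      ∫⁻ x, e (l, x) * f x ∂μ)) (hW.aemeasurable.mul ((hm f hf).mul (hm f hf)))]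
  refine lintegral_mono fun l => ?_
  simp only
  rw [← mul_add, mul_left_comm]
  gcongr
  exact ennreal_two_mul_le _ _

/-- The total mass of the Gaussian `exp (-4 s |z|²)`. -/
def gaussMass (N : ℕ) (s : ℝ) : ℝ≥0∞ :=
  ∫⁻ z : Space N, ENNReal.ofReal (Real.exp (-(4 * s) * ‖z‖ ^ 2))

theorem gaussMass_ne_zero (N : ℕ) (s : ℝ) : gaussMass N s ≠ 0 := by
  rw [gaussMass, Ne, lintegral_eq_zero_iff (by fun_prop)]
  intro h
  have h2 : ∀ᵐ _ : Space N, False := by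
    filter_upwards [h] with z hz
    simp only [Pi.zero_apply, ENNReal.ofReal_eq_zero] at hz
    exact absurd hz (not_le.2 (Real.exp_pos _))
  exact NeZero.ne (volume : Measure (Space N)) (by simpa using h2)

theorem gaussMass_ne_top (N : ℕ) {s : ℝ} (hs : 0 < s) : gaussMass N s ≠ ⊤ := by
  have h := GaussianFourier.integral_rexp_neg_mul_sq_norm (V := Space N)
    (b := 4 * s) (by linarith)
  have hi : Integrable fun z : Space N => Real.exp (-(4 * s) * ‖z‖ ^ 2) := by
    by_contra hn
    rw [integral_undef hn] at h
    have : 0 < (Real.pi / (4 * s)) ^ ((Module.finrank ℝ (Space N) : ℝ) / 2) := by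
      have := Real.pi_pos
      positivity
    exact this.ne h
  exact hi.lintegral_lt_top.ne

/-- A Gaussian in `x - y` is a convolution square up to its mass, by the parallelogram law. -/
theorem lintegral_gauss_mul_gauss (s : ℝ) (x y : Space N) :
    ∫⁻ z, ENNReal.ofReal (Real.exp (-(2 * s) * ‖x - z‖ ^ 2)) *
      ENNReal.ofReal (Real.exp (-(2 * s) * ‖y - z‖ ^ 2)) =
    ENNReal.ofReal (Real.exp (-(s * ‖x - y‖ ^ 2))) * gaussMass N s := by
  rw [gaussMass, ← lintegral_sub_right_eq_self
      (fun z : Space N => ENNReal.ofReal (Real.exp (-(4 * s) * ‖z‖ ^ 2))) ((1 / 2 : ℝ) • (x + y)),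
    ← lintegral_const_mul' _ _ ENNReal.ofReal_ne_top]
  refine lintegral_congr fun z => ?_
  rw [← ENNReal.ofReal_mul (Real.exp_nonneg _), ← ENNReal.ofReal_mul (Real.exp_nonneg _),
    ← Real.exp_add, ← Real.exp_add]
  congr 2
  have e1 : x - y = (x - z) - (y - z) := by abel
  have e2 : z - (1 / 2 : ℝ) • (x + y) = -(1 / 2 : ℝ) • ((x - z) + (y - z)) := by
    module
  have e3 := parallelogram_law_with_norm ℝ (x - z) (y - z)
  rw [← e1] at e3
  rw [e2, norm_smul, mul_pow]
  norm_num
  linear_combination s * e3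

/-- By the Gamma integral the Riesz kernel is a superposition of Gaussians, hence of convolution
squares. -/
theorem rieszKernel_superposition {α : ℝ} (hα : 0 < α) (hαN : α < N) {x y : Space N} (h : x ≠ y) :
    ENNReal.ofReal (rieszKernel α (x - y)) =
      ∫⁻ l : ℝ × Space N, (ENNReal.ofReal (rieszConst N α / Real.Gamma ((N - α) / 2) *
          l.1 ^ (((N : ℝ) - α) / 2 - 1)) * (gaussMass N l.1)⁻¹) *
        (ENNReal.ofReal (Real.exp (-(2 * l.1) * ‖x - l.2‖ ^ 2)) *
          ENNReal.ofReal (Real.exp (-(2 * l.1) * ‖y - l.2‖ ^ 2)))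
        ∂((volume.restrict (Ioi 0)).prod volume) := by
  have hβ : 0 < ((N : ℝ) - α) / 2 := by linarith
  have hG := Real.Gamma_pos_of_pos hβ
  have hc := rieszConst_pos hα hαN
  have hxy : 0 < ‖x - y‖ := norm_pos_iff.2 (sub_ne_zero.2 h)
  have hm : Measurable (gaussMass N) := by
    unfold gaussMass
    exact Measurable.lintegral_prod_right' (f := fun q : ℝ × Space N =>
      ENNReal.ofReal (Real.exp (-(4 * q.1) * ‖q.2‖ ^ 2))) (by fun_prop)
  rw [lintegral_prod _ (by fun_prop)]
  have e1 : ∀ s ∈ Ioi (0 : ℝ), ∫⁻ z : Space N,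
      (ENNReal.ofReal (rieszConst N α / Real.Gamma ((N - α) / 2) *
          s ^ (((N : ℝ) - α) / 2 - 1)) * (gaussMass N s)⁻¹) *
        (ENNReal.ofReal (Real.exp (-(2 * s) * ‖x - z‖ ^ 2)) *
          ENNReal.ofReal (Real.exp (-(2 * s) * ‖y - z‖ ^ 2)))
      = ENNReal.ofReal (rieszConst N α / Real.Gamma ((N - α) / 2) *
          (s ^ (((N : ℝ) - α) / 2 - 1) * Real.exp (-(‖x - y‖ ^ 2 * s)))) := by
    intro s hs
    have hs : 0 < s := hs
    rw [lintegral_const_mul _ (by fun_prop), lintegral_gauss_mul_gauss, mul_assoc,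
      mul_comm (gaussMass N s)⁻¹, mul_assoc,
      ENNReal.mul_inv_cancel (gaussMass_ne_zero N s) (gaussMass_ne_top N hs), mul_one,
      ← ENNReal.ofReal_mul (by positivity)]
    congr 1
    rw [mul_comm s (‖x - y‖ ^ 2)]; ring
  rw [setLIntegral_congr_fun measurableSet_Ioi e1]
  have e2 := Real.integral_rpow_mul_exp_neg_mul_Ioi hβ (show 0 < ‖x - y‖ ^ 2 by positivity)
  have hi : IntegrableOn (fun s : ℝ => s ^ (((N : ℝ) - α) / 2 - 1) *
      Real.exp (-(‖x - y‖ ^ 2 * s))) (Ioi 0) := by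
    by_contra hn
    rw [integral_undef hn] at e2
    have : 0 < (1 / ‖x - y‖ ^ 2) ^ (((N : ℝ) - α) / 2) * Real.Gamma ((N - α) / 2) := by positivity
    exact this.ne e2
  rw [← ofReal_integral_eq_lintegral_ofReal (hi.const_mul _)
    ((ae_restrict_iff' measurableSet_Ioi).2 (ae_of_all _ fun s hs => by
      have hs : 0 < s := hs
      positivity)), integral_const_mul, e2, rieszKernel_eq]
  congr 1
  have : (1 / ‖x - y‖ ^ 2) ^ (((N : ℝ) - α) / 2) = ‖x - y‖ ^ (-((N : ℝ) - α)) := by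
    rw [one_div, ← Real.rpow_natCast, ← Real.rpow_neg hxy.le, ← Real.rpow_mul hxy.le]
    congr 1
    push_cast; ring
  rw [this]
  field_simp

/-- The Riesz kernel is positive definite. -/
theorem two_mul_interaction_le (hN : 1 ≤ N) {α : ℝ} (hα : 0 < α) (hαN : α < N)
    {f g : Space N → ℝ≥0∞} (hf : AEMeasurable f volume) (hg : AEMeasurable g volume) :
    2 * interaction α f g ≤ interaction α f f + interaction α g g := by
  have : Nonempty (Fin N) := ⟨⟨0, hN⟩⟩
  have hm : Measurable (gaussMass N) := by
    unfold gaussMass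
    exact Measurable.lintegral_prod_right' (f := fun q : ℝ × Space N =>
      ENNReal.ofReal (Real.exp (-(4 * q.1) * ‖q.2‖ ^ 2))) (by fun_prop)
  refine two_mul_lintegral_le_of_superposition (μ := (volume : Measure (Space N)))
    (ν := ((volume : Measure ℝ).restrict (Ioi 0)).prod (volume : Measure (Space N)))
    (W := fun l => ENNReal.ofReal (rieszConst N α / Real.Gamma ((N - α) / 2) *
          l.1 ^ (((N : ℝ) - α) / 2 - 1)) * (gaussMass N l.1)⁻¹)
    (e := fun q => ENNReal.ofReal (Real.exp (-(2 * q.1.1) * ‖q.2 - q.1.2‖ ^ 2)))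
    (by fun_prop) (by fun_prop) ?_ hf hg
  have hne : ∀ᵐ x : Space N, x ≠ 0 := by simp [ae_iff]
  filter_upwards [(quasiMeasurePreserving_sub_of_right_invariant (volume : Measure (Space N))
    volume).ae hne] with z hz
  exact rieszKernel_superposition hα hαN (sub_ne_zero.1 hz)

/-! ### Elementary inequalities for powers -/

/-- The odd power `|t|^(p-2) t`, which is `1/p` times the derivative of `|t|^p`. -/
def oddPow (p t : ℝ) : ℝ := |t| ^ (p - 2) * t

theorem abs_oddPow {p : ℝ} (hp : 1 < p) (t : ℝ) : |oddPow p t| = |t| ^ (p - 1) := by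
  unfold oddPow
  rw [abs_mul, abs_of_nonneg (Real.rpow_nonneg (abs_nonneg t) _)]
  rcases eq_or_ne t 0 with rfl | ht
  · simp [Real.zero_rpow (show p - 1 ≠ 0 by linarith)]
  · rw [← Real.rpow_add_one (abs_pos.2 ht).ne']; congr 1; ring

theorem measurable_oddPow (p : ℝ) : Measurable (oddPow p) := by
  unfold oddPow; fun_prop

theorem abs_rpow_sub_one_mul_abs {p : ℝ} (hp : 1 < p) (t : ℝ) : |t| ^ (p - 1) * |t| = |t| ^ p := by
  rcases eq_or_ne t 0 with rfl | ht
  · simp [Real.zero_rpow (show p ≠ 0 by linarith)]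
  · rw [← Real.rpow_add_one (abs_pos.2 ht).ne']; congr 1; ring

theorem one_add_mul_le_abs_one_add_rpow {p : ℝ} (hp : 1 < p) (s : ℝ) :
    1 + p * s ≤ |1 + s| ^ p := by
  rcases le_total (-1) s with h | h
  · rw [abs_of_nonneg (by linarith)]
    exact one_add_mul_self_le_rpow_one_add h hp.le
  · have : 0 ≤ |1 + s| ^ p := by positivity
    nlinarith

/-- The first order Taylor remainder of `|t|^p` at one: a small linear part near zero, and a part of
order `p` away from zero. -/
theorem exists_abs_one_add_rpow_le {p : ℝ} (hp : 1 < p) {ε : ℝ} (hε : 0 < ε) :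
    ∃ C : ℝ, 0 ≤ C ∧ ∀ s : ℝ, |1 + s| ^ p - 1 - p * s ≤ ε * |s| + C * |s| ^ p := by
  have hd : HasDerivAt (fun s : ℝ => (1 + s) ^ p) p 0 := by
    have := ((hasDerivAt_id (0 : ℝ)).const_add 1).rpow_const (p := p) (Or.inr hp.le)
    simpa using this
  rw [hasDerivAt_iff_isLittleO] at hd
  obtain ⟨δ, hδ, h⟩ := Metric.eventually_nhds_iff.1 (hd.def hε)
  set d := min δ 1 with hdd
  have hd0 : 0 < d := lt_min hδ one_pos
  refine ⟨(1 / d + 1) ^ p + p * d ^ (1 - p), by positivity, fun s => ?_⟩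
  rcases lt_or_ge |s| d with hs | hs
  · have h1 := h (y := s) (by
      rw [Real.dist_eq, sub_zero]; exact hs.trans_le (min_le_left _ _))
    simp only [sub_zero, add_zero, Real.one_rpow, smul_eq_mul, Real.norm_eq_abs] at h1
    have h2 : |s| < 1 := hs.trans_le (min_le_right _ _)
    rw [abs_of_pos (show 0 < 1 + s by linarith [neg_abs_le s])]
    have h3 := (le_abs_self _).trans h1
    have h4 : 0 ≤ ((1 / d + 1) ^ p + p * d ^ (1 - p)) * |s| ^ p := by positivity
    linarith
  · have hs0 : 0 < |s| := hd0.trans_le hs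
    have h1 : |1 + s| ≤ (1 / d + 1) * |s| := by
      have : 1 ≤ 1 / d * |s| := by rw [one_div, inv_mul_eq_div, le_div_iff₀ hd0]; linarith
      calc |1 + s| ≤ |1| + |s| := abs_add_le _ _
        _ = 1 + |s| := by simp
        _ ≤ _ := by linarith
    have h2 : |1 + s| ^ p ≤ (1 / d + 1) ^ p * |s| ^ p := by
      rw [← Real.mul_rpow (by positivity) hs0.le]
      exact Real.rpow_le_rpow (abs_nonneg _) h1 (by linarith)
    have h3 : |s| ≤ d ^ (1 - p) * |s| ^ p := by
      have e1 : |s| = |s| ^ (1 - p) * |s| ^ p := by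
        rw [← Real.rpow_add hs0]; simp
      calc |s| = |s| ^ (1 - p) * |s| ^ p := e1
        _ ≤ _ := by
          gcongr ?_ * _
          exact Real.rpow_le_rpow_of_nonpos hd0 hs (by linarith)
    have h4 : -(p * s) ≤ p * |s| := by
      have := mul_le_mul_of_nonneg_left (neg_abs_le s) (show 0 ≤ p by linarith)
      linarith
    have h5 : p * |s| ≤ p * (d ^ (1 - p) * |s| ^ p) := mul_le_mul_of_nonneg_left h3 (by linarith)
    have h6 : 0 ≤ ε * |s| := by positivity
    linarith

/-- Convexity of `|·| ^ p`. -/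
theorem abs_add_rpow_sub_nonneg {p : ℝ} (hp : 1 < p) (a h : ℝ) :
    0 ≤ |a + h| ^ p - |a| ^ p - p * (oddPow p a * h) := by
  rcases eq_or_ne a 0 with rfl | ha
  · simp [oddPow, Real.zero_rpow (show p ≠ 0 by linarith)]; positivity
  · have ha' : 0 < |a| := abs_pos.2 ha
    have e1 : |a + h| ^ p = |a| ^ p * |1 + h / a| ^ p := by
      rw [← Real.mul_rpow ha'.le (abs_nonneg _), ← abs_mul]; congr 2; field_simp
    have e2 : oddPow p a * h = |a| ^ p * (h / a) := by
      unfold oddPow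
      have : |a| ^ p = |a| ^ (p - 2) * a ^ 2 := by
        rw [← sq_abs, ← Real.rpow_natCast, ← Real.rpow_add ha']; simp
      rw [this]; field_simp
    rw [e1, e2]
    have := one_add_mul_le_abs_one_add_rpow hp (h / a)
    have h2 : 0 ≤ |a| ^ p * (|1 + h / a| ^ p - (1 + p * (h / a))) :=
      mul_nonneg (by positivity) (by linarith)
    linarith

/-- The remainder of the first-order expansion of `|·| ^ p` is small to first order in `h`, up to a
term of order `p`. -/
theorem exists_abs_add_rpow_sub_le {p : ℝ} (hp : 1 < p) {ε : ℝ} (hε : 0 < ε) :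
    ∃ C : ℝ, 0 ≤ C ∧ ∀ a h : ℝ, |a + h| ^ p - |a| ^ p - p * (oddPow p a * h) ≤
      ε * (|a| ^ (p - 1) * |h|) + C * (|h| ^ (p - 1) * |h|) := by
  obtain ⟨C, hC, H⟩ := exists_abs_one_add_rpow_le hp hε
  refine ⟨max C 1, by positivity, fun a h => ?_⟩
  rw [abs_rpow_sub_one_mul_abs hp h]
  rcases eq_or_ne a 0 with rfl | ha
  · simp only [oddPow, zero_add, abs_zero, Real.zero_rpow (show p ≠ 0 by linarith),
      Real.zero_rpow (show p - 1 ≠ 0 by linarith), mul_zero, zero_mul, sub_zero]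
    have : 0 ≤ |h| ^ p := by positivity
    nlinarith [le_max_right C 1]
  · have ha' : 0 < |a| := abs_pos.2 ha
    have e1 : |a + h| ^ p = |a| ^ p * |1 + h / a| ^ p := by
      rw [← Real.mul_rpow ha'.le (abs_nonneg _), ← abs_mul]; congr 2; field_simp
    have e2 : oddPow p a * h = |a| ^ p * (h / a) := by
      unfold oddPow
      have : |a| ^ p = |a| ^ (p - 2) * a ^ 2 := by
        rw [← sq_abs, ← Real.rpow_natCast, ← Real.rpow_add ha']; simp
      rw [this]; field_simp
    have e3 : |a| ^ p * |h / a| = |a| ^ (p - 1) * |h| := by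
      rw [← abs_rpow_sub_one_mul_abs hp a, abs_div]; field_simp
    have e4 : |a| ^ p * |h / a| ^ p = |h| ^ p := by
      rw [← Real.mul_rpow ha'.le (abs_nonneg _), abs_div]; congr 1; field_simp
    have h1 := mul_le_mul_of_nonneg_left (H (h / a)) (show 0 ≤ |a| ^ p by positivity)
    have h2 : C * |h| ^ p ≤ max C 1 * |h| ^ p := by gcongr; exact le_max_left _ _
    calc _ = |a| ^ p * (|1 + h / a| ^ p - 1 - p * (h / a)) := by rw [e1, e2]; ring
      _ ≤ _ := h1
      _ = ε * (|a| ^ p * |h / a|) + C * (|a| ^ p * |h / a| ^ p) := by ring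
      _ = ε * (|a| ^ (p - 1) * |h|) + C * |h| ^ p := by rw [e3, e4]
      _ ≤ _ := by linarith

theorem exists_abs_abs_add_rpow_sub_le {p : ℝ} (hp : 1 < p) :
    ∃ C : ℝ, 0 ≤ C ∧ ∀ a h : ℝ, |(|a + h| ^ p - |a| ^ p)| ≤
      C * (|a| ^ (p - 1) * |h| + |h| ^ (p - 1) * |h|) := by
  obtain ⟨C, hC, H⟩ := exists_abs_add_rpow_sub_le hp one_pos
  refine ⟨p + 1 + C, by linarith, fun a h => ?_⟩
  have h1 := H a h
  have h2 := abs_add_rpow_sub_nonneg hp a h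
  have h3 : |p * (oddPow p a * h)| ≤ p * (|a| ^ (p - 1) * |h|) := by
    rw [abs_mul, abs_mul, abs_oddPow hp, abs_of_pos (by linarith)]
  have h4 : 0 ≤ |a| ^ (p - 1) * |h| := by positivity
  have h5 : 0 ≤ |h| ^ (p - 1) * |h| := by positivity
  have h6 := abs_le.1 h3
  rw [abs_le]
  constructor <;> nlinarith

/-! ### The Riesz bilinear form -/

theorem interaction_mono_ae {α : ℝ} {f g f' g' : Space N → ℝ≥0∞} (hf : f ≤ᵐ[volume] f')
    (hg : g ≤ᵐ[volume] g') : interaction α f g ≤ interaction α f' g' := by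
  refine lintegral_mono_ae ?_
  filter_upwards [Measure.quasiMeasurePreserving_fst.ae hf,
    Measure.quasiMeasurePreserving_snd.ae hg] with z h1 h2
  gcongr

theorem interaction_comm {α : ℝ} (f g : Space N → ℝ≥0∞) :
    interaction α f g = interaction α g f := by
  unfold interaction
  have h := lintegral_prod_swap (μ := (volume : Measure (Space N))) (ν := volume)
    (fun z : Space N × Space N => ENNReal.ofReal (rieszKernel α (z.1 - z.2)) * (g z.1 * f z.2))
  refine Eq.trans ?_ h
  refine lintegral_congr fun z => ?_
  simp only [Prod.fst_swap, Prod.snd_swap]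
  rw [← rieszKernel_neg, neg_sub, mul_comm (f z.1)]

theorem aemeasurable_interaction {α : ℝ} {f g : Space N → ℝ≥0∞} (hf : AEMeasurable f volume)
    (hg : AEMeasurable g volume) :
    AEMeasurable (fun z : Space N × Space N =>
      ENNReal.ofReal (rieszKernel α (z.1 - z.2)) * (f z.1 * g z.2)) (volume.prod volume) :=
  ((measurable_rieszKernel α).ennreal_ofReal.comp
    (measurable_fst.sub measurable_snd)).aemeasurable.mul
    ((hf.comp_quasiMeasurePreserving Measure.quasiMeasurePreserving_fst).mul
      (hg.comp_quasiMeasurePreserving Measure.quasiMeasurePreserving_snd))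

theorem interaction_add_left {α : ℝ} {f f' g : Space N → ℝ≥0∞} (hf : AEMeasurable f volume)
    (hg : AEMeasurable g volume) :
    interaction α (fun x => f x + f' x) g = interaction α f g + interaction α f' g := by
  unfold interaction
  rw [Measure.volume_eq_prod, ← lintegral_add_left' (aemeasurable_interaction hf hg)]
  refine lintegral_congr fun z => ?_
  ring

theorem interaction_add_right {α : ℝ} {f f' g : Space N → ℝ≥0∞} (hf : AEMeasurable f volume)
    (hg : AEMeasurable g volume) :
    interaction α g (fun x => f x + f' x) = interaction α g f + interaction α g f' := by
  rw [interaction_comm, interaction_add_left hf hg, interaction_comm, interaction_comm f']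

theorem interaction_const_mul {α : ℝ} {c d : ℝ≥0∞} (hc : c ≠ ⊤) (hd : d ≠ ⊤)
    (f g : Space N → ℝ≥0∞) :
    interaction α (fun x => c * f x) (fun x => d * g x) = c * d * interaction α f g := by
  unfold interaction
  rw [← lintegral_const_mul' _ _ (ENNReal.mul_ne_top hc hd)]
  refine lintegral_congr fun z => ?_
  ring

/-- Real functions of finite Riesz energy. -/
def FiniteEnergy (α : ℝ) (F : Space N → ℝ) : Prop :=
  AEStronglyMeasurable F volume ∧ interaction α (fun x => ‖F x‖ₑ) (fun x => ‖F x‖ₑ) ≠ ⊤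

/-- The Riesz interaction energy `∬ I_α(x - y) F(x) G(y) dx dy` of two real functions. -/
def rieszForm (α : ℝ) (F G : Space N → ℝ) : ℝ :=
  ∫ z : Space N × Space N, rieszKernel α (z.1 - z.2) * (F z.1 * G z.2)

theorem FiniteEnergy.mono {α : ℝ} {F G : Space N → ℝ} (hG : FiniteEnergy α G)
    (hF : AEStronglyMeasurable F volume) (h : ∀ᵐ x, |F x| ≤ |G x|) : FiniteEnergy α F := by
  refine ⟨hF, ne_top_of_le_ne_top hG.2 ?_⟩
  have : (fun x => ‖F x‖ₑ) ≤ᵐ[volume] fun x => ‖G x‖ₑ := by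
    filter_upwards [h] with x hx
    exact enorm_le_iff_norm_le.2 hx
  exact interaction_mono_ae this this

theorem FiniteEnergy.interaction_ne_top (hN : 1 ≤ N) {α : ℝ} (hα : 0 < α) (hαN : α < N)
    {F G : Space N → ℝ} (hF : FiniteEnergy α F) (hG : FiniteEnergy α G) :
    interaction α (fun x => ‖F x‖ₑ) (fun x => ‖G x‖ₑ) ≠ ⊤ := by
  have h := two_mul_interaction_le hN hα hαN hF.1.enorm hG.1.enorm
  intro ht
  rw [ht, ENNReal.mul_top (by norm_num)] at h
  exact ENNReal.add_ne_top.2 ⟨hF.2, hG.2⟩ (top_le_iff.1 h)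

theorem FiniteEnergy.add (hN : 1 ≤ N) {α : ℝ} (hα : 0 < α) (hαN : α < N)
    {F G : Space N → ℝ} (hF : FiniteEnergy α F) (hG : FiniteEnergy α G) :
    FiniteEnergy α (fun x => F x + G x) := by
  refine ⟨hF.1.add hG.1, ?_⟩
  have hle : (fun x => ‖F x + G x‖ₑ) ≤ᵐ[volume] fun x => ‖F x‖ₑ + ‖G x‖ₑ :=
    ae_of_all _ fun x => enorm_add_le _ _
  refine ne_top_of_le_ne_top ?_ (interaction_mono_ae hle hle)
  rw [interaction_add_left (g := fun x => ‖F x‖ₑ + ‖G x‖ₑ) hF.1.enorm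
      (hF.1.enorm.add hG.1.enorm),
    interaction_add_right hF.1.enorm hF.1.enorm, interaction_add_right hF.1.enorm hG.1.enorm]
  have h1 := hF.interaction_ne_top hN hα hαN hG
  have h2 := hG.interaction_ne_top hN hα hαN hF
  exact ENNReal.add_ne_top.2 ⟨ENNReal.add_ne_top.2 ⟨hF.2, h1⟩, ENNReal.add_ne_top.2 ⟨h2, hG.2⟩⟩

theorem FiniteEnergy.const_mul {α : ℝ} {F : Space N → ℝ} (hF : FiniteEnergy α F) (c : ℝ) :
    FiniteEnergy α (fun x => c * F x) := by
  refine ⟨hF.1.const_mul c, ?_⟩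
  simp only [enorm_mul]
  rw [interaction_const_mul enorm_ne_top enorm_ne_top]
  exact ENNReal.mul_ne_top (by finiteness) hF.2

theorem FiniteEnergy.sub (hN : 1 ≤ N) {α : ℝ} (hα : 0 < α) (hαN : α < N)
    {F G : Space N → ℝ} (hF : FiniteEnergy α F) (hG : FiniteEnergy α G) :
    FiniteEnergy α (fun x => F x - G x) := by
  have := hF.add hN hα hαN (hG.const_mul (-1))
  simpa [sub_eq_add_neg] using this

theorem aestronglyMeasurable_rieszForm {α : ℝ} {F G : Space N → ℝ}
    (hF : AEStronglyMeasurable F volume) (hG : AEStronglyMeasurable G volume) :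
    AEStronglyMeasurable (fun z : Space N × Space N =>
      rieszKernel α (z.1 - z.2) * (F z.1 * G z.2)) volume :=
  ((measurable_rieszKernel α).comp (measurable_fst.sub measurable_snd)).aestronglyMeasurable.mul
    (hF.comp_fst.mul hG.comp_snd)

theorem lintegral_enorm_rieszForm {α : ℝ} (hα : 0 < α) (hαN : α < N) (F G : Space N → ℝ) :
    ∫⁻ z : Space N × Space N, ‖rieszKernel α (z.1 - z.2) * (F z.1 * G z.2)‖ₑ =
      interaction α (fun x => ‖F x‖ₑ) (fun x => ‖G x‖ₑ) := by
  refine lintegral_congr fun z => ?_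
  rw [enorm_mul, enorm_mul, Real.enorm_eq_ofReal (rieszKernel_nonneg hα hαN _)]

theorem FiniteEnergy.integrable (hN : 1 ≤ N) {α : ℝ} (hα : 0 < α) (hαN : α < N)
    {F G : Space N → ℝ} (hF : FiniteEnergy α F) (hG : FiniteEnergy α G) :
    Integrable (fun z : Space N × Space N => rieszKernel α (z.1 - z.2) * (F z.1 * G z.2)) := by
  refine ⟨aestronglyMeasurable_rieszForm hF.1 hG.1, ?_⟩
  rw [hasFiniteIntegral_iff_enorm, lintegral_enorm_rieszForm hα hαN]
  exact (hF.interaction_ne_top hN hα hαN hG).lt_top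

theorem rieszForm_comm {α : ℝ} (F G : Space N → ℝ) : rieszForm α F G = rieszForm α G F := by
  unfold rieszForm
  have h := integral_prod_swap (μ := (volume : Measure (Space N))) (ν := volume)
    (fun z : Space N × Space N => rieszKernel α (z.1 - z.2) * (G z.1 * F z.2))
  refine Eq.trans ?_ h
  refine integral_congr_ae (ae_of_all _ fun z => ?_)
  simp only [Prod.fst_swap, Prod.snd_swap]
  rw [← rieszKernel_neg, neg_sub, mul_comm (F z.1)]

theorem rieszForm_congr {α : ℝ} {F G F' G' : Space N → ℝ} (hF : F =ᵐ[volume] F')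
    (hG : G =ᵐ[volume] G') : rieszForm α F G = rieszForm α F' G' := by
  refine integral_congr_ae ?_
  filter_upwards [Measure.quasiMeasurePreserving_fst.ae hF,
    Measure.quasiMeasurePreserving_snd.ae hG] with z h1 h2
  rw [h1, h2]

theorem rieszForm_add_left (hN : 1 ≤ N) {α : ℝ} (hα : 0 < α) (hαN : α < N)
    {F F' G : Space N → ℝ} (hF : FiniteEnergy α F) (hF' : FiniteEnergy α F')
    (hG : FiniteEnergy α G) :
    rieszForm α (fun x => F x + F' x) G = rieszForm α F G + rieszForm α F' G := by
  unfold rieszForm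
  rw [← integral_add (hF.integrable hN hα hαN hG) (hF'.integrable hN hα hαN hG)]
  refine integral_congr_ae (ae_of_all _ fun z => ?_)
  simp only; ring

theorem rieszForm_const_mul_left {α : ℝ} (c : ℝ) (F G : Space N → ℝ) :
    rieszForm α (fun x => c * F x) G = c * rieszForm α F G := by
  unfold rieszForm
  rw [← integral_const_mul]
  refine integral_congr_ae (ae_of_all _ fun z => ?_)
  simp only; ring

theorem rieszForm_sub_left (hN : 1 ≤ N) {α : ℝ} (hα : 0 < α) (hαN : α < N)
    {F F' G : Space N → ℝ} (hF : FiniteEnergy α F) (hF' : FiniteEnergy α F')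
    (hG : FiniteEnergy α G) :
    rieszForm α (fun x => F x - F' x) G = rieszForm α F G - rieszForm α F' G := by
  unfold rieszForm
  rw [← integral_sub (hF.integrable hN hα hαN hG) (hF'.integrable hN hα hαN hG)]
  refine integral_congr_ae (ae_of_all _ fun z => ?_)
  simp only; ring

theorem rieszForm_sub_right (hN : 1 ≤ N) {α : ℝ} (hα : 0 < α) (hαN : α < N)
    {F F' G : Space N → ℝ} (hF : FiniteEnergy α F) (hF' : FiniteEnergy α F')
    (hG : FiniteEnergy α G) :
    rieszForm α G (fun x => F x - F' x) = rieszForm α G F - rieszForm α G F' := by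
  rw [rieszForm_comm, rieszForm_sub_left hN hα hαN hF hF' hG, rieszForm_comm F,
    rieszForm_comm F']

theorem rieszForm_eq_toReal {α : ℝ} (hα : 0 < α) (hαN : α < N) {F G : Space N → ℝ}
    (hF : AEStronglyMeasurable F volume) (hG : AEStronglyMeasurable G volume)
    (hF0 : ∀ x, 0 ≤ F x) (hG0 : ∀ x, 0 ≤ G x) :
    rieszForm α F G = (interaction α (fun x => ‖F x‖ₑ) (fun x => ‖G x‖ₑ)).toReal := by
  unfold rieszForm
  rw [← lintegral_enorm_rieszForm hα hαN, integral_eq_lintegral_of_nonneg_ae]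
  · congr 1
    refine lintegral_congr fun z => ?_
    rw [Real.enorm_eq_ofReal (mul_nonneg (rieszKernel_nonneg hα hαN _)
      (mul_nonneg (hF0 _) (hG0 _)))]
  · exact ae_of_all _ fun z => mul_nonneg (rieszKernel_nonneg hα hαN _)
      (mul_nonneg (hF0 _) (hG0 _))
  · exact aestronglyMeasurable_rieszForm hF hG

/-- Monotonicity of the Riesz form, with domination by nonnegative functions. -/
theorem abs_rieszForm_le (hN : 1 ≤ N) {α : ℝ} (hα : 0 < α) (hαN : α < N)
    {F G F' G' : Space N → ℝ} (hF' : FiniteEnergy α F')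
    (hG' : FiniteEnergy α G') (hF : ∀ᵐ x, |F x| ≤ F' x) (hG : ∀ᵐ x, |G x| ≤ G' x) :
    |rieszForm α F G| ≤ rieszForm α F' G' := by
  unfold rieszForm
  rw [← Real.norm_eq_abs]
  refine norm_integral_le_of_norm_le (hF'.integrable hN hα hαN hG') ?_
  filter_upwards [Measure.quasiMeasurePreserving_fst.ae hF,
    Measure.quasiMeasurePreserving_snd.ae hG] with z h1 h2
  rw [Real.norm_eq_abs, abs_mul, abs_mul, abs_of_nonneg (rieszKernel_nonneg hα hαN _)]
  exact mul_le_mul_of_nonneg_left (mul_le_mul h1 h2 (abs_nonneg _) ((abs_nonneg _).trans h1))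
    (rieszKernel_nonneg hα hαN _)

theorem rieszForm_mono_left (hN : 1 ≤ N) {α : ℝ} (hα : 0 < α) (hαN : α < N)
    {F F' G : Space N → ℝ} (hF : FiniteEnergy α F) (hF' : FiniteEnergy α F')
    (hG : FiniteEnergy α G) (h : ∀ᵐ x, F x ≤ F' x) (hG0 : ∀ x, 0 ≤ G x) :
    rieszForm α F G ≤ rieszForm α F' G := by
  unfold rieszForm
  refine integral_mono_ae (hF.integrable hN hα hαN hG) (hF'.integrable hN hα hαN hG) ?_
  filter_upwards [Measure.quasiMeasurePreserving_fst.ae h] with z hz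
  exact mul_le_mul_of_nonneg_left (mul_le_mul_of_nonneg_right hz (hG0 _))
    (rieszKernel_nonneg hα hαN _)

theorem two_mul_rieszForm_le (hN : 1 ≤ N) {α : ℝ} (hα : 0 < α) (hαN : α < N)
    {F G : Space N → ℝ} (hF : FiniteEnergy α F) (hG : FiniteEnergy α G)
    (hF0 : ∀ x, 0 ≤ F x) (hG0 : ∀ x, 0 ≤ G x) :
    2 * rieszForm α F G ≤ rieszForm α F F + rieszForm α G G := by
  rw [rieszForm_eq_toReal hα hαN hF.1 hG.1 hF0 hG0, rieszForm_eq_toReal hα hαN hF.1 hF.1 hF0 hF0,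
    rieszForm_eq_toReal hα hαN hG.1 hG.1 hG0 hG0, ← ENNReal.toReal_add hF.2 hG.2]
  have h := two_mul_interaction_le hN hα hαN hF.1.enorm hG.1.enorm
  have h2 := ENNReal.toReal_mono (ENNReal.add_ne_top.2 ⟨hF.2, hG.2⟩) h
  simpa using h2

theorem rieszForm_eq_integral (hN : 1 ≤ N) {α : ℝ} (hα : 0 < α) (hαN : α < N)
    {F G : Space N → ℝ} (hF : FiniteEnergy α F) (hG : FiniteEnergy α G) :
    rieszForm α F G = ∫ x, (∫ y, rieszKernel α (x - y) * G y) * F x := by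
  unfold rieszForm
  rw [Measure.volume_eq_prod, integral_prod _ (hF.integrable hN hα hαN hG)]
  refine integral_congr_ae (ae_of_all _ fun x => ?_)
  simp only
  rw [← integral_mul_const]
  refine integral_congr_ae (ae_of_all _ fun y => ?_)
  simp only; ring

/-- The product `|a|^(p-1) |b|` of `H¹` functions, which has finite Riesz energy. -/
def powMul (p : ℝ) (a b : H1 N) (x : Space N) : ℝ := |fn a x| ^ (p - 1) * |fn b x|

theorem powMul_nonneg (p : ℝ) (a b : H1 N) (x : Space N) : 0 ≤ powMul p a b x := by
  unfold powMul; positivity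

theorem powMul_self {p : ℝ} (hp : 1 < p) (a : H1 N) :
    powMul p a a = fun x => |fn a x| ^ p :=
  funext fun _ => abs_rpow_sub_one_mul_abs hp _

theorem aestronglyMeasurable_powMul (p : ℝ) (a b : H1 N) :
    AEStronglyMeasurable (powMul p a b) volume := by
  have h1 : AEMeasurable (fun x => |fn a x| ^ (p - 1)) volume :=
    ((memLp_fn a).1.aemeasurable.norm).pow_const _
  exact h1.aestronglyMeasurable.mul (memLp_fn b).1.norm

theorem enorm_powMul {p : ℝ} (hp : 1 < p) (a b : H1 N) (x : Space N) :
    ‖powMul p a b x‖ₑ = ‖fn a x‖ₑ ^ (p - 1) * ‖fn b x‖ₑ := by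
  unfold powMul
  rw [enorm_mul, ← Real.norm_eq_abs, ← Real.norm_eq_abs, enorm_norm,
    Real.enorm_rpow_of_nonneg (norm_nonneg _) (by linarith), enorm_norm]

/-- The exponent conditions imposed on `α` and `p`. -/
structure HartreeExponents (N : ℕ) (α p : ℝ) : Prop where
  two_le : 2 ≤ N
  pos : 0 < α
  lt_dim : α < N
  lower : ((N : ℝ) + α) / N < p
  upper : 3 ≤ N → p < ((N : ℝ) + α) / ((N : ℝ) - 2)

theorem HartreeExponents.one_lt {α p : ℝ} (h : HartreeExponents N α p) : 1 < p := by
  have h2 : (2 : ℝ) ≤ N := by exact_mod_cast h.two_le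
  have := h.pos
  exact lt_trans (by rw [lt_div_iff₀ (by linarith)]; linarith) h.lower

theorem HartreeExponents.one_le {α p : ℝ} (h : HartreeExponents N α p) : 1 ≤ N :=
  one_le_two.trans h.two_le

theorem ofReal_rpow_mul_mul (C : ℝ≥0) {s a b c d : ℝ} (hs : 0 ≤ s) (ha : 0 ≤ a) (hb : 0 ≤ b)
    (hc : 0 ≤ c) :
    (C : ℝ≥0∞) * ((ENNReal.ofReal a ^ s * ENNReal.ofReal b) *
        (ENNReal.ofReal c ^ s * ENNReal.ofReal d))
        = ENNReal.ofReal (C * ((a ^ s * b) * (c ^ s * d))) := by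
  rw [ENNReal.ofReal_mul (by positivity), ENNReal.ofReal_mul (by positivity),
    ENNReal.ofReal_mul (by positivity), ENNReal.ofReal_mul (by positivity),
    ENNReal.ofReal_rpow_of_nonneg ha hs, ENNReal.ofReal_rpow_of_nonneg hc hs]
  simp

theorem HartreeExponents.exists_bound {α p : ℝ} (h : HartreeExponents N α p) :
    ∃ C : ℝ, 0 ≤ C ∧ (∀ a b : H1 N, FiniteEnergy α (powMul p a b)) ∧ ∀ a b c d : H1 N,
      rieszForm α (powMul p a b) (powMul p c d) ≤
        C * ((‖a‖ ^ (p - 1) * ‖b‖) * (‖c‖ ^ (p - 1) * ‖d‖)) := by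
  obtain ⟨C, hC⟩ := exists_interaction_H1_le h.two_le h.pos h.lt_dim h.lower h.upper
  have hp := h.one_lt
  have hr : ∀ a b c d : H1 N, (C : ℝ≥0∞) * ((ENNReal.ofReal ‖a‖ ^ (p - 1) * ENNReal.ofReal ‖b‖) *
        (ENNReal.ofReal ‖c‖ ^ (p - 1) * ENNReal.ofReal ‖d‖))
        = ENNReal.ofReal (C * ((‖a‖ ^ (p - 1) * ‖b‖) * (‖c‖ ^ (p - 1) * ‖d‖))) :=
    fun a b c d => ofReal_rpow_mul_mul C (by linarith) (norm_nonneg a) (norm_nonneg b)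
      (norm_nonneg c)
  have hfin : ∀ a b : H1 N, FiniteEnergy α (powMul p a b) := by
    intro a b
    refine ⟨aestronglyMeasurable_powMul p a b, ?_⟩
    simp only [enorm_powMul hp]
    exact ne_top_of_le_ne_top ((hr a b a b).trans_ne ENNReal.ofReal_ne_top) (hC a b a b)
  refine ⟨C, C.2, hfin, fun a b c d => ?_⟩
  rw [rieszForm_eq_toReal h.pos h.lt_dim (hfin a b).1 (hfin c d).1 (powMul_nonneg p a b)
    (powMul_nonneg p c d)]
  simp only [enorm_powMul hp]
  refine ENNReal.toReal_le_of_le_ofReal (by positivity) ?_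
  exact (hC a b c d).trans_eq (hr a b c d)

theorem HartreeExponents.finiteEnergy {α p : ℝ} (h : HartreeExponents N α p) (a b : H1 N) :
    FiniteEnergy α (powMul p a b) := by
  obtain ⟨_, _, hf, _⟩ := h.exists_bound
  exact hf a b

/-! ### The energy is differentiable and convex -/

/-- Differentiability when, for every `ε`, the remainder is at most `ε K ‖h‖` up to terms of higher
order. -/
theorem hasFDerivAt_of_remainder_le {E : Type*} [NormedAddCommGroup E] [NormedSpace ℝ E]
    {f : E → ℝ} {L : E →L[ℝ] ℝ} {u : E} {K s : ℝ} (hs : 1 < s)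
    (H : ∀ ε > 0, ∃ C : ℝ, ∀ h : E, ‖h‖ ≤ 1 →
      |f (u + h) - f u - L h| ≤ ε * K * ‖h‖ + C * (‖h‖ ^ s + ‖h‖ ^ 2)) :
    HasFDerivAt f L u := by
  rw [hasFDerivAt_iff_isLittleO_nhds_zero, Asymptotics.isLittleO_iff]
  intro c hc
  obtain ⟨C, hC⟩ := H (c / (2 * (|K| + 1))) (by positivity)
  have t1 : Tendsto (fun h : E => |C| * (‖h‖ ^ (s - 1) + ‖h‖)) (𝓝 0) (𝓝 0) := by
    have : Continuous fun h : E => |C| * (‖h‖ ^ (s - 1) + ‖h‖) :=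
      continuous_const.mul ((continuous_norm.rpow_const fun _ => Or.inr (by linarith)).add
        continuous_norm)
    have h2 := this.tendsto 0
    simpa [Real.zero_rpow (show s - 1 ≠ 0 by linarith)] using h2
  have e1 : ∀ᶠ h : E in 𝓝 0, |C| * (‖h‖ ^ (s - 1) + ‖h‖) ≤ c / 2 :=
    (t1.eventually (gt_mem_nhds (by positivity : (0 : ℝ) < c / 2))).mono fun _ h => h.le
  have e2 : ∀ᶠ h : E in 𝓝 0, ‖h‖ ≤ 1 := by
    have := (continuous_norm (E := E)).tendsto 0
    rw [norm_zero] at this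
    exact (this.eventually (gt_mem_nhds one_pos)).mono fun _ h => h.le
  filter_upwards [e1, e2] with h h1 h2
  rw [Real.norm_eq_abs]
  refine (hC h h2).trans ?_
  have h3 : ‖h‖ ^ s = ‖h‖ ^ (s - 1) * ‖h‖ := by
    rcases eq_or_ne ‖h‖ 0 with h0 | h0
    · rw [h0]; simp [Real.zero_rpow (show s ≠ 0 by linarith)]
    · rw [← Real.rpow_add_one h0]; congr 1; ring
  have h4 : C * (‖h‖ ^ s + ‖h‖ ^ 2) ≤ (|C| * (‖h‖ ^ (s - 1) + ‖h‖)) * ‖h‖ := by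
    rw [h3]
    have : C * (‖h‖ ^ (s - 1) * ‖h‖ + ‖h‖ ^ 2) ≤ |C| * (‖h‖ ^ (s - 1) * ‖h‖ + ‖h‖ ^ 2) := by
      gcongr; exact le_abs_self C
    linarith
  have h5 : (|C| * (‖h‖ ^ (s - 1) + ‖h‖)) * ‖h‖ ≤ c / 2 * ‖h‖ := by gcongr
  have h6 : c / (2 * (|K| + 1)) * K ≤ c / 2 := by
    rw [div_mul_eq_mul_div, div_le_div_iff₀ (by positivity) two_pos]
    have := le_abs_self K
    nlinarith
  have h7 : c / (2 * (|K| + 1)) * K * ‖h‖ ≤ c / 2 * ‖h‖ := by gcongr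
  linarith

/-- The exponent conditions imposed on `q`. -/
structure SobolevExponent (N : ℕ) (q : ℝ) : Prop where
  two_le : 2 ≤ N
  lower : 2 < q
  upper : 3 ≤ N → q < 2 * (N : ℝ) / ((N : ℝ) - 2)

theorem SobolevExponent.exists_bound {q : ℝ} (h : SobolevExponent N q) :
    ∃ C : ℝ, 0 ≤ C ∧ (∀ a b : H1 N, Integrable (powMul q a b)) ∧ ∀ a b : H1 N,
      ∫ x, powMul q a b x ≤ C * (‖a‖ ^ (q - 1) * ‖b‖) := by
  have hq : 1 < q := by linarith [h.lower]
  obtain ⟨C, hC⟩ := exists_lintegral_rpow_mul_le h.two_le (r := 1) hq one_pos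
    (by linarith [h.lower]) (fun h3 => by rw [mul_one]; exact (h.upper h3).le)
  have hb : ∀ a b : H1 N, ∫⁻ x, ‖powMul q a b x‖ₑ
      ≤ ENNReal.ofReal (C * (‖a‖ ^ (q - 1) * ‖b‖)) := by
    intro a b
    have h1 := hC a b
    simp only [ENNReal.rpow_one, div_one] at h1
    simp only [enorm_powMul hq]
    refine h1.trans (le_of_eq ?_)
    have ha := norm_nonneg a
    have hb := norm_nonneg b
    generalize ‖a‖ = s at ha
    generalize ‖b‖ = t at hb
    rw [ENNReal.ofReal_mul (by positivity), ENNReal.ofReal_mul (by positivity),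
      ENNReal.ofReal_rpow_of_nonneg ha (by linarith)]
    simp
  have hi : ∀ a b : H1 N, Integrable (powMul q a b) := fun a b =>
    ⟨aestronglyMeasurable_powMul q a b, (hb a b).trans_lt ENNReal.ofReal_lt_top⟩
  refine ⟨C, C.2, hi, fun a b => ?_⟩
  have h0 : 0 ≤ (C : ℝ) * (‖a‖ ^ (q - 1) * ‖b‖) := by
    have ha := norm_nonneg a
    have hb := norm_nonneg b
    positivity
  rw [integral_eq_lintegral_of_nonneg_ae (ae_of_all _ (powMul_nonneg q a b))
    (aestronglyMeasurable_powMul q a b)]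
  refine ENNReal.toReal_le_of_le_ofReal h0 (le_trans (le_of_eq ?_) (hb a b))
  refine lintegral_congr fun x => ?_
  rw [Real.enorm_eq_ofReal (powMul_nonneg q a b x)]

theorem SobolevExponent.integrable {q : ℝ} (h : SobolevExponent N q) (a b : H1 N) :
    Integrable (powMul q a b) := by
  obtain ⟨_, _, hi, _⟩ := h.exists_bound
  exact hi a b

/-- The density `|u|^(p-2) u w` of the derivative of `|u|^p` in the direction `w`. -/
def oddMul (p : ℝ) (u w : H1 N) (x : Space N) : ℝ := oddPow p (fn u x) * fn w x

theorem abs_oddMul {p : ℝ} (hp : 1 < p) (u w : H1 N) (x : Space N) :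
    |oddMul p u w x| = powMul p u w x := by
  rw [oddMul, abs_mul, abs_oddPow hp, powMul]

theorem aestronglyMeasurable_oddMul (p : ℝ) (u w : H1 N) :
    AEStronglyMeasurable (oddMul p u w) volume :=
  (((measurable_oddPow p).comp_aemeasurable (memLp_fn u).1.aemeasurable).mul
    (memLp_fn w).1.aemeasurable).aestronglyMeasurable

theorem oddMul_add (p : ℝ) (u v w : H1 N) :
    oddMul p u (v + w) =ᵐ[volume] fun x => oddMul p u v x + oddMul p u w x := by
  filter_upwards [fn_add v w] with x hx
  simp only [oddMul, hx]; ring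

theorem oddMul_smul (p : ℝ) (u : H1 N) (c : ℝ) (w : H1 N) :
    oddMul p u (c • w) =ᵐ[volume] fun x => c * oddMul p u w x := by
  filter_upwards [fn_smul c w] with x hx
  simp only [oddMul, hx]; ring

/-- Everywhere nonnegative Taylor remainder of `|u|^p`. -/
theorem powMul_add_sub_nonneg {p : ℝ} (hp : 1 < p) (u h : H1 N) :
    ∀ᵐ x, 0 ≤ powMul p (u + h) (u + h) x - powMul p u u x - p * oddMul p u h x := by
  filter_upwards [fn_add u h] with x hx
  rw [powMul_self hp, powMul_self hp]
  simp only [hx, oddMul]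
  exact abs_add_rpow_sub_nonneg hp _ _

theorem exists_powMul_add_sub_le {p : ℝ} (hp : 1 < p) {ε : ℝ} (hε : 0 < ε) :
    ∃ C : ℝ, 0 ≤ C ∧ ∀ u h : H1 N, ∀ᵐ x,
      |powMul p (u + h) (u + h) x - powMul p u u x - p * oddMul p u h x| ≤
        ε * powMul p u h x + C * powMul p h h x := by
  obtain ⟨C, hC, H⟩ := exists_abs_add_rpow_sub_le hp hε
  refine ⟨C, hC, fun u h => ?_⟩
  filter_upwards [fn_add u h, powMul_add_sub_nonneg hp u h] with x hx h0
  rw [abs_of_nonneg h0, powMul_self hp, powMul_self hp]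
  simp only [hx, oddMul]
  exact H _ _

theorem exists_abs_powMul_add_sub_le {p : ℝ} (hp : 1 < p) :
    ∃ C : ℝ, 0 ≤ C ∧ ∀ u h : H1 N, ∀ᵐ x,
      |powMul p (u + h) (u + h) x - powMul p u u x| ≤
        C * (powMul p u h x + powMul p h h x) := by
  obtain ⟨C, hC, H⟩ := exists_abs_abs_add_rpow_sub_le hp
  refine ⟨C, hC, fun u h => ?_⟩
  filter_upwards [fn_add u h] with x hx
  rw [powMul_self hp, powMul_self hp]
  simp only [hx]
  exact H _ _

section Power

variable {q : ℝ}

theorem SobolevExponent.one_lt (h : SobolevExponent N q) : 1 < q := by linarith [h.lower]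

theorem SobolevExponent.integrable_oddMul (h : SobolevExponent N q) (u w : H1 N) :
    Integrable (oddMul q u w) :=
  (h.integrable u w).mono' (aestronglyMeasurable_oddMul q u w)
    (ae_of_all _ fun x => (abs_oddMul h.one_lt u w x).le)

theorem SobolevExponent.exists_abs_integral_oddMul_le (h : SobolevExponent N q) (u : H1 N) :
    ∃ C : ℝ, ∀ w : H1 N, ‖∫ x, oddMul q u w x‖ ≤ C * ‖w‖ := by
  obtain ⟨C, -, -, hC⟩ := h.exists_bound
  refine ⟨C * ‖u‖ ^ (q - 1), fun w => ?_⟩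
  have h1 := norm_integral_le_integral_norm (μ := volume) (oddMul q u w)
  simp only [Real.norm_eq_abs, abs_oddMul h.one_lt] at h1
  have h2 := h1.trans (hC u w)
  rw [← mul_assoc] at h2
  exact h2

/-- The linear form `w ↦ ∫ |u|^(q-2) u w` on `H¹`. -/
def powerDeriv (h : SobolevExponent N q) (u : H1 N) : H1 N →L[ℝ] ℝ :=
  LinearMap.mkContinuousOfExistsBound
    { toFun := fun w => ∫ x, oddMul q u w x
      map_add' := fun v w => by
        rw [integral_congr_ae (oddMul_add q u v w),
          integral_add (h.integrable_oddMul u v) (h.integrable_oddMul u w)]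
      map_smul' := fun c w => by
        rw [integral_congr_ae (oddMul_smul q u c w), integral_const_mul]; rfl }
    (h.exists_abs_integral_oddMul_le u)

theorem powerDeriv_apply (h : SobolevExponent N q) (u w : H1 N) :
    powerDeriv h u w = ∫ x, oddMul q u w x := rfl

set_option maxHeartbeats 2000000 in
theorem hasFDerivAt_power (h : SobolevExponent N q) (u : H1 N) :
    HasFDerivAt (fun u : H1 N => ∫ x, powMul q u u x) (q • powerDeriv h u) u := by
  obtain ⟨M, hM0, hi, hM⟩ := h.exists_bound
  refine hasFDerivAt_of_remainder_le (K := M * ‖u‖ ^ (q - 1)) h.one_lt fun ε hε => ?_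
  obtain ⟨C, hC0, hC⟩ := exists_powMul_add_sub_le (N := N) h.one_lt hε
  refine ⟨C * M, fun w _ => ?_⟩
  have e1 : (∫ x, powMul q (u + w) (u + w) x) - (∫ x, powMul q u u x) - (q • powerDeriv h u) w
      = ∫ x, (powMul q (u + w) (u + w) x - powMul q u u x - q * oddMul q u w x) := by
    rw [integral_sub (f := fun x => powMul q (u + w) (u + w) x - powMul q u u x)
      ((hi _ _).sub (hi _ _)) ((h.integrable_oddMul u w).const_mul q),
      integral_sub (hi _ _) (hi _ _), integral_const_mul]
    rfl
  rw [e1]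
  have hsum : Integrable (fun x => ε * powMul q u w x + C * powMul q w w x) :=
    ((hi u w).const_mul ε).add ((hi w w).const_mul C)
  have e2 : |∫ x, (powMul q (u + w) (u + w) x - powMul q u u x - q * oddMul q u w x)| ≤
      ∫ x, (ε * powMul q u w x + C * powMul q w w x) := by
    rw [← Real.norm_eq_abs]
    exact norm_integral_le_of_norm_le hsum (hC u w)
  rw [integral_add ((hi u w).const_mul ε) ((hi w w).const_mul C), integral_const_mul,
    integral_const_mul] at e2
  refine e2.trans ?_
  have h1 := hM u w
  have h2 := hM w w
  have hw := norm_nonneg w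
  generalize ‖w‖ = t at h1 h2 hw
  generalize ‖u‖ = s at h1
  have h3 : t ^ (q - 1) * t = t ^ q := by
    have := abs_rpow_sub_one_mul_abs h.one_lt t
    rwa [abs_of_nonneg hw] at this
  rw [h3] at h2
  have h4 := mul_le_mul_of_nonneg_left h1 hε.le
  have h5 := mul_le_mul_of_nonneg_left h2 hC0
  have h6 : 0 ≤ C * M * t ^ 2 := by positivity
  linarith

theorem power_sub_ge (h : SobolevExponent N q) (u v : H1 N) :
    q * powerDeriv h u (v - u) ≤ (∫ x, powMul q v v x) - ∫ x, powMul q u u x := by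
  rw [powerDeriv_apply, ← integral_const_mul, ← integral_sub (h.integrable v v) (h.integrable u u)]
  refine integral_mono_ae ((h.integrable_oddMul u (v - u)).const_mul q)
    ((h.integrable v v).sub (h.integrable u u)) ?_
  have := powMul_add_sub_nonneg h.one_lt u (v - u)
  rw [add_sub_cancel] at this
  filter_upwards [this] with x hx
  linarith

end Power

section Hartree

variable {α p : ℝ}

theorem HartreeExponents.finiteEnergy_oddMul (h : HartreeExponents N α p) (u w : H1 N) :
    FiniteEnergy α (oddMul p u w) :=
  (h.finiteEnergy u w).mono (aestronglyMeasurable_oddMul p u w) (ae_of_all _ fun x => by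
    rw [abs_oddMul h.one_lt]; exact le_abs_self _)

theorem HartreeExponents.exists_abs_rieszForm_oddMul_le (h : HartreeExponents N α p) (u : H1 N) :
    ∃ C : ℝ, ∀ w : H1 N, ‖rieszForm α (oddMul p u w) (powMul p u u)‖ ≤ C * ‖w‖ := by
  obtain ⟨C, -, -, hC⟩ := h.exists_bound
  refine ⟨C * (‖u‖ ^ (p - 1) * (‖u‖ ^ (p - 1) * ‖u‖)), fun w => ?_⟩
  have h1 := abs_rieszForm_le h.one_le h.pos h.lt_dim (h.finiteEnergy u w) (h.finiteEnergy u u)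
    (ae_of_all _ fun x => (abs_oddMul h.one_lt u w x).le)
    (ae_of_all _ fun x => (abs_of_nonneg (powMul_nonneg p u u x)).le)
  have h2 := h1.trans (hC u w u u)
  rw [Real.norm_eq_abs]
  generalize ‖w‖ = t at h2 ⊢
  refine h2.trans (le_of_eq ?_)
  generalize ‖u‖ = s
  ring

/-- The linear form `w ↦ ∫ (I_α * |u|^p) |u|^(p-2) u w` on `H¹`. -/
def hartreeDeriv (h : HartreeExponents N α p) (u : H1 N) : H1 N →L[ℝ] ℝ :=
  LinearMap.mkContinuousOfExistsBound
    { toFun := fun w => rieszForm α (oddMul p u w) (powMul p u u)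
      map_add' := fun v w => by
        rw [rieszForm_congr (oddMul_add p u v w) (Filter.EventuallyEq.refl _ _),
          rieszForm_add_left h.one_le h.pos h.lt_dim (h.finiteEnergy_oddMul u v)
            (h.finiteEnergy_oddMul u w) (h.finiteEnergy u u)]
      map_smul' := fun c w => by
        rw [rieszForm_congr (oddMul_smul p u c w) (Filter.EventuallyEq.refl _ _),
          rieszForm_const_mul_left]; rfl }
    (h.exists_abs_rieszForm_oddMul_le u)

theorem hartreeDeriv_apply (h : HartreeExponents N α p) (u w : H1 N) :
    hartreeDeriv h u w = rieszForm α (oddMul p u w) (powMul p u u) := rfl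

set_option maxHeartbeats 2000000 in
theorem hasFDerivAt_hartree (h : HartreeExponents N α p) (u : H1 N) :
    HasFDerivAt (fun u : H1 N => rieszForm α (powMul p u u) (powMul p u u))
      ((2 * p) • hartreeDeriv h u) u := by
  obtain ⟨M, hM0, hfe, hM⟩ := h.exists_bound
  obtain ⟨D, hD0, hD⟩ := exists_abs_powMul_add_sub_le (N := N) h.one_lt
  refine hasFDerivAt_of_remainder_le
    (K := 2 * M * ‖u‖ ^ (p - 1) * (‖u‖ ^ (p - 1) * ‖u‖)) h.one_lt fun ε hε => ?_
  obtain ⟨C, hC0, hC⟩ := exists_powMul_add_sub_le (N := N) h.one_lt hε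
  refine ⟨2 * C * M * (‖u‖ ^ (p - 1) * ‖u‖) + D ^ 2 * M * (‖u‖ ^ (p - 1) + 1) ^ 2,
    fun w hw1 => ?_⟩
  have hN := h.one_le
  have hα := h.pos
  have hαN := h.lt_dim
  set f := powMul p u u with hf
  set g := powMul p (u + w) (u + w) with hg
  have hfE : FiniteEnergy α f := hfe u u
  have hgE : FiniteEnergy α g := hfe _ _
  have hoE := h.finiteEnergy_oddMul u w
  have hpo : FiniteEnergy α (fun x => p * oddMul p u w x) := hoE.const_mul p
  have hdE : FiniteEnergy α (fun x => g x - f x) := hgE.sub hN hα hαN hfE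
  have hrE : FiniteEnergy α (fun x => g x - f x - p * oddMul p u w x) := hdE.sub hN hα hαN hpo
  -- with `B` the Riesz form, `B(g, g) - B(f, f) = 2 B(g - f, f) + B(g - f, g - f)`
  have e1 : rieszForm α g g - rieszForm α f f - ((2 * p) • hartreeDeriv h u) w
      = 2 * rieszForm α (fun x => g x - f x - p * oddMul p u w x) f
        + rieszForm α (fun x => g x - f x) (fun x => g x - f x) := by
    rw [rieszForm_sub_left hN hα hαN hdE hpo hfE, rieszForm_const_mul_left,
      rieszForm_sub_left hN hα hαN hgE hfE hfE, rieszForm_sub_left hN hα hαN hgE hfE hdE,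
      rieszForm_sub_right hN hα hαN hgE hfE hgE, rieszForm_sub_right hN hα hαN hgE hfE hfE,
      rieszForm_comm f g]
    simp only [smul_apply, smul_eq_mul, hartreeDeriv_apply]
    ring
  rw [e1]
  have b1 : |rieszForm α (fun x => g x - f x - p * oddMul p u w x) f| ≤
      rieszForm α (fun x => ε * powMul p u w x + C * powMul p w w x) f :=
    abs_rieszForm_le hN hα hαN
      (((hfe u w).const_mul ε).add hN hα hαN ((hfe w w).const_mul C)) hfE (hC u w)
      (ae_of_all _ fun x => (abs_of_nonneg (powMul_nonneg p u u x)).le)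
  rw [rieszForm_add_left hN hα hαN ((hfe u w).const_mul ε) ((hfe w w).const_mul C) hfE,
    rieszForm_const_mul_left, rieszForm_const_mul_left] at b1
  have hsE : FiniteEnergy α (fun x => powMul p u w x + powMul p w w x) :=
    (hfe u w).add hN hα hαN (hfe w w)
  have b2 : |rieszForm α (fun x => g x - f x) (fun x => g x - f x)| ≤
      rieszForm α (fun x => D * (powMul p u w x + powMul p w w x))
        (fun x => D * (powMul p u w x + powMul p w w x)) :=
    abs_rieszForm_le hN hα hαN (hsE.const_mul D) (hsE.const_mul D) (hD u w) (hD u w)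
  rw [rieszForm_const_mul_left,
    rieszForm_comm _ (fun x => D * (powMul p u w x + powMul p w w x)), rieszForm_const_mul_left,
    rieszForm_add_left hN hα hαN (hfe u w) (hfe w w) hsE,
    rieszForm_comm (powMul p u w) (fun x => powMul p u w x + powMul p w w x),
    rieszForm_comm (powMul p w w) (fun x => powMul p u w x + powMul p w w x),
    rieszForm_add_left hN hα hαN (hfe u w) (hfe w w) (hfe u w),
    rieszForm_add_left hN hα hαN (hfe u w) (hfe w w) (hfe w w)] at b2
  have m1 := hM u w u u
  have m2 := hM w w u u
  have m3 := hM u w u w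
  have m4 := hM u w w w
  have m5 := hM w w u w
  have m6 := hM w w w w
  refine (abs_add_le _ _).trans ?_
  rw [abs_mul, abs_two]
  have hw0 := norm_nonneg w
  have hu0 := norm_nonneg u
  generalize ‖w‖ = t at *
  generalize ‖u‖ = s at *
  have ht : t ^ (p - 1) * t = t ^ p := by
    have := abs_rpow_sub_one_mul_abs h.one_lt t
    rwa [abs_of_nonneg hw0] at this
  have ht1 : t ^ (p - 1) ≤ 1 := Real.rpow_le_one hw0 hw1 (by linarith [h.one_lt])
  have ht0 : 0 ≤ t ^ (p - 1) := by positivity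
  have hs0 : 0 ≤ s ^ (p - 1) := by positivity
  have q2 : rieszForm α (powMul p u w) (powMul p u w) + rieszForm α (powMul p w w) (powMul p u w)
      + (rieszForm α (powMul p u w) (powMul p w w) + rieszForm α (powMul p w w) (powMul p w w))
      ≤ M * (s ^ (p - 1) + 1) ^ 2 * t ^ 2 := by
    have : M * (s ^ (p - 1) + t ^ (p - 1)) ^ 2 * t ^ 2 ≤ M * (s ^ (p - 1) + 1) ^ 2 * t ^ 2 := by
      gcongr
    refine le_trans ?_ this
    refine (add_le_add (add_le_add m3 m5) (add_le_add m4 m6)).trans (le_of_eq ?_)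
    ring
  have q3 := mul_le_mul_of_nonneg_left q2 (mul_nonneg hD0 hD0)
  have q1 := mul_le_mul_of_nonneg_left m1 hε.le
  have q4 := mul_le_mul_of_nonneg_left m2 hC0
  rw [ht] at q4
  have x1 : 0 ≤ 2 * C * M * (s ^ (p - 1) * s) * t ^ 2 := by positivity
  have x2 : 0 ≤ D ^ 2 * M * (s ^ (p - 1) + 1) ^ 2 * t ^ p := by positivity
  linarith

theorem hartree_sub_ge (h : HartreeExponents N α p) (u v : H1 N) :
    2 * p * hartreeDeriv h u (v - u) ≤
      rieszForm α (powMul p v v) (powMul p v v) - rieszForm α (powMul p u u) (powMul p u u) := by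
  have hN := h.one_le
  have hα := h.pos
  have hαN := h.lt_dim
  have hv := h.finiteEnergy v v
  have hu := h.finiteEnergy u u
  have h1 := two_mul_rieszForm_le hN hα hαN hv hu (powMul_nonneg p v v) (powMul_nonneg p u u)
  have hle : rieszForm α (fun x => p * oddMul p u (v - u) x) (powMul p u u) ≤
      rieszForm α (fun x => powMul p v v x - powMul p u u x) (powMul p u u) := by
    refine rieszForm_mono_left hN hα hαN ((h.finiteEnergy_oddMul u (v - u)).const_mul p)
      (hv.sub hN hα hαN hu) hu ?_ (powMul_nonneg p u u)
    have := powMul_add_sub_nonneg h.one_lt u (v - u)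
    rw [add_sub_cancel] at this
    filter_upwards [this] with x hx
    linarith
  rw [rieszForm_const_mul_left, rieszForm_sub_left hN hα hαN hv hu hu] at hle
  rw [hartreeDeriv_apply]
  linarith

end Hartree

section Energy

variable {α p q γ μ : ℝ}

/-- The linear form `w ↦ ∫ ⟨∇u, ∇w⟩` on `H¹`. -/
def dirichletDeriv (u : H1 N) : H1 N →L[ℝ] ℝ :=
  LinearMap.mkContinuous
    { toFun := fun w => inner ℝ u.1.snd w.1.snd
      map_add' := fun v w => inner_add_right u.1.snd v.1.snd w.1.snd
      map_smul' := fun c w => inner_smul_right u.1.snd w.1.snd c }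
    ‖u.1.snd‖ (fun w => (norm_inner_le_norm u.1.snd w.1.snd).trans
      (mul_le_mul_of_nonneg_left (norm_snd_le w) (norm_nonneg _)))

theorem dirichletDeriv_apply (u w : H1 N) :
    dirichletDeriv u w = inner ℝ u.1.snd w.1.snd := rfl

theorem dirichletDeriv_apply_eq_integral (u w : H1 N) :
    dirichletDeriv u w = ∫ x, inner ℝ (grad u x) (grad w x) := by
  rw [dirichletDeriv_apply, L2.inner_def]; rfl

theorem integral_norm_sq_grad (u : H1 N) : ∫ x, ‖grad u x‖ ^ 2 = ‖u.1.snd‖ ^ 2 := by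
  rw [← real_inner_self_eq_norm_sq, L2.inner_def]
  refine integral_congr_ae (ae_of_all _ fun x => ?_)
  exact (real_inner_self_eq_norm_sq _).symm

theorem snd_add (u w : H1 N) : (u + w).1.snd = u.1.snd + w.1.snd := rfl

theorem snd_sub (u w : H1 N) : (u - w).1.snd = u.1.snd - w.1.snd := rfl

theorem fst_sub (u w : H1 N) : (u - w).1.fst = u.1.fst - w.1.fst := rfl

set_option maxHeartbeats 2000000 in
theorem hasFDerivAt_dirichlet (u : H1 N) :
    HasFDerivAt (fun u : H1 N => ‖u.1.snd‖ ^ 2) ((2 : ℝ) • dirichletDeriv u) u := by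
  refine hasFDerivAt_of_remainder_le (K := 0) one_lt_two fun ε _ => ⟨1, fun w _ => ?_⟩
  have e : ‖(u + w).1.snd‖ ^ 2 - ‖u.1.snd‖ ^ 2 - ((2 : ℝ) • dirichletDeriv u) w
      = ‖w.1.snd‖ ^ 2 := by
    rw [snd_add, norm_add_sq_real]
    simp only [smul_apply, smul_eq_mul, dirichletDeriv_apply]
    ring
  rw [e, abs_of_nonneg (by positivity)]
  have h1 := norm_snd_le w
  have h2 := norm_nonneg w.1.snd
  generalize ‖w.1.snd‖ = a at *
  generalize ‖w‖ = b at *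
  have h3 : 0 ≤ b ^ (2 : ℝ) := by rw [Real.rpow_two]; positivity
  have h4 : a ^ 2 ≤ b ^ 2 := pow_le_pow_left₀ h2 h1 2
  linarith

theorem energy_eq (h : HartreeExponents N α p) (hq : SobolevExponent N q) (u : H1 N) :
    energy α p q γ μ u = 1 / 2 * ‖u.1.snd‖ ^ 2
      - γ / (2 * p) * rieszForm α (powMul p u u) (powMul p u u)
      - μ / q * ∫ x, powMul q u u x := by
  unfold energy
  rw [integral_norm_sq_grad, rieszForm_eq_integral h.one_le h.pos h.lt_dim (h.finiteEnergy u u)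
    (h.finiteEnergy u u), powMul_self h.one_lt, powMul_self hq.one_lt]
  rfl

/-- The derivative of the energy on `H¹`. -/
def energyDeriv (h : HartreeExponents N α p) (hq : SobolevExponent N q) (γ μ : ℝ) (u : H1 N) :
    H1 N →L[ℝ] ℝ :=
  dirichletDeriv u - γ • hartreeDeriv h u - μ • powerDeriv hq u

set_option maxHeartbeats 2000000 in
theorem hasFDerivAt_energy (h : HartreeExponents N α p) (hq : SobolevExponent N q) (u : H1 N) :
    HasFDerivAt (energy α p q γ μ) (energyDeriv h hq γ μ u) u := by
  have h1 := (((hasFDerivAt_dirichlet u).const_mul (1 / 2)).sub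
    ((hasFDerivAt_hartree h u).const_mul (γ / (2 * p)))).sub
    ((hasFDerivAt_power hq u).const_mul (μ / q))
  have hp0 : p ≠ 0 := by linarith [h.one_lt]
  have hq0 : q ≠ 0 := by linarith [hq.one_lt]
  have e : energyDeriv h hq γ μ u = (1 / 2 : ℝ) • (2 : ℝ) • dirichletDeriv u
      - (γ / (2 * p)) • (2 * p) • hartreeDeriv h u - (μ / q) • q • powerDeriv hq u := by
    rw [energyDeriv, smul_smul, smul_smul, smul_smul]
    congr 2
    · simp
    · field_simp
    · field_simp
  rw [e]
  exact h1.congr_of_eventuallyEq (Eventually.of_forall fun v => energy_eq h hq v)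

set_option maxHeartbeats 2000000 in
/-- Convexity of the energy in the repulsive case. -/
theorem energy_sub_ge (h : HartreeExponents N α p) (hq : SobolevExponent N q) (hγ : γ ≤ 0)
    (hμ : μ ≤ 0) (u v : H1 N) :
    energyDeriv h hq γ μ u (v - u) ≤ energy α p q γ μ v - energy α p q γ μ u := by
  have hp0 : 0 < p := by linarith [h.one_lt]
  have hq0 : 0 < q := by linarith [hq.one_lt]
  have h1 := mul_le_mul_of_nonneg_left (hartree_sub_ge h u v)
    (div_nonneg (neg_nonneg.2 hγ) (show 0 ≤ 2 * p by linarith))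
  have h2 := mul_le_mul_of_nonneg_left (power_sub_ge hq u v)
    (div_nonneg (neg_nonneg.2 hμ) hq0.le)
  have h3 : 2 * dirichletDeriv u (v - u) ≤ ‖v.1.snd‖ ^ 2 - ‖u.1.snd‖ ^ 2 := by
    rw [dirichletDeriv_apply, snd_sub, inner_sub_right, real_inner_self_eq_norm_sq]
    have := norm_sub_sq_real v.1.snd u.1.snd
    rw [real_inner_comm] at this
    nlinarith [sq_nonneg ‖v.1.snd - u.1.snd‖]
  have h4 : -γ / (2 * p) * (2 * p * hartreeDeriv h u (v - u)) =
      -(γ * hartreeDeriv h u (v - u)) := by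
    field_simp
  have h5 : -μ / q * (q * powerDeriv hq u (v - u)) = -(μ * powerDeriv hq u (v - u)) := by
    field_simp
  rw [h4] at h1
  rw [h5] at h2
  rw [energy_eq h hq, energy_eq h hq, energyDeriv]
  simp only [sub_apply, smul_apply, smul_eq_mul]
  rw [neg_div] at h1 h2
  linarith

end Energy

/-! ### Stretching maps of `ℝ^N` -/

/-- A bounded smooth displacement profile `η` on the line with slope `η' ∈ [0, 1]`. -/
structure Profile where
  /-- the displacement `η` -/
  disp : ℝ → ℝ
  /-- its derivative `η'` -/
  slope : ℝ → ℝ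
  /-- a bound for `|η|` -/
  bound : ℝ
  hasDerivAt : ∀ r, HasDerivAt disp (slope r) r
  contDiff_slope : ContDiff ℝ ∞ slope
  slope_nonneg : ∀ r, 0 ≤ slope r
  slope_le_one : ∀ r, slope r ≤ 1
  abs_disp_le : ∀ r, |disp r| ≤ bound

namespace Profile

variable (η : Profile) {σ : ℝ}

theorem deriv_disp : deriv η.disp = η.slope := funext fun r => (η.hasDerivAt r).deriv

theorem differentiable_disp : Differentiable ℝ η.disp := fun r => (η.hasDerivAt r).differentiableAt

theorem contDiff_disp : ContDiff ℝ ∞ η.disp := by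
  rw [contDiff_infty_iff_deriv, η.deriv_disp]
  exact ⟨η.differentiable_disp, η.contDiff_slope⟩

theorem bound_nonneg : 0 ≤ η.bound := (abs_nonneg _).trans (η.abs_disp_le 0)

theorem mul_sub_le_disp_sub {ρ κ : ℝ} (h : ∀ r, |r| ≤ ρ → κ ≤ η.slope r) {r s : ℝ}
    (hr : |r| ≤ ρ) (hs : |s| ≤ ρ) (hrs : r ≤ s) : κ * (s - r) ≤ η.disp s - η.disp r := by
  refine (convex_Icc (-ρ) ρ).mul_sub_le_image_sub_of_le_deriv
    η.differentiable_disp.continuous.continuousOn η.differentiable_disp.differentiableOn ?_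
    r (abs_le.1 hr) s (abs_le.1 hs) hrs
  intro x hx
  rw [η.deriv_disp]
  have hx' : x ∈ Icc (-ρ) ρ := interior_subset hx
  exact h x (abs_le.2 ⟨hx'.1, hx'.2⟩)

/-- Moving by `σ η` expands distances on the line by at least `1 + σ κ` where `η' ≥ κ`. -/
theorem mul_abs_sub_le (hσ : 0 ≤ σ) {ρ κ : ℝ} (h : ∀ r, |r| ≤ ρ → κ ≤ η.slope r)
    {r s : ℝ} (hr : |r| ≤ ρ) (hs : |s| ≤ ρ) :
    (1 + σ * κ) * |s - r| ≤ |(s + σ * η.disp s) - (r + σ * η.disp r)| := by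
  have key : ∀ r s : ℝ, |r| ≤ ρ → |s| ≤ ρ → r ≤ s →
      (1 + σ * κ) * |s - r| ≤ |(s + σ * η.disp s) - (r + σ * η.disp r)| := by
    intro r s hr hs hrs
    rw [abs_of_nonneg (sub_nonneg.2 hrs)]
    refine le_trans ?_ (le_abs_self _)
    have := mul_le_mul_of_nonneg_left (η.mul_sub_le_disp_sub h hr hs hrs) hσ
    nlinarith
  rcases le_total r s with hrs | hrs
  · exact key r s hr hs hrs
  · rw [abs_sub_comm s r, abs_sub_comm (s + _)]
    exact key s r hs hr hrs

theorem abs_sub_le (hσ : 0 ≤ σ) (r s : ℝ) :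
    |s - r| ≤ |(s + σ * η.disp s) - (r + σ * η.disp r)| := by
  have := η.mul_abs_sub_le (ρ := max |r| |s|) hσ (fun r _ => η.slope_nonneg r)
    (le_max_left _ _) (le_max_right |r| |s|)
  simpa using this

theorem strictMono_add_mul_disp (hσ : 0 ≤ σ) : StrictMono fun r => r + σ * η.disp r := by
  refine (strictMono_id).add_monotone (fun r s hrs => ?_)
  have := η.mul_sub_le_disp_sub (ρ := max |r| |s|) (fun r _ => η.slope_nonneg r)
    (le_max_left _ _) (le_max_right |r| |s|) hrs
  have := mul_le_mul_of_nonneg_left this hσ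
  linarith

theorem surjective_add_mul_disp (hσ : 0 ≤ σ) : Function.Surjective fun r => r + σ * η.disp r := by
  have hb : ∀ r, |σ * η.disp r| ≤ σ * η.bound := fun r => by
    rw [abs_mul, abs_of_nonneg hσ]
    exact mul_le_mul_of_nonneg_left (η.abs_disp_le r) hσ
  refine Continuous.surjective
    (continuous_id.add (continuous_const.mul η.differentiable_disp.continuous)) ?_ ?_
  · refine tendsto_atTop_mono (fun r => ?_) (tendsto_atTop_add_const_right _ (-(σ * η.bound))
      tendsto_id)
    have := (abs_le.1 (hb r)).1
    simpa using this
  · refine tendsto_atBot_mono (fun r => ?_) (tendsto_atBot_add_const_right _ (σ * η.bound)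
      tendsto_id)
    have := (abs_le.1 (hb r)).2
    simpa using this

/-- The increasing bijection `r ↦ r + σ η(r)` of the line. -/
def lineIso (hσ : 0 ≤ σ) : ℝ ≃o ℝ :=
  (η.strictMono_add_mul_disp hσ).orderIsoOfSurjective _ (η.surjective_add_mul_disp hσ)

/-- The homeomorphism `y ↦ (y_i + σ η(y_i))_i` of `ℝ^N`. -/
def stretch (hσ : 0 ≤ σ) : Space N ≃ₜ Space N where
  toFun y := WithLp.toLp 2 fun i => η.lineIso hσ (y i)
  invFun y := WithLp.toLp 2 fun i => (η.lineIso hσ).symm (y i)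
  left_inv y := by ext i; simp
  right_inv y := by ext i; simp
  continuous_toFun := by
    refine (PiLp.continuous_toLp 2 _).comp (continuous_pi fun i => ?_)
    exact (η.lineIso hσ).continuous.comp (by fun_prop)
  continuous_invFun := by
    refine (PiLp.continuous_toLp 2 _).comp (continuous_pi fun i => ?_)
    exact (η.lineIso hσ).symm.continuous.comp (by fun_prop)

theorem stretch_apply (hσ : 0 ≤ σ) (y : Space N) (i : Fin N) :
    η.stretch hσ y i = y i + σ * η.disp (y i) := rfl

/-- The line stretching factor `1 + σ η'`. -/
def factor (σ r : ℝ) : ℝ := 1 + σ * η.slope r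

theorem one_le_factor (hσ : 0 ≤ σ) (r : ℝ) : 1 ≤ η.factor σ r := by
  have := mul_nonneg hσ (η.slope_nonneg r)
  unfold factor; linarith

theorem factor_pos (hσ : 0 ≤ σ) (r : ℝ) : 0 < η.factor σ r :=
  one_pos.trans_le (η.one_le_factor hσ r)

theorem factor_le (hσ : 0 ≤ σ) (r : ℝ) : η.factor σ r ≤ 1 + σ := by
  have := mul_le_mul_of_nonneg_left (η.slope_le_one r) hσ
  unfold factor; linarith

theorem contDiff_factor : ContDiff ℝ ∞ (η.factor σ) :=
  contDiff_const.add (contDiff_const.mul η.contDiff_slope)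

/-- The Jacobian determinant of the stretching map. -/
def jac (σ : ℝ) (y : Space N) : ℝ := ∏ i, η.factor σ (y i)

theorem jac_pos (hσ : 0 ≤ σ) (y : Space N) : 0 < η.jac σ y :=
  Finset.prod_pos fun i _ => η.factor_pos hσ (y i)

theorem one_le_jac (hσ : 0 ≤ σ) (y : Space N) : 1 ≤ η.jac σ y := by
  have := Finset.prod_le_prod (s := Finset.univ) (f := fun _ : Fin N => (1 : ℝ))
    (fun i _ => zero_le_one) (fun i _ => η.one_le_factor hσ (y i))
  simpa [jac] using this

theorem jac_le (hσ : 0 ≤ σ) (y : Space N) : η.jac σ y ≤ (1 + σ) ^ N := by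
  unfold jac
  refine (Finset.prod_le_prod (fun i _ => (η.factor_pos hσ (y i)).le)
    (fun i _ => η.factor_le hσ (y i))).trans_eq ?_
  simp

theorem continuous_jac : Continuous (η.jac σ : Space N → ℝ) := by
  unfold jac
  refine continuous_finsetProd _ fun i _ => η.contDiff_factor.continuous.comp (by fun_prop)

/-- The derivative of the stretching map at `y`: the diagonal map with entries
`1 + σ η'(y_i)`. -/
def stretchDeriv (σ : ℝ) (y : Space N) : Space N →L[ℝ] Space N :=
  LinearMap.toContinuousLinearMap
    (Matrix.toLin (EuclideanSpace.basisFun (Fin N) ℝ).toBasis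
      (EuclideanSpace.basisFun (Fin N) ℝ).toBasis
      (Matrix.diagonal fun i => η.factor σ (y i)))

theorem stretchDeriv_apply (y w : Space N) (i : Fin N) :
    η.stretchDeriv σ y w i = η.factor σ (y i) * w i := by
  unfold stretchDeriv
  rw [LinearMap.coe_toContinuousLinearMap']
  have := congrFun (Matrix.repr_toLin (EuclideanSpace.basisFun (Fin N) ℝ).toBasis
      (EuclideanSpace.basisFun (Fin N) ℝ).toBasis
      (Matrix.diagonal fun i => η.factor σ (y i)) w) i
  simpa [Matrix.mulVec_diagonal] using this

theorem det_stretchDeriv (y : Space N) : (η.stretchDeriv σ y).det = η.jac σ y := by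
  unfold stretchDeriv jac
  rw [LinearMap.det_toContinuousLinearMap, LinearMap.det_toLin, Matrix.det_diagonal]

theorem hasFDerivAt_stretch (hσ : 0 ≤ σ) (y : Space N) :
    HasFDerivAt (η.stretch hσ : Space N → Space N) (η.stretchDeriv σ y) y := by
  rw [← hasFDerivWithinAt_univ, hasFDerivWithinAt_euclidean]
  intro i
  rw [hasFDerivWithinAt_univ]
  have h : HasFDerivAt (fun y : Space N => y i) (EuclideanSpace.proj i : Space N →L[ℝ] ℝ) y :=
    (EuclideanSpace.proj i : Space N →L[ℝ] ℝ).hasFDerivAt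
  refine (h.add (((η.hasDerivAt (y i)).comp_hasFDerivAt y h).const_mul σ)).congr_fderiv ?_
  ext w
  have hw := η.stretchDeriv_apply (σ := σ) y w i
  simp only [ContinuousLinearMap.comp_apply, PiLp.proj_apply, hw, factor, add_apply, smul_apply,
    smul_eq_mul]
  ring

theorem contDiff_stretch (hσ : 0 ≤ σ) : ContDiff ℝ ∞ (η.stretch hσ : Space N → Space N) := by
  rw [contDiff_euclidean]
  intro i
  have h : ContDiff ℝ ∞ fun y : Space N => y i := contDiff_euclidean.1 contDiff_id i
  exact h.add (contDiff_const.mul (η.contDiff_disp.comp h))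

theorem lintegral_comp_stretch_symm (hσ : 0 ≤ σ) (g : Space N → ℝ≥0∞) :
    ∫⁻ x, g ((η.stretch hσ).symm x) = ∫⁻ y, ENNReal.ofReal (η.jac σ y) * g y := by
  have h := lintegral_image_eq_lintegral_abs_det_fderiv_mul volume (s := univ) MeasurableSet.univ
    (fun y _ => (η.hasFDerivAt_stretch hσ y).hasFDerivWithinAt) (η.stretch hσ).injective.injOn
    (fun x => g ((η.stretch hσ).symm x))
  rw [image_univ, (η.stretch hσ).surjective.range_eq, setLIntegral_univ, setLIntegral_univ] at h
  rw [h]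
  refine lintegral_congr fun y => ?_
  rw [det_stretchDeriv, abs_of_pos (η.jac_pos hσ y), Homeomorph.symm_apply_apply]

theorem integral_comp_stretch_symm (hσ : 0 ≤ σ) (g : Space N → ℝ) :
    ∫ x, g ((η.stretch hσ).symm x) = ∫ y, η.jac σ y * g y := by
  have h := integral_image_eq_integral_abs_det_fderiv_smul volume (s := univ) MeasurableSet.univ
    (fun y _ => (η.hasFDerivAt_stretch hσ y).hasFDerivWithinAt) (η.stretch hσ).injective.injOn
    (fun x => g ((η.stretch hσ).symm x))
  rw [image_univ, (η.stretch hσ).surjective.range_eq, setIntegral_univ, setIntegral_univ] at h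
  rw [h]
  refine integral_congr_ae (ae_of_all _ fun y => ?_)
  simp only
  rw [det_stretchDeriv, abs_of_pos (η.jac_pos hσ y), Homeomorph.symm_apply_apply, smul_eq_mul]

theorem map_stretch_symm_le (hσ : 0 ≤ σ) :
    Measure.map (η.stretch hσ).symm (volume : Measure (Space N)) ≤
      ENNReal.ofReal ((1 + σ) ^ N) • volume := by
  refine Measure.le_iff.2 fun s hs => ?_
  rw [Measure.map_apply (η.stretch hσ).symm.continuous.measurable hs]
  have h := η.lintegral_comp_stretch_symm (N := N) hσ (s.indicator 1)
  have e1 : ∫⁻ x, s.indicator (1 : Space N → ℝ≥0∞) ((η.stretch hσ).symm x)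
      = volume ((η.stretch hσ).symm ⁻¹' s) := by
    rw [← lintegral_indicator_one ((η.stretch hσ).symm.continuous.measurable hs)]
    rfl
  rw [← e1, h, Measure.smul_apply, ← lintegral_indicator_one hs, smul_eq_mul,
    ← lintegral_const_mul' _ _ ENNReal.ofReal_ne_top]
  refine lintegral_mono fun y => ?_
  gcongr
  exact η.jac_le hσ y

theorem quasiMeasurePreserving_stretch_symm (hσ : 0 ≤ σ) :
    Measure.QuasiMeasurePreserving (η.stretch hσ).symm (volume : Measure (Space N)) volume :=
  ⟨(η.stretch hσ).symm.continuous.measurable,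
    (Measure.absolutelyContinuous_of_le (η.map_stretch_symm_le hσ)).trans
      (Measure.smul_absolutelyContinuous)⟩

theorem memLp_comp_stretch_symm {F : Type*} [NormedAddCommGroup F] (hσ : 0 ≤ σ) {f : Space N → F}
    {r : ℝ≥0∞} (hf : MemLp f r (volume : Measure (Space N))) :
    MemLp (fun x => f ((η.stretch hσ).symm x)) r (volume : Measure (Space N)) :=
  (hf.of_measure_le_smul ENNReal.ofReal_ne_top (η.map_stretch_symm_le hσ)).comp_of_map
    (η.stretch hσ).symm.continuous.measurable.aemeasurable

end Profile

/-! ### Transport of `H¹` functions along a stretching map -/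

/-- It suffices to test weak gradients in the coordinate directions. -/
theorem isWeakGradient_of_coord {f : Space N → ℝ} {g : Space N → Space N}
    (hf : MemLp f 2 (volume : Measure (Space N))) (hg : MemLp g 2 (volume : Measure (Space N)))
    (h : ∀ φ : Space N → ℝ, IsTest φ → ∀ i : Fin N,
      ∫ x, f x * fderiv ℝ φ x (EuclideanSpace.single i 1) = - ∫ x, g x i * φ x) :
    IsWeakGradient f g := by
  intro φ hφ v
  have hv : v = ∑ i, v i • EuclideanSpace.single i (1 : ℝ) := by
    have := (EuclideanSpace.basisFun (Fin N) ℝ).sum_repr v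
    simpa using this.symm
  have e1 : ∀ x, f x * fderiv ℝ φ x v
      = ∑ i, v i * (f x * fderiv ℝ φ x (EuclideanSpace.single i 1)) := by
    intro x
    conv_lhs => rw [hv]
    rw [map_sum, Finset.mul_sum]
    refine Finset.sum_congr rfl fun i _ => ?_
    rw [map_smul, smul_eq_mul]; ring
  have e2 : ∀ x, inner ℝ (g x) v * φ x = ∑ i, v i * (g x i * φ x) := by
    intro x
    rw [PiLp.inner_apply, Finset.sum_mul]
    refine Finset.sum_congr rfl fun i _ => ?_
    simp only [RCLike.inner_apply, conj_trivial]; ring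
  simp only [e1, e2]
  have hgi : ∀ i, MemLp (fun x => g x i) 2 (volume : Measure (Space N)) := fun i =>
    hg.mono ((by fun_prop : Continuous fun w : Space N => w i).comp_aestronglyMeasurable hg.1)
      (ae_of_all _ fun x => PiLp.norm_apply_le (g x) i)
  have i1 : ∀ i, Integrable
      fun x => v i * (f x * fderiv ℝ φ x (EuclideanSpace.single i 1)) := fun i =>
    (hf.integrable_mul (hφ.memLp_fderiv _)).const_mul _
  have i2 : ∀ i, Integrable fun x => v i * (g x i * φ x) := fun i =>
    ((hgi i).integrable_mul hφ.memLp).const_mul _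
  rw [integral_finsetSum _ fun i _ => i1 i, integral_finsetSum _ fun i _ => i2 i,
    ← Finset.sum_neg_distrib]
  refine Finset.sum_congr rfl fun i _ => ?_
  rw [integral_const_mul, integral_const_mul, h φ hφ i]
  ring

/-- The normalising amplitude `(1 + σ)^(-N/2)`. -/
def amp (N : ℕ) (σ : ℝ) : ℝ := (1 + σ) ^ (-((N : ℝ) / 2))

namespace Profile

variable (η : Profile) {σ : ℝ}

/-- The inverse of `stretchDeriv` at `y`. -/
def squeeze (σ : ℝ) (y w : Space N) : Space N := WithLp.toLp 2 fun i => w i / η.factor σ (y i)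

theorem squeeze_apply (y w : Space N) (i : Fin N) :
    η.squeeze σ y w i = w i / η.factor σ (y i) := rfl

theorem continuous_squeeze (hσ : 0 ≤ σ) :
    Continuous fun z : Space N × Space N => η.squeeze σ z.1 z.2 := by
  refine (PiLp.continuous_toLp 2 _).comp (continuous_pi fun i => ?_)
  refine Continuous.div (by fun_prop) (η.contDiff_factor.continuous.comp (by fun_prop)) fun z => ?_
  exact (η.factor_pos hσ _).ne'

theorem mul_norm_sq_squeeze_le {k : ℝ} {y : Space N} (w : Space N)
    (h : ∀ i, 1 ≤ k * η.factor σ (y i) ^ 2) (hσ : 0 ≤ σ) :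
    ‖η.squeeze σ y w‖ ^ 2 ≤ k * ‖w‖ ^ 2 := by
  rw [EuclideanSpace.norm_sq_eq, EuclideanSpace.norm_sq_eq, Finset.mul_sum]
  refine Finset.sum_le_sum fun i _ => ?_
  rw [squeeze_apply, Real.norm_eq_abs, Real.norm_eq_abs, sq_abs, sq_abs, div_pow,
    div_le_iff₀ (pow_pos (η.factor_pos hσ _) 2)]
  have := mul_le_mul_of_nonneg_left (h i) (sq_nonneg (w i))
  linarith

theorem norm_squeeze_le (hσ : 0 ≤ σ) (y w : Space N) : ‖η.squeeze σ y w‖ ≤ ‖w‖ := by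
  refine le_of_sq_le_sq ?_ (norm_nonneg _)
  have := η.mul_norm_sq_squeeze_le (σ := σ) (k := 1) (y := y) w
    (fun i => by rw [one_mul]; exact one_le_pow₀ (η.one_le_factor hσ _)) hσ
  rwa [one_mul] at this

theorem memLp_squeeze_comp (hσ : 0 ≤ σ) (a : ℝ) {g : Space N → Space N}
    (hg : MemLp g 2 (volume : Measure (Space N))) :
    MemLp (fun x => a • η.squeeze σ ((η.stretch hσ).symm x) (g ((η.stretch hσ).symm x))) 2
      (volume : Measure (Space N)) := by
  have h := η.memLp_comp_stretch_symm hσ hg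
  refine MemLp.const_smul (h.mono ?_ (ae_of_all _ fun x => η.norm_squeeze_le hσ _ _)) a
  exact (η.continuous_squeeze hσ).comp_aestronglyMeasurable
    ((η.stretch hσ).symm.continuous.aestronglyMeasurable.prodMk h.1)

/-- The product of the stretching factors in the directions other than `i`. -/
def cofactor (σ : ℝ) (i : Fin N) (y : Space N) : ℝ :=
  ∏ j ∈ Finset.univ.erase i, η.factor σ (y j)

theorem factor_mul_cofactor (i : Fin N) (y : Space N) :
    η.factor σ (y i) * η.cofactor σ i y = η.jac σ y :=
  Finset.mul_prod_erase _ (fun j => η.factor σ (y j)) (Finset.mem_univ i)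

theorem contDiff_cofactor (i : Fin N) : ContDiff ℝ ∞ (η.cofactor σ i) := by
  unfold cofactor
  refine contDiff_prod fun j _ => ?_
  exact η.contDiff_factor.comp (contDiff_euclidean.1 contDiff_id j)

theorem fderiv_cofactor_single (i : Fin N) (y : Space N) :
    fderiv ℝ (η.cofactor σ i) y (EuclideanSpace.single i 1) = 0 := by
  have hd : DifferentiableAt ℝ (η.cofactor σ i) y :=
    (η.contDiff_cofactor i).differentiable (by simp) y
  rw [← hd.lineDeriv_eq_fderiv, lineDeriv]
  have : (fun t : ℝ => η.cofactor σ i (y + t • EuclideanSpace.single i 1))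
      = fun _ => η.cofactor σ i y := by
    funext t
    refine Finset.prod_congr rfl fun j hj => ?_
    have hji : j ≠ i := Finset.ne_of_mem_erase hj
    simp [hji]
  rw [this, deriv_const]

/-- The test function `φ ∘ Ψ` times the `i`-th cofactor of the stretching map `Ψ`. -/
def pullTest (hσ : 0 ≤ σ) (i : Fin N) (φ : Space N → ℝ) (y : Space N) : ℝ :=
  φ (η.stretch hσ y) * η.cofactor σ i y

theorem isTest_comp_stretch (hσ : 0 ≤ σ) {φ : Space N → ℝ} (hφ : IsTest φ) :
    IsTest (fun y => φ (η.stretch hσ y)) :=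
  ⟨hφ.1.comp (η.contDiff_stretch hσ), hφ.2.comp_homeomorph (η.stretch hσ)⟩

theorem isTest_pullTest (hσ : 0 ≤ σ) (i : Fin N) {φ : Space N → ℝ} (hφ : IsTest φ) :
    IsTest (η.pullTest hσ i φ) :=
  ⟨(η.isTest_comp_stretch hσ hφ).1.mul (η.contDiff_cofactor i),
    (η.isTest_comp_stretch hσ hφ).2.mul_right⟩

theorem stretchDeriv_single (y : Space N) (i : Fin N) :
    η.stretchDeriv σ y (EuclideanSpace.single i 1)
      = η.factor σ (y i) • EuclideanSpace.single i (1 : ℝ) := by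
  ext j
  rw [stretchDeriv_apply]
  rcases eq_or_ne j i with rfl | h
  · simp
  · simp [h]

theorem fderiv_pullTest_single (hσ : 0 ≤ σ) (i : Fin N) {φ : Space N → ℝ} (hφ : IsTest φ)
    (y : Space N) :
    fderiv ℝ (η.pullTest hσ i φ) y (EuclideanSpace.single i 1)
      = η.jac σ y * fderiv ℝ φ (η.stretch hσ y) (EuclideanSpace.single i 1) := by
  have h1 : HasFDerivAt (fun y => φ (η.stretch hσ y))
      ((fderiv ℝ φ (η.stretch hσ y)).comp (η.stretchDeriv σ y)) y :=
    (hφ.differentiable _).hasFDerivAt.comp y (η.hasFDerivAt_stretch hσ y)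
  have h2 : HasFDerivAt (η.cofactor σ i) (fderiv ℝ (η.cofactor σ i) y) y :=
    ((η.contDiff_cofactor i).differentiable (by simp) y).hasFDerivAt
  have h3 : HasFDerivAt (η.pullTest hσ i φ) _ y := h1.mul h2
  rw [h3.fderiv]
  simp only [add_apply, smul_apply, ContinuousLinearMap.comp_apply, fderiv_cofactor_single,
    stretchDeriv_single, map_smul, smul_eq_mul, mul_zero, zero_add]
  rw [← factor_mul_cofactor η i y]
  ring

theorem isWeakGradient_comp_stretch_symm (hσ : 0 ≤ σ) (u : H1 N) (a : ℝ) :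
    IsWeakGradient (fun x => a * fn u ((η.stretch hσ).symm x))
      (fun x => a • η.squeeze σ ((η.stretch hσ).symm x) (grad u ((η.stretch hσ).symm x))) := by
  refine isWeakGradient_of_coord ((η.memLp_comp_stretch_symm hσ (memLp_fn u)).const_mul a)
    (η.memLp_squeeze_comp hσ a (memLp_grad u)) fun φ hφ i => ?_
  have key := isWeakGradient u _ (η.isTest_pullTest hσ i hφ) (EuclideanSpace.single i 1)
  have e1 := η.integral_comp_stretch_symm hσ (fun y => a * fn u y *
    fderiv ℝ φ (η.stretch hσ y) (EuclideanSpace.single i 1))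
  have e2 := η.integral_comp_stretch_symm hσ (fun y => a * (grad u y i / η.factor σ (y i)) *
    φ (η.stretch hσ y))
  simp only [Homeomorph.apply_symm_apply] at e1 e2
  have e2' : ∫ x, (a • η.squeeze σ ((η.stretch hσ).symm x) (grad u ((η.stretch hσ).symm x))) i
      * φ x = ∫ y, η.jac σ y * (a * (grad u y i / η.factor σ (y i)) * φ (η.stretch hσ y)) := e2
  rw [e1, e2']
  have e3 : ∀ y, η.jac σ y * (a * fn u y *
      fderiv ℝ φ (η.stretch hσ y) (EuclideanSpace.single i 1))
      = a * (fn u y * fderiv ℝ (η.pullTest hσ i φ) y (EuclideanSpace.single i 1)) := by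
    intro y
    rw [η.fderiv_pullTest_single hσ i hφ]; ring
  have e4 : ∀ y, η.jac σ y * (a * (grad u y i / η.factor σ (y i)) * φ (η.stretch hσ y))
      = a * (inner ℝ (grad u y) (EuclideanSpace.single i 1) * η.pullTest hσ i φ y) := by
    intro y
    have := (η.factor_pos hσ (y i)).ne'
    rw [EuclideanSpace.inner_single_right, pullTest, ← η.factor_mul_cofactor i y]
    simp only [one_mul, conj_trivial]
    field_simp
  simp only [e3, e4]
  rw [integral_const_mul, integral_const_mul, key]
  ring

/-- The transported function `(1 + σ)^(-N/2) u ∘ Ψ⁻¹`, `Ψ` being the stretching map. -/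
def transport (hσ : 0 ≤ σ) (u : H1 N) : H1 N :=
  mkH1 (fun x => amp N σ * fn u ((η.stretch hσ).symm x))
    (fun x => amp N σ • η.squeeze σ ((η.stretch hσ).symm x) (grad u ((η.stretch hσ).symm x)))
    ((η.memLp_comp_stretch_symm hσ (memLp_fn u)).const_mul _)
    (η.memLp_squeeze_comp hσ _ (memLp_grad u))
    (η.isWeakGradient_comp_stretch_symm hσ u _)

theorem fn_transport (hσ : 0 ≤ σ) (u : H1 N) :
    fn (η.transport hσ u) =ᵐ[volume] fun x => amp N σ * fn u ((η.stretch hσ).symm x) :=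
  fn_mkH1 ((η.memLp_comp_stretch_symm hσ (memLp_fn u)).const_mul _)
    (η.memLp_squeeze_comp hσ _ (memLp_grad u)) (η.isWeakGradient_comp_stretch_symm hσ u _)

theorem grad_transport (hσ : 0 ≤ σ) (u : H1 N) :
    grad (η.transport hσ u) =ᵐ[volume] fun x => amp N σ •
      η.squeeze σ ((η.stretch hσ).symm x) (grad u ((η.stretch hσ).symm x)) :=
  grad_mkH1 ((η.memLp_comp_stretch_symm hσ (memLp_fn u)).const_mul _)
    (η.memLp_squeeze_comp hσ _ (memLp_grad u)) (η.isWeakGradient_comp_stretch_symm hσ u _)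

end Profile

/-! ### Mass, gradient and power terms under transport -/

theorem one_sub_sum_le_prod {ι : Type*} (s : Finset ι) {f : ι → ℝ} (h0 : ∀ i, 0 ≤ f i)
    (h1 : ∀ i, f i ≤ 1) : 1 - ∑ i ∈ s, (1 - f i) ≤ ∏ i ∈ s, f i := by
  classical
  induction s using Finset.induction_on with
  | empty => simp
  | insert a s ha ih =>
    rw [Finset.sum_insert ha, Finset.prod_insert ha]
    have hP0 : 0 ≤ ∏ i ∈ s, f i := Finset.prod_nonneg fun i _ => h0 i
    have hP1 : ∏ i ∈ s, f i ≤ 1 := Finset.prod_le_one (fun i _ => h0 i) fun i _ => h1 i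
    nlinarith [h1 a, h0 a, mul_nonneg (sub_nonneg.2 (h1 a)) (sub_nonneg.2 hP1)]

theorem amp_pos {σ : ℝ} (hσ : 0 ≤ σ) : 0 < amp N σ := Real.rpow_pos_of_pos (by linarith) _

theorem amp_le_one {σ : ℝ} (hσ : 0 ≤ σ) : amp N σ ≤ 1 :=
  Real.rpow_le_one_of_one_le_of_nonpos (by linarith) (by simp; positivity)

theorem amp_sq {σ : ℝ} (hσ : 0 ≤ σ) : amp N σ ^ 2 = ((1 + σ) ^ N)⁻¹ := by
  unfold amp
  rw [← Real.rpow_natCast, ← Real.rpow_mul (by linarith), ← Real.rpow_natCast (1 + σ) N,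
    ← Real.rpow_neg (by linarith)]
  congr 1
  push_cast; ring

theorem one_sub_amp_le {σ : ℝ} (hσ : 0 ≤ σ) : 1 - amp N σ ≤ N * σ := by
  have h1 : 1 - amp N σ ≤ 1 - amp N σ ^ 2 := by
    have := amp_pos (N := N) hσ
    have := amp_le_one (N := N) hσ
    nlinarith
  refine h1.trans ?_
  rw [amp_sq hσ, ← inv_pow]
  have h2 := one_add_mul_le_pow (a := (1 + σ)⁻¹ - 1)
    (by have : 0 ≤ (1 + σ)⁻¹ := inv_nonneg.2 (by linarith)
        linarith) N
  have h3 : 1 - (1 + σ)⁻¹ ≤ σ := by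
    rw [sub_le_iff_le_add, ← sub_le_iff_le_add', ← one_div, le_div_iff₀ (by linarith)]
    nlinarith
  have h4 : (N : ℝ) * (1 - (1 + σ)⁻¹) ≤ N * σ := by gcongr
  have h5 : 1 + ((1 + σ)⁻¹ - 1) = (1 + σ)⁻¹ := by ring
  rw [h5] at h2
  linarith

theorem abs_apply_le {y : Space N} {ρ : ℝ} (hy : ‖y‖ ≤ ρ) (i : Fin N) : |y i| ≤ ρ :=
  (PiLp.norm_apply_le y i).trans hy

theorem integrable_sq_fn (u : H1 N) : Integrable (fun x => fn u x ^ 2) :=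
  (memLp_fn u).integrable_sq

theorem integrable_norm_sq_grad (u : H1 N) : Integrable (fun x => ‖grad u x‖ ^ 2) :=
  (memLp_grad u).norm.integrable_sq

theorem norm_sq_fst (u : H1 N) : ‖u.1.fst‖ ^ 2 = ∫ x, fn u x ^ 2 := by
  rw [← real_inner_self_eq_norm_sq, L2.inner_def]
  refine integral_congr_ae (ae_of_all _ fun x => ?_)
  simp only [real_inner_self_eq_norm_sq, Real.norm_eq_abs, sq_abs]
  rfl

namespace Profile

variable (η : Profile) {σ : ℝ}

theorem amp_sq_mul_jac (hσ : 0 ≤ σ) (y : Space N) :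
    amp N σ ^ 2 * η.jac σ y = ∏ i, η.factor σ (y i) / (1 + σ) := by
  rw [amp_sq hσ, Finset.prod_div_distrib, Finset.prod_const, Finset.card_univ, Fintype.card_fin,
    jac]
  ring

theorem factor_div_le_one (hσ : 0 ≤ σ) (r : ℝ) : η.factor σ r / (1 + σ) ≤ 1 :=
  div_le_one_of_le₀ (η.factor_le hσ r) (by linarith)

theorem factor_div_nonneg (hσ : 0 ≤ σ) (r : ℝ) : 0 ≤ η.factor σ r / (1 + σ) :=
  div_nonneg (η.factor_pos hσ r).le (by linarith)

theorem amp_sq_mul_jac_le_one (hσ : 0 ≤ σ) (y : Space N) : amp N σ ^ 2 * η.jac σ y ≤ 1 := by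
  rw [η.amp_sq_mul_jac hσ]
  exact Finset.prod_le_one (fun i _ => η.factor_div_nonneg hσ _) fun i _ => η.factor_div_le_one hσ _

theorem one_sub_amp_sq_mul_jac_le (hσ : 0 ≤ σ) (y : Space N) :
    1 - amp N σ ^ 2 * η.jac σ y ≤ σ * ∑ i, (1 - η.slope (y i)) := by
  rw [η.amp_sq_mul_jac hσ]
  have h := one_sub_sum_le_prod Finset.univ (f := fun i => η.factor σ (y i) / (1 + σ))
    (fun i => η.factor_div_nonneg hσ _) (fun i => η.factor_div_le_one hσ _)
  have h2 : ∑ i, (1 - η.factor σ (y i) / (1 + σ)) ≤ σ * ∑ i, (1 - η.slope (y i)) := by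
    rw [Finset.mul_sum]
    refine Finset.sum_le_sum fun i _ => ?_
    have h0 := η.slope_le_one (y i)
    have : 1 - η.factor σ (y i) / (1 + σ) = σ * (1 - η.slope (y i)) / (1 + σ) := by
      unfold factor
      field_simp
      ring
    rw [this]
    exact div_le_self (mul_nonneg hσ (by linarith)) (by linarith)
  linarith

theorem amp_rpow_mul_jac_le_one (hσ : 0 ≤ σ) {q : ℝ} (hq : 2 ≤ q) (y : Space N) :
    amp N σ ^ q * η.jac σ y ≤ 1 := by
  refine le_trans ?_ (η.amp_sq_mul_jac_le_one hσ y)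
  refine mul_le_mul_of_nonneg_right ?_ (η.jac_pos hσ y).le
  rw [← Real.rpow_two]
  exact Real.rpow_le_rpow_of_exponent_ge (amp_pos hσ) (amp_le_one hσ) hq

theorem integral_powMul_transport_le (hσ : 0 ≤ σ) {q : ℝ} (h : SobolevExponent N q) (u : H1 N) :
    ∫ x, powMul q (η.transport hσ u) (η.transport hσ u) x ≤ ∫ x, powMul q u u x := by
  have hi := h.integrable u u
  rw [powMul_self h.one_lt] at hi ⊢
  rw [powMul_self h.one_lt]
  have e1 : ∫ x, |fn (η.transport hσ u) x| ^ q
      = ∫ x, |amp N σ * fn u ((η.stretch hσ).symm x)| ^ q := by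
    refine integral_congr_ae ?_
    filter_upwards [η.fn_transport hσ u] with x hx
    rw [hx]
  rw [e1, η.integral_comp_stretch_symm hσ (fun y => |amp N σ * fn u y| ^ q)]
  refine integral_mono_of_nonneg (ae_of_all _ fun y => ?_) hi (ae_of_all _ fun y => ?_)
  · have := η.jac_pos hσ y
    simp only [Pi.zero_apply]
    positivity
  · simp only
    rw [abs_mul, abs_of_pos (amp_pos hσ), Real.mul_rpow (amp_pos hσ).le (abs_nonneg _),
      ← mul_assoc, mul_comm (η.jac σ y)]
    exact mul_le_of_le_one_left (by positivity) (η.amp_rpow_mul_jac_le_one hσ h.lower.le y)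

theorem norm_sq_fst_transport (hσ : 0 ≤ σ) (u : H1 N) :
    ‖(η.transport hσ u).1.fst‖ ^ 2 = ∫ y, amp N σ ^ 2 * η.jac σ y * fn u y ^ 2 := by
  rw [norm_sq_fst]
  have e1 : ∫ x, fn (η.transport hσ u) x ^ 2
      = ∫ x, (amp N σ * fn u ((η.stretch hσ).symm x)) ^ 2 := by
    refine integral_congr_ae ?_
    filter_upwards [η.fn_transport hσ u] with x hx
    rw [hx]
  rw [e1, η.integral_comp_stretch_symm hσ (fun y => (amp N σ * fn u y) ^ 2)]
  refine integral_congr_ae (ae_of_all _ fun x => ?_)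
  simp only; ring

theorem integrable_amp_jac_sq (hσ : 0 ≤ σ) (u : H1 N) :
    Integrable fun y => amp N σ ^ 2 * η.jac σ y * fn u y ^ 2 := by
  refine (integrable_sq_fn u).mono'
    ((continuous_const.mul η.continuous_jac).aestronglyMeasurable.mul (integrable_sq_fn u).1)
    (ae_of_all _ fun y => ?_)
  rw [Real.norm_eq_abs, abs_of_nonneg
    (mul_nonneg (mul_nonneg (sq_nonneg _) (η.jac_pos hσ y).le) (sq_nonneg _))]
  exact mul_le_of_le_one_left (sq_nonneg _) (η.amp_sq_mul_jac_le_one hσ y)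

theorem norm_fst_transport_le (hσ : 0 ≤ σ) (u : H1 N) :
    ‖(η.transport hσ u).1.fst‖ ≤ ‖u.1.fst‖ := by
  refine le_of_sq_le_sq ?_ (norm_nonneg _)
  rw [norm_sq_fst_transport, norm_sq_fst]
  exact integral_mono (η.integrable_amp_jac_sq hσ u) (integrable_sq_fn u)
    fun y => mul_le_of_le_one_left (sq_nonneg _) (η.amp_sq_mul_jac_le_one hσ y)

/-- Transport loses little mass when the profile has slope close to one on a large ball. -/
theorem norm_sq_fst_sub_transport_le (hσ : 0 ≤ σ) {ρ κ : ℝ}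
    (h : ∀ r, |r| ≤ ρ → κ ≤ η.slope r) (hκ : κ ≤ 1) (u : H1 N) :
    ‖u.1.fst‖ ^ 2 - ‖(η.transport hσ u).1.fst‖ ^ 2 ≤
      σ * (N * ((1 - κ) * ‖u.1.fst‖ ^ 2 +
        ∫ y in (Metric.closedBall (0 : Space N) ρ)ᶜ, fn u y ^ 2)) := by
  rw [norm_sq_fst_transport, norm_sq_fst, ← integral_sub (integrable_sq_fn u)
    (η.integrable_amp_jac_sq hσ u), ← integral_indicator measurableSet_closedBall.compl,
    ← integral_const_mul (1 - κ), ← integral_add ((integrable_sq_fn u).const_mul _)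
      ((integrable_sq_fn u).indicator measurableSet_closedBall.compl), ← integral_const_mul,
    ← integral_const_mul]
  refine integral_mono ((integrable_sq_fn u).sub (η.integrable_amp_jac_sq hσ u))
    ((((integrable_sq_fn u).const_mul _).add ((integrable_sq_fn u).indicator
      measurableSet_closedBall.compl)).const_mul _ |>.const_mul _) fun y => ?_
  simp only
  have h1 := η.one_sub_amp_sq_mul_jac_le hσ y
  have h2 : ∑ i, (1 - η.slope (y i)) ≤
      N * ((1 - κ) + (Metric.closedBall (0 : Space N) ρ)ᶜ.indicator (fun _ => (1 : ℝ)) y) := by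
    have : ∀ i ∈ Finset.univ, 1 - η.slope (y i) ≤
        (1 - κ) + (Metric.closedBall (0 : Space N) ρ)ᶜ.indicator (fun _ => (1 : ℝ)) y := by
      intro i _
      by_cases hy : y ∈ Metric.closedBall (0 : Space N) ρ
      · rw [indicator_of_notMem (by simpa using hy)]
        have := h (y i) (abs_apply_le (mem_closedBall_zero_iff.1 hy) i)
        linarith
      · rw [indicator_of_mem hy]
        have := η.slope_nonneg (y i)
        linarith
    refine (Finset.sum_le_sum this).trans_eq ?_
    rw [Finset.sum_const, Finset.card_univ, Fintype.card_fin, nsmul_eq_mul]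
  have h3 : (Metric.closedBall (0 : Space N) ρ)ᶜ.indicator (fun y => fn u y ^ 2) y
      = (Metric.closedBall (0 : Space N) ρ)ᶜ.indicator (fun _ => (1 : ℝ)) y * fn u y ^ 2 := by
    by_cases hy : y ∈ (Metric.closedBall (0 : Space N) ρ)ᶜ
    · rw [indicator_of_mem hy, indicator_of_mem hy, one_mul]
    · rw [indicator_of_notMem hy, indicator_of_notMem hy, zero_mul]
  rw [h3]
  have h4 := h1.trans (mul_le_mul_of_nonneg_left h2 hσ)
  have h5 := mul_le_mul_of_nonneg_right h4 (sq_nonneg (fn u y))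
  linarith

/-- Transport decreases the Dirichlet energy at a rate proportional to `σ`. -/
theorem norm_sq_snd_transport_le (hσ : 0 ≤ σ) (hσ1 : σ ≤ 1) {ρ κ : ℝ}
    (h : ∀ r, |r| ≤ ρ → κ ≤ η.slope r) (hκ : 1 / 2 ≤ κ) (u : H1 N) :
    ‖(η.transport hσ u).1.snd‖ ^ 2 ≤ ‖u.1.snd‖ ^ 2 -
      σ / 4 * ∫ y in Metric.closedBall (0 : Space N) ρ, ‖grad u y‖ ^ 2 := by
  rw [← integral_norm_sq_grad, ← integral_norm_sq_grad]
  have e1 : ∫ x, ‖grad (η.transport hσ u) x‖ ^ 2 = ∫ x, ‖amp N σ •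
      η.squeeze σ ((η.stretch hσ).symm x) (grad u ((η.stretch hσ).symm x))‖ ^ 2 := by
    refine integral_congr_ae ?_
    filter_upwards [η.grad_transport hσ u] with x hx
    rw [hx]
  have hi := integrable_norm_sq_grad u
  have hi2 := hi.indicator (measurableSet_closedBall (x := (0 : Space N)) (ε := ρ))
  rw [e1, η.integral_comp_stretch_symm hσ (fun y => ‖amp N σ • η.squeeze σ y (grad u y)‖ ^ 2),
    ← integral_indicator measurableSet_closedBall, ← integral_const_mul,
    ← integral_sub hi (hi2.const_mul _)]
  refine integral_mono_of_nonneg (ae_of_all _ fun y => ?_) (hi.sub (hi2.const_mul _))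
    (ae_of_all _ fun y => ?_)
  · have := η.jac_pos hσ y
    simp only [Pi.zero_apply]
    positivity
  simp only
  rw [norm_smul, mul_pow, Real.norm_eq_abs, sq_abs, ← mul_assoc, mul_comm (η.jac σ y)]
  have h0 := mul_le_of_le_one_left (sq_nonneg ‖η.squeeze σ y (grad u y)‖)
    (η.amp_sq_mul_jac_le_one hσ y)
  refine h0.trans ?_
  by_cases hy : y ∈ Metric.closedBall (0 : Space N) ρ
  · rw [indicator_of_mem hy]
    have h1 := η.mul_norm_sq_squeeze_le (σ := σ) (k := 1 - σ / 4) (y := y) (grad u y)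
      (fun i => by
        have h2 := h (y i) (abs_apply_le (mem_closedBall_zero_iff.1 hy) i)
        have h3 : 1 + σ / 2 ≤ η.factor σ (y i) := by
          unfold factor
          nlinarith
        have h4 : (1 + σ / 2) ^ 2 ≤ η.factor σ (y i) ^ 2 :=
          pow_le_pow_left₀ (by linarith) h3 2
        have h5 : (1 - σ / 4) * (1 + σ / 2) ^ 2 ≤ (1 - σ / 4) * η.factor σ (y i) ^ 2 :=
          mul_le_mul_of_nonneg_left h4 (by linarith)
        nlinarith [mul_nonneg hσ (sub_nonneg.2 hσ1)]) hσ
    linarith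
  · rw [indicator_of_notMem hy]
    have := pow_le_pow_left₀ (norm_nonneg _) (η.norm_squeeze_le hσ y (grad u y)) 2
    linarith

end Profile

/-! ### The nonlocal term under transport -/

theorem mul_norm_le_norm_of_coord {k : ℝ} (hk : 0 ≤ k) {a b : Space N}
    (h : ∀ i, k * |a i| ≤ |b i|) : k * ‖a‖ ≤ ‖b‖ := by
  refine le_of_sq_le_sq ?_ (norm_nonneg _)
  rw [mul_pow, EuclideanSpace.norm_sq_eq, EuclideanSpace.norm_sq_eq, Finset.mul_sum]
  refine Finset.sum_le_sum fun i _ => ?_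
  rw [← mul_pow]
  exact pow_le_pow_left₀ (by positivity) (h i) 2

theorem one_add_pow_le {σ : ℝ} (hσ : 0 ≤ σ) (hσ1 : σ ≤ 1) (n : ℕ) :
    (1 + σ) ^ n ≤ 1 + (2 ^ n - 1) * σ := by
  induction n with
  | zero => simp
  | succ n ih =>
    have h1 : (1 : ℝ) ≤ 2 ^ n := one_le_pow₀ (by norm_num)
    rw [pow_succ, pow_succ]
    have h2 := mul_le_mul_of_nonneg_right ih (show 0 ≤ 1 + σ by linarith)
    have h3 : 0 ≤ (2 ^ n - 1) * σ * (1 - σ) :=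
      mul_nonneg (mul_nonneg (by linarith) hσ) (by linarith)
    nlinarith

/-- Bernoulli's inequality with exponent `e / β ≤ 1`. -/
theorem one_add_rpow_le_one_add_mul_rpow {σ e β κ : ℝ} (hσ : 0 ≤ σ) (hβ : 0 < β) (he : e ≤ β)
    (hκ : 0 ≤ κ) (h : e / β ≤ κ) : (1 + σ) ^ e ≤ (1 + σ * κ) ^ β := by
  have hσκ := mul_nonneg hσ hκ
  rcases le_total e 0 with he0 | he0
  · exact (Real.rpow_le_one_of_one_le_of_nonpos (by linarith) he0).trans
      (Real.one_le_rpow (by linarith) hβ.le)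
  · have h1 := rpow_one_add_le_one_add_mul_self (s := σ) (by linarith) (p := e / β)
      (by positivity) (div_le_one_of_le₀ he hβ.le)
    have h2 : (1 + σ) ^ (e / β) ≤ 1 + σ * κ := by
      have := mul_le_mul_of_nonneg_right h hσ
      linarith
    have h3 := Real.rpow_le_rpow (by positivity) h2 hβ.le
    rwa [← Real.rpow_mul (by linarith), div_mul_cancel₀ _ hβ.ne'] at h3

theorem rieszKernel_le_of_mul_norm_le {α : ℝ} (hα : 0 < α) (hαN : α < N) {k : ℝ} (hk : 1 ≤ k)
    {x y : Space N} (h : k * ‖x‖ ≤ ‖y‖) (hx : x ≠ 0) :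
    k ^ ((N : ℝ) - α) * rieszKernel α y ≤ rieszKernel α x := by
  have hβ : 0 < (N : ℝ) - α := by linarith
  have hx0 : 0 < ‖x‖ := norm_pos_iff.2 hx
  have hy0 : 0 < ‖y‖ := lt_of_lt_of_le (by positivity) h
  rw [rieszKernel_eq, rieszKernel_eq, mul_left_comm]
  refine mul_le_mul_of_nonneg_left ?_ (rieszConst_pos hα hαN).le
  rw [Real.rpow_neg hy0.le, Real.rpow_neg hx0.le, ← div_eq_mul_inv,
    div_le_iff₀ (by positivity), ← div_eq_inv_mul, le_div_iff₀ (by positivity),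
    ← Real.mul_rpow (by linarith) hx0.le]
  exact Real.rpow_le_rpow (by positivity) h hβ.le

namespace Profile

variable (η : Profile) {σ : ℝ}

theorem mul_norm_sub_le_norm_stretch_sub (hσ : 0 ≤ σ) {ρ κ : ℝ} (hκ : 0 ≤ κ)
    (h : ∀ r, |r| ≤ ρ → κ ≤ η.slope r) {x y : Space N} (hx : ‖x‖ ≤ ρ) (hy : ‖y‖ ≤ ρ) :
    (1 + σ * κ) * ‖x - y‖ ≤ ‖η.stretch hσ x - η.stretch hσ y‖ :=
  mul_norm_le_norm_of_coord (by positivity) fun i =>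
    η.mul_abs_sub_le hσ h (abs_apply_le hy i) (abs_apply_le hx i)

theorem norm_sub_le_norm_stretch_sub (hσ : 0 ≤ σ) (x y : Space N) :
    ‖x - y‖ ≤ ‖η.stretch hσ x - η.stretch hσ y‖ := by
  have := mul_norm_le_norm_of_coord (k := 1) zero_le_one (a := x - y)
    (b := η.stretch hσ x - η.stretch hσ y) fun i => by
      rw [one_mul]; exact η.abs_sub_le hσ (y i) (x i)
  rwa [one_mul] at this

theorem rieszKernel_stretch_le {α : ℝ} (hα : 0 < α) (hαN : α < N) (hσ : 0 ≤ σ) {k : ℝ}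
    (hk : 1 ≤ k) {x y : Space N} (h : k * ‖x - y‖ ≤ ‖η.stretch hσ x - η.stretch hσ y‖) :
    k ^ ((N : ℝ) - α) * rieszKernel α (η.stretch hσ x - η.stretch hσ y)
      ≤ rieszKernel α (x - y) := by
  rcases eq_or_ne x y with rfl | hxy
  · have hβ : (N : ℝ) - α ≠ 0 := by linarith
    simp [rieszKernel, Real.zero_rpow hβ]
  · exact rieszKernel_le_of_mul_norm_le hα hαN hk h (sub_ne_zero.2 hxy)

theorem amp_rpow_sq_mul_jac_mul_jac_le (hσ : 0 ≤ σ) (p : ℝ) (x y : Space N) :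
    (amp N σ ^ p) ^ 2 * (η.jac σ x * η.jac σ y) ≤ (1 + σ) ^ (2 * (N : ℝ) - N * p) := by
  have h1 : η.jac σ x * η.jac σ y ≤ (1 + σ) ^ N * (1 + σ) ^ N :=
    mul_le_mul (η.jac_le hσ x) (η.jac_le hσ y) (η.jac_pos hσ y).le (by positivity)
  refine (mul_le_mul_of_nonneg_left h1 (sq_nonneg _)).trans_eq ?_
  have h0 : 0 < 1 + σ := by linarith
  unfold amp
  rw [← Real.rpow_mul h0.le, ← Real.rpow_natCast, ← Real.rpow_mul h0.le, ← Real.rpow_natCast,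
    ← Real.rpow_add h0, ← Real.rpow_add h0]
  congr 1
  push_cast; ring

/-- The interaction kernel seen through the stretching map is at most the original one for pairs
of points in a large ball, and exceeds it by a factor at most `1 + O(σ)` otherwise. -/
theorem kernel_transport_le {α p : ℝ} (hp : HartreeExponents N α p) (hσ : 0 ≤ σ) (hσ1 : σ ≤ 1)
    {ρ κ : ℝ} (h : ∀ r, |r| ≤ ρ → κ ≤ η.slope r) (hκ : 0 ≤ κ)
    (hκp : (2 * (N : ℝ) - N * p) / (N - α) ≤ κ) (x y : Space N) :
    (amp N σ ^ p) ^ 2 * (η.jac σ x * η.jac σ y) *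
        rieszKernel α (η.stretch hσ x - η.stretch hσ y) ≤
      (1 + 2 ^ N * σ *
        (Metric.closedBall (0 : Space N) ρ ×ˢ Metric.closedBall (0 : Space N) ρ)ᶜ.indicator
          (fun _ => (1 : ℝ)) (x, y)) * rieszKernel α (x - y) := by
  have hα := hp.pos
  have hαN := hp.lt_dim
  have hN : (0 : ℝ) < N := by linarith
  have hK := rieszKernel_nonneg hα hαN (η.stretch hσ x - η.stretch hσ y)
  have h1 := mul_le_mul_of_nonneg_right (η.amp_rpow_sq_mul_jac_mul_jac_le hσ p x y) hK
  refine h1.trans ?_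
  by_cases hz : (x, y) ∈ Metric.closedBall (0 : Space N) ρ ×ˢ Metric.closedBall (0 : Space N) ρ
  · rw [indicator_of_notMem (by simpa using hz), mul_zero, add_zero, one_mul]
    have hx := mem_closedBall_zero_iff.1 hz.1
    have hy := mem_closedBall_zero_iff.1 hz.2
    -- the expansion of distances outweighs the amplitude, by the lower bound on `p`
    have he : 2 * (N : ℝ) - N * p ≤ N - α := by
      have := (div_lt_iff₀ hN).1 hp.lower
      linarith
    have h2 := one_add_rpow_le_one_add_mul_rpow hσ (by linarith : (0 : ℝ) < N - α) he hκ hκp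
    refine (mul_le_mul_of_nonneg_right h2 hK).trans ?_
    have := mul_nonneg hσ hκ
    exact η.rieszKernel_stretch_le hα hαN hσ (by linarith)
      (η.mul_norm_sub_le_norm_stretch_sub hσ hκ h hx hy)
  · rw [indicator_of_mem hz, mul_one]
    have h2 : (1 + σ) ^ (2 * (N : ℝ) - N * p) ≤ 1 + 2 ^ N * σ := by
      have h3 : (1 + σ) ^ (2 * (N : ℝ) - N * p) ≤ (1 + σ) ^ (N : ℝ) := by
        refine Real.rpow_le_rpow_of_exponent_le (by linarith) ?_
        nlinarith [hp.one_lt]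
      rw [Real.rpow_natCast] at h3
      have := one_add_pow_le hσ hσ1 N
      linarith
    have h4 := η.rieszKernel_stretch_le hα hαN hσ le_rfl (x := x) (y := y)
      (by rw [one_mul]; exact η.norm_sub_le_norm_stretch_sub hσ x y)
    rw [Real.one_rpow, one_mul] at h4
    exact mul_le_mul h2 h4 hK (by positivity)

theorem powMul_transport (hσ : 0 ≤ σ) {p : ℝ} (hp : 1 < p) (u : H1 N) :
    powMul p (η.transport hσ u) (η.transport hσ u) =ᵐ[volume]
      fun x => amp N σ ^ p * powMul p u u ((η.stretch hσ).symm x) := by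
  rw [powMul_self hp, powMul_self hp]
  filter_upwards [η.fn_transport hσ u] with x hx
  rw [hx, abs_mul, abs_of_pos (amp_pos hσ), Real.mul_rpow (amp_pos hσ).le (abs_nonneg _)]

/-- Transport increases the nonlocal energy by `O(σ)` times the interaction involving points
outside a large ball. -/
theorem rieszForm_transport_le {α p : ℝ} (hp : HartreeExponents N α p) (hσ : 0 ≤ σ) (hσ1 : σ ≤ 1)
    {ρ κ : ℝ} (h : ∀ r, |r| ≤ ρ → κ ≤ η.slope r) (hκ : 0 ≤ κ)
    (hκp : (2 * (N : ℝ) - N * p) / (N - α) ≤ κ) (u : H1 N) :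
    rieszForm α (powMul p (η.transport hσ u) (η.transport hσ u))
        (powMul p (η.transport hσ u) (η.transport hσ u)) ≤
      rieszForm α (powMul p u u) (powMul p u u) + 2 ^ N * σ *
        ∫ z in (Metric.closedBall (0 : Space N) ρ ×ˢ Metric.closedBall (0 : Space N) ρ)ᶜ,
          rieszKernel α (z.1 - z.2) * (powMul p u u z.1 * powMul p u u z.2) := by
  have hN := hp.one_le
  have hα := hp.pos
  have hαN := hp.lt_dim
  set f := powMul p u u with hf
  have hf0 : ∀ x, 0 ≤ f x := powMul_nonneg p u u
  set A := amp N σ ^ p with hA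
  have hA0 : 0 ≤ A := Real.rpow_nonneg (amp_pos hσ).le _
  set F : Space N → ℝ := fun x => A * f ((η.stretch hσ).symm x) with hF
  have hae := η.powMul_transport hσ hp.one_lt u
  have hFm : AEStronglyMeasurable F volume :=
    ((hp.finiteEnergy u u).1.comp_quasiMeasurePreserving
      (η.quasiMeasurePreserving_stretch_symm hσ)).const_mul A
  have hFE : FiniteEnergy α F := (hp.finiteEnergy (η.transport hσ u) (η.transport hσ u)).mono hFm
    (by filter_upwards [hae] with x hx; rw [hx])
  have hW : Integrable (fun z : Space N × Space N => rieszKernel α (z.1 - z.2) * (f z.1 * f z.2)) :=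
    (hp.finiteEnergy u u).integrable hN hα hαN (hp.finiteEnergy u u)
  have hbad : MeasurableSet
      (Metric.closedBall (0 : Space N) ρ ×ˢ Metric.closedBall (0 : Space N) ρ)ᶜ :=
    (measurableSet_closedBall.prod measurableSet_closedBall).compl
  set V : Space N × Space N → ℝ := fun z => A ^ 2 * (η.jac σ z.1 * η.jac σ z.2) *
        rieszKernel α (η.stretch hσ z.1 - η.stretch hσ z.2) * (f z.1 * f z.2) with hV
  set W : Space N × Space N → ℝ :=
    fun z => rieszKernel α (z.1 - z.2) * (f z.1 * f z.2) with hWd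
  have hV0 : ∀ z, 0 ≤ V z := fun z => by
    have h1 := rieszKernel_nonneg hα hαN (η.stretch hσ z.1 - η.stretch hσ z.2)
    have h2 := η.jac_pos hσ z.1
    have h3 := η.jac_pos hσ z.2
    have h4 := hf0 z.1
    have h5 := hf0 z.2
    simp only [hV]
    positivity
  have hR : Integrable (fun z => W z + 2 ^ N * σ *
      (Metric.closedBall (0 : Space N) ρ ×ˢ Metric.closedBall (0 : Space N) ρ)ᶜ.indicator W z) :=
    hW.add ((hW.indicator hbad).const_mul _)
  have hle : ∀ z, V z ≤ W z + 2 ^ N * σ *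
      (Metric.closedBall (0 : Space N) ρ ×ˢ Metric.closedBall (0 : Space N) ρ)ᶜ.indicator W z := by
    intro z
    have h1 := mul_le_mul_of_nonneg_right
      (η.kernel_transport_le hp hσ hσ1 h hκ hκp z.1 z.2) (mul_nonneg (hf0 z.1) (hf0 z.2))
    refine h1.trans_eq ?_
    by_cases hz : z ∈ (Metric.closedBall (0 : Space N) ρ ×ˢ Metric.closedBall (0 : Space N) ρ)ᶜ
    · rw [indicator_of_mem hz, indicator_of_mem hz]; simp only [hWd]; ring
    · rw [indicator_of_notMem hz, indicator_of_notMem hz]; simp only [hWd]; ring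
  have hVm : AEStronglyMeasurable V volume := by
    have c1 : Continuous fun z : Space N × Space N => η.jac σ z.1 * η.jac σ z.2 :=
      (η.continuous_jac.comp continuous_fst).mul (η.continuous_jac.comp continuous_snd)
    have c2 : Measurable fun z : Space N × Space N =>
        rieszKernel α (η.stretch hσ z.1 - η.stretch hσ z.2) :=
      (measurable_rieszKernel α).comp
        (((η.stretch hσ).continuous.comp continuous_fst).sub
          ((η.stretch hσ).continuous.comp continuous_snd)).measurable
    exact ((continuous_const.mul c1).aestronglyMeasurable.mul c2.aestronglyMeasurable).mul
      ((hp.finiteEnergy u u).1.comp_fst.mul (hp.finiteEnergy u u).1.comp_snd)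
  have hVi : Integrable V := hR.mono' hVm (ae_of_all _ fun z => by
    rw [Real.norm_eq_abs, abs_of_nonneg (hV0 z)]; exact hle z)
  have e1 : rieszForm α (powMul p (η.transport hσ u) (η.transport hσ u))
        (powMul p (η.transport hσ u) (η.transport hσ u)) = ∫ z, V z := by
    rw [rieszForm_congr hae hae]
    change rieszForm α F F = _
    rw [rieszForm_eq_integral hN hα hαN hFE hFE, Measure.volume_eq_prod,
      integral_prod V hVi]
    have s1 : ∀ x, ∫ y, rieszKernel α (x - y) * F y
        = ∫ y, η.jac σ y * (rieszKernel α (x - η.stretch hσ y) * (A * f y)) := fun x => by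
      rw [← η.integral_comp_stretch_symm hσ
        (fun y => rieszKernel α (x - η.stretch hσ y) * (A * f y))]
      simp only [Homeomorph.apply_symm_apply, hF]
    simp only [s1]
    have s2 := η.integral_comp_stretch_symm hσ (fun x =>
      (∫ y, η.jac σ y * (rieszKernel α (η.stretch hσ x - η.stretch hσ y) * (A * f y))) * (A * f x))
    simp only [Homeomorph.apply_symm_apply] at s2
    refine s2.trans (integral_congr_ae (ae_of_all _ fun x => ?_))
    simp only
    rw [← integral_mul_const, ← integral_const_mul]
    refine integral_congr_ae (ae_of_all _ fun y => ?_)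
    simp only [hV]; ring
  rw [e1, ← integral_indicator hbad, ← integral_const_mul]
  change _ ≤ (∫ z, W z) + _
  rw [← integral_add hW ((hW.indicator hbad).const_mul _)]
  exact integral_mono hVi hR hle

end Profile

/-! ### Transport is close to the identity in `L²` -/

namespace Profile

variable (η : Profile) {σ : ℝ}

/-- The displacement field `y ↦ (η(y_i))_i`. -/
def field (y : Space N) : Space N := WithLp.toLp 2 fun i => η.disp (y i)

theorem stretch_eq (hσ : 0 ≤ σ) (y : Space N) : η.stretch hσ y = y + σ • η.field y := by
  ext i
  rw [stretch_apply]
  simp [field]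

theorem continuous_field : Continuous (η.field : Space N → Space N) :=
  (PiLp.continuous_toLp 2 _).comp (continuous_pi fun i =>
    η.differentiable_disp.continuous.comp (by fun_prop))

theorem norm_field_le (y : Space N) : ‖η.field y‖ ≤ N * η.bound := by
  have h1 : ‖η.field y‖ ≤ ∑ i, ‖η.field y i‖ := by
    refine le_of_sq_le_sq ?_ (Finset.sum_nonneg fun i _ => norm_nonneg _)
    rw [EuclideanSpace.norm_sq_eq]
    exact Finset.sum_sq_le_sq_sum_of_nonneg fun i _ => norm_nonneg _
  refine h1.trans ((Finset.sum_le_sum fun i _ => η.abs_disp_le (y i)).trans_eq ?_)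
  simp

theorem lintegral_comp_stretch_le (hσ : 0 ≤ σ) (g : Space N → ℝ≥0∞) :
    ∫⁻ y, g (η.stretch hσ y) ≤ ∫⁻ x, g x := by
  have h := η.lintegral_comp_stretch_symm hσ (fun y => g (η.stretch hσ y))
  simp only [Homeomorph.apply_symm_apply] at h
  rw [h]
  refine lintegral_mono fun y => ?_
  refine le_mul_of_one_le_left' ?_
  rw [← ENNReal.ofReal_one]
  exact ENNReal.ofReal_le_ofReal (η.one_le_jac hσ y)

theorem enorm_test_add_smul_field_sub_sq_le (hσ : 0 ≤ σ) {φ : Space N → ℝ} (hφ : IsTest φ)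
    (y : Space N) :
    ‖φ (y + σ • η.field y) - φ y‖ₑ ^ 2 ≤ ENNReal.ofReal ((σ * (N * η.bound)) ^ 2) *
      ∫⁻ θ in Icc (0 : ℝ) 1, ‖gradient φ (y + (θ * σ) • η.field y)‖ₑ ^ 2 := by
  have hd : ∀ θ : ℝ, HasDerivAt (fun θ : ℝ => φ (y + (θ * σ) • η.field y))
      (fderiv ℝ φ (y + (θ * σ) • η.field y) (σ • η.field y)) θ := by
    intro θ
    refine (hφ.differentiable _).hasFDerivAt.comp_hasDerivAt θ ?_
    have h1 : HasDerivAt (fun θ : ℝ => (θ * σ) • η.field y) ((1 * σ) • η.field y) θ :=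
      ((hasDerivAt_id θ).mul_const σ).smul_const _
    rw [one_mul] at h1
    exact h1.const_add y
  have hc : Continuous fun θ : ℝ => y + (θ * σ) • η.field y := by fun_prop
  have hcont : Continuous fun θ : ℝ => fderiv ℝ φ (y + (θ * σ) • η.field y) (σ • η.field y) :=
    ((hφ.1.continuous_fderiv (by simp)).comp hc).clm_apply continuous_const
  have hftc := intervalIntegral.integral_eq_sub_of_hasDerivAt (a := 0) (b := 1)
    (fun θ _ => hd θ) (hcont.intervalIntegrable 0 1)
  simp only [one_mul, zero_mul, zero_smul, add_zero] at hftc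
  rw [← hftc, intervalIntegral.integral_of_le zero_le_one, ← integral_Icc_eq_integral_Ioc]
  have hpt : ∀ θ : ℝ, ‖fderiv ℝ φ (y + (θ * σ) • η.field y) (σ • η.field y)‖ₑ ≤
      ENNReal.ofReal (σ * (N * η.bound)) * ‖gradient φ (y + (θ * σ) • η.field y)‖ₑ := by
    intro θ
    rw [← inner_gradient, ← ofReal_norm, ← ofReal_norm, ← ENNReal.ofReal_mul
      (mul_nonneg hσ (mul_nonneg (Nat.cast_nonneg N) η.bound_nonneg))]
    refine ENNReal.ofReal_le_ofReal ((norm_inner_le_norm _ _).trans ?_)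
    rw [norm_smul, Real.norm_eq_abs, abs_of_nonneg hσ, mul_comm]
    exact mul_le_mul_of_nonneg_right (mul_le_mul_of_nonneg_left (η.norm_field_le y) hσ)
      (norm_nonneg _)
  have hg : Measurable fun θ : ℝ => ‖gradient φ (y + (θ * σ) • η.field y)‖ₑ :=
    (hφ.continuous_gradient.comp hc).enorm.measurable
  have hcs := sq_lintegral_mul_le (μ := volume.restrict (Icc (0 : ℝ) 1)) (w := fun _ => 1)
    aemeasurable_const hg.aemeasurable (by simp)
  simp only [one_mul] at hcs
  calc _ ≤ (∫⁻ θ in Icc (0 : ℝ) 1,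
        ‖fderiv ℝ φ (y + (θ * σ) • η.field y) (σ • η.field y)‖ₑ) ^ 2 := by
        gcongr; exact enorm_integral_le_lintegral_enorm _
    _ ≤ (∫⁻ θ in Icc (0 : ℝ) 1, ENNReal.ofReal (σ * (N * η.bound)) *
          ‖gradient φ (y + (θ * σ) • η.field y)‖ₑ) ^ 2 := by
        gcongr with θ; exact hpt θ
    _ = ENNReal.ofReal (σ * (N * η.bound)) ^ 2 *
          (∫⁻ θ in Icc (0 : ℝ) 1, ‖gradient φ (y + (θ * σ) • η.field y)‖ₑ) ^ 2 := by
        rw [lintegral_const_mul' _ _ ENNReal.ofReal_ne_top, mul_pow]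
    _ ≤ _ := by
        rw [ENNReal.ofReal_pow (mul_nonneg hσ (mul_nonneg (Nat.cast_nonneg N) η.bound_nonneg))]
        gcongr

/-- Composition with the stretching map displaces a test function by `O(σ)` in `L²`. -/
theorem lintegral_enorm_test_comp_stretch_sub_sq_le (hσ : 0 ≤ σ) {φ : Space N → ℝ}
    (hφ : IsTest φ) :
    ∫⁻ y, ‖φ (η.stretch hσ y) - φ y‖ₑ ^ 2 ≤
      ENNReal.ofReal ((σ * (N * η.bound)) ^ 2) * ∫⁻ y, ‖gradient φ y‖ₑ ^ 2 := by
  have hm : Measurable fun z : Space N × ℝ =>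
      ‖gradient φ (z.1 + (z.2 * σ) • η.field z.1)‖ₑ ^ 2 := by
    have : Continuous fun z : Space N × ℝ => z.1 + (z.2 * σ) • η.field z.1 :=
      continuous_fst.add ((continuous_snd.mul continuous_const).smul
        (η.continuous_field.comp continuous_fst))
    exact (hφ.continuous_gradient.comp this).enorm.measurable.pow_const 2
  calc _ ≤ ∫⁻ y, ENNReal.ofReal ((σ * (N * η.bound)) ^ 2) *
        ∫⁻ θ in Icc (0 : ℝ) 1, ‖gradient φ (y + (θ * σ) • η.field y)‖ₑ ^ 2 := by
        refine lintegral_mono fun y => ?_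
        rw [stretch_eq]
        exact η.enorm_test_add_smul_field_sub_sq_le hσ hφ y
    _ = ENNReal.ofReal ((σ * (N * η.bound)) ^ 2) *
        ∫⁻ θ in Icc (0 : ℝ) 1, ∫⁻ y, ‖gradient φ (y + (θ * σ) • η.field y)‖ₑ ^ 2 := by
        rw [lintegral_const_mul' _ _ ENNReal.ofReal_ne_top,
          lintegral_lintegral_swap hm.aemeasurable]
    _ ≤ ENNReal.ofReal ((σ * (N * η.bound)) ^ 2) *
        ∫⁻ _ in Icc (0 : ℝ) 1, ∫⁻ y, ‖gradient φ y‖ₑ ^ 2 := by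
        refine mul_le_mul' le_rfl (setLIntegral_mono measurable_const fun θ hθ => ?_)
        have := η.lintegral_comp_stretch_le (mul_nonneg hθ.1 hσ) (fun x => ‖gradient φ x‖ₑ ^ 2)
        simpa only [stretch_eq] using this
    _ = _ := by simp

/-- The constant in the displacement estimate for `transport`. -/
def moveConst (N : ℕ) : ℝ := 2 ^ N * (N * η.bound) + N

theorem moveConst_nonneg : 0 ≤ η.moveConst N := by
  have := η.bound_nonneg
  unfold moveConst; positivity

theorem norm_fst_transport_test_sub_le (hσ : 0 ≤ σ) (hσ1 : σ ≤ 1) {φ : Space N → ℝ}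
    (hφ : IsTest φ) :
    ‖(η.transport hσ (testH1 φ hφ) - testH1 φ hφ).1.fst‖ ≤ η.moveConst N * σ * ‖testH1 φ hφ‖ := by
  have hb := η.bound_nonneg
  have hS : MemLp (fun x => φ ((η.stretch hσ).symm x)) 2 (volume : Measure (Space N)) :=
    η.memLp_comp_stretch_symm hσ hφ.memLp
  have e1 : eLpNorm (fun x => φ ((η.stretch hσ).symm x) - φ x) 2 (volume : Measure (Space N)) ≤
      ENNReal.ofReal (2 ^ N * (σ * (N * η.bound))) *
        ENNReal.ofReal ‖(testH1 φ hφ).1.snd‖ := by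
    rw [← ENNReal.pow_le_pow_left_iff two_ne_zero, eLpNorm_two_sq, mul_pow, ← eLpNorm_grad,
      eLpNorm_congr_ae (grad_testH1 hφ), eLpNorm_two_sq]
    have h1 := η.lintegral_comp_stretch_symm hσ (fun y => ‖φ y - φ (η.stretch hσ y)‖ₑ ^ 2)
    simp only [Homeomorph.apply_symm_apply] at h1
    rw [h1]
    have h2 : ∀ y : Space N, ENNReal.ofReal (η.jac σ y) ≤ ENNReal.ofReal ((2 ^ N) ^ 2) := by
      intro y
      refine ENNReal.ofReal_le_ofReal ((η.jac_le hσ y).trans ?_)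
      have h3 : (1 + σ) ^ N ≤ 2 ^ N := pow_le_pow_left₀ (by linarith) (by linarith) N
      have h4 : (1 : ℝ) ≤ 2 ^ N := one_le_pow₀ (by norm_num)
      nlinarith
    refine (lintegral_mono fun y => mul_le_mul' (h2 y) le_rfl).trans ?_
    rw [lintegral_const_mul' _ _ ENNReal.ofReal_ne_top]
    have h3 := η.lintegral_enorm_test_comp_stretch_sub_sq_le hσ hφ
    simp only [enorm_sub_rev (φ _) (φ (η.stretch hσ _))]
    refine (mul_le_mul' le_rfl h3).trans_eq ?_
    rw [← ENNReal.ofReal_pow (by positivity), mul_pow (2 ^ N : ℝ) (σ * (N * η.bound)) 2,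
      ENNReal.ofReal_mul (by positivity), mul_assoc]
  rw [← ENNReal.ofReal_le_ofReal_iff (mul_nonneg (mul_nonneg η.moveConst_nonneg hσ)
    (norm_nonneg _)), ← eLpNorm_fn]
  have e2 : fn (η.transport hσ (testH1 φ hφ) - testH1 φ hφ) =ᵐ[volume]
      (amp N σ • fun x => φ ((η.stretch hσ).symm x) - φ x) + (amp N σ - 1) • φ := by
    filter_upwards [fn_sub (η.transport hσ (testH1 φ hφ)) (testH1 φ hφ),
      η.fn_transport hσ (testH1 φ hφ), fn_testH1 hφ,
      (η.quasiMeasurePreserving_stretch_symm hσ).ae (fn_testH1 hφ)] with x h1 h2 h3 h4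
    rw [h1, h2, h3, h4]
    simp only [Pi.add_apply, Pi.smul_apply, smul_eq_mul]
    ring
  rw [eLpNorm_congr_ae e2]
  refine (eLpNorm_add_le ((hS.sub hφ.memLp).1.const_smul _) (hφ.memLp.1.const_smul _)
    (by norm_num)).trans ?_
  rw [eLpNorm_const_smul, eLpNorm_const_smul]
  have e3 : eLpNorm φ 2 (volume : Measure (Space N)) = ENNReal.ofReal ‖(testH1 φ hφ).1.fst‖ := by
    rw [← eLpNorm_fn]; exact (eLpNorm_congr_ae (fn_testH1 hφ)).symm
  have a1 : ‖amp N σ‖ₑ ≤ 1 := by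
    rw [Real.enorm_eq_ofReal (amp_pos hσ).le, ← ENNReal.ofReal_one]
    exact ENNReal.ofReal_le_ofReal (amp_le_one hσ)
  have a2 : ‖amp N σ - 1‖ₑ ≤ ENNReal.ofReal (N * σ) := by
    rw [← ofReal_norm]
    refine ENNReal.ofReal_le_ofReal ?_
    rw [Real.norm_eq_abs, abs_sub_comm, abs_of_nonneg (by linarith [amp_le_one (N := N) hσ])]
    exact one_sub_amp_le hσ
  rw [e3]
  refine (add_le_add (mul_le_mul' a1 e1) (mul_le_mul' a2 le_rfl)).trans ?_
  have n1 := norm_fst_le (testH1 φ hφ)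
  have n2 := norm_snd_le (testH1 φ hφ)
  have n3 := norm_nonneg (testH1 φ hφ).1.fst
  have n4 := norm_nonneg (testH1 φ hφ).1.snd
  generalize ‖(testH1 φ hφ).1.fst‖ = a at *
  generalize ‖(testH1 φ hφ).1.snd‖ = b at *
  generalize ‖testH1 φ hφ‖ = s at *
  rw [one_mul, ← ENNReal.ofReal_mul (by positivity), ← ENNReal.ofReal_mul (by positivity),
    ← ENNReal.ofReal_add (by positivity) (by positivity)]
  refine ENNReal.ofReal_le_ofReal ?_
  have m1 := mul_le_mul_of_nonneg_left n2 (show 0 ≤ 2 ^ N * (σ * (N * η.bound)) by positivity)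
  have m2 := mul_le_mul_of_nonneg_left n1 (show 0 ≤ N * σ by positivity)
  unfold moveConst
  linarith

theorem fst_transport_sub (hσ : 0 ≤ σ) (u w : H1 N) :
    (η.transport hσ (u - w)).1.fst = (η.transport hσ u).1.fst - (η.transport hσ w).1.fst := by
  rw [← fst_sub]
  refine Lp.ext ?_
  change fn (η.transport hσ (u - w)) =ᵐ[volume] fn (η.transport hσ u - η.transport hσ w)
  filter_upwards [fn_sub (η.transport hσ u) (η.transport hσ w), η.fn_transport hσ u,
    η.fn_transport hσ w, η.fn_transport hσ (u - w),
    (η.quasiMeasurePreserving_stretch_symm hσ).ae (fn_sub u w)] with x h1 h2 h3 h4 h5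
  rw [h1, h2, h3, h4, h5]
  ring

/-- Transport moves an element of `H¹` by `O(σ)` in `L²`. -/
theorem norm_fst_transport_sub_le (hσ : 0 ≤ σ) (hσ1 : σ ≤ 1) (u : H1 N) :
    ‖(η.transport hσ u).1.fst - u.1.fst‖ ≤ η.moveConst N * σ * ‖u‖ := by
  obtain ⟨φ, hφ, -⟩ := exists_seq_isTest_tendsto u
  have hfst : Tendsto (fun n => ‖(u - testH1 (φ n).1 (φ n).2).1.fst‖) atTop (𝓝 0) := by
    refine squeeze_zero (fun _ => norm_nonneg _) (fun n => norm_fst_le _) ?_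
    have h1 := (tendsto_const_nhds (x := u)).sub hφ
    rw [sub_self] at h1
    exact tendsto_zero_iff_norm_tendsto_zero.1 h1
  have hlim : Tendsto (fun n => 2 * ‖(u - testH1 (φ n).1 (φ n).2).1.fst‖ +
      η.moveConst N * σ * ‖testH1 (φ n).1 (φ n).2‖) atTop
      (𝓝 (2 * 0 + η.moveConst N * σ * ‖u‖)) :=
    (hfst.const_mul 2).add (hφ.norm.const_mul _)
  rw [mul_zero, zero_add] at hlim
  refine ge_of_tendsto' hlim fun n => ?_
  have h1 := η.norm_fst_transport_test_sub_le hσ hσ1 (φ n).2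
  have h2 := η.norm_fst_transport_le hσ (u - testH1 (φ n).1 (φ n).2)
  rw [fst_transport_sub] at h2
  rw [fst_sub] at h1 h2
  rw [fst_sub]
  have h3 : (η.transport hσ u).1.fst - u.1.fst =
      ((η.transport hσ u).1.fst - (η.transport hσ (testH1 (φ n).1 (φ n).2)).1.fst)
      + ((η.transport hσ (testH1 (φ n).1 (φ n).2)).1.fst - (testH1 (φ n).1 (φ n).2).1.fst)
      - (u.1.fst - (testH1 (φ n).1 (φ n).2).1.fst) := by abel
  rw [h3]
  have h4 := norm_sub_le
    (((η.transport hσ u).1.fst - (η.transport hσ (testH1 (φ n).1 (φ n).2)).1.fst)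
      + ((η.transport hσ (testH1 (φ n).1 (φ n).2)).1.fst - (testH1 (φ n).1 (φ n).2).1.fst))
    (u.1.fst - (testH1 (φ n).1 (φ n).2).1.fst)
  have h5 := norm_add_le
    ((η.transport hσ u).1.fst - (η.transport hσ (testH1 (φ n).1 (φ n).2)).1.fst)
    ((η.transport hσ (testH1 (φ n).1 (φ n).2)).1.fst - (testH1 (φ n).1 (φ n).2).1.fst)
  linarith

end Profile

/-! ### Constrained critical points vanish -/

/-- The profile `η(r) = R arctan (r / R)`. -/
def arctanProfile {R : ℝ} (hR : 0 < R) : Profile where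
  disp r := R * Real.arctan (r / R)
  slope r := 1 / (1 + (r / R) ^ 2)
  bound := R * (Real.pi / 2)
  hasDerivAt r := by
    have h := (((hasDerivAt_id r).div_const R).arctan).const_mul R
    refine h.congr_deriv ?_
    simp only [id]
    field_simp
  contDiff_slope := by
    refine contDiff_const.div (by fun_prop) fun r => ?_
    positivity
  slope_nonneg r := by positivity
  slope_le_one r := div_le_one_of_le₀ (by linarith [sq_nonneg (r / R)]) (by positivity)
  abs_disp_le r := by
    rw [abs_mul, abs_of_pos hR]
    refine mul_le_mul_of_nonneg_left (abs_le.2 ⟨?_, ?_⟩) hR.le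
    · exact (Real.neg_pi_div_two_lt_arctan _).le
    · exact (Real.arctan_lt_pi_div_two _).le

theorem exists_profile_le_slope {κ ρ : ℝ} (hκ : κ < 1) (hκ0 : 0 < κ) :
    ∃ η : Profile, ∀ r, |r| ≤ ρ → κ ≤ η.slope r := by
  have hd : 0 < κ⁻¹ - 1 := sub_pos.2 ((one_lt_inv₀ hκ0).2 hκ)
  set R := (|ρ| + 1) / Real.sqrt (κ⁻¹ - 1) with hRdef
  have hs : 0 < Real.sqrt (κ⁻¹ - 1) := Real.sqrt_pos.2 hd
  have hR : 0 < R := by positivity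
  refine ⟨arctanProfile hR, fun r hr => ?_⟩
  change κ ≤ 1 / (1 + (r / R) ^ 2)
  rw [le_div_iff₀ (by positivity), ← le_div_iff₀' hκ0, ← le_sub_iff_add_le', one_div]
  have h1 : |r / R| ≤ Real.sqrt (κ⁻¹ - 1) := by
    rw [abs_div, abs_of_pos hR, div_le_iff₀ hR, hRdef, mul_div_cancel₀ _ hs.ne']
    linarith [le_abs_self ρ]
  rw [← sq_abs]
  calc |r / R| ^ 2 ≤ Real.sqrt (κ⁻¹ - 1) ^ 2 := pow_le_pow_left₀ (abs_nonneg _) h1 2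
    _ = _ := Real.sq_sqrt hd.le

theorem le_of_forall_small {X Y Z s₀ : ℝ} (hs₀ : 0 < s₀)
    (h : ∀ s, 0 < s → s ≤ s₀ → X ≤ Y + Z * s) : X ≤ Y := by
  have hlim : Tendsto (fun s : ℝ => Y + Z * s) (𝓝[>] 0) (𝓝 (Y + Z * 0)) :=
    ((by fun_prop : Continuous fun s : ℝ => Y + Z * s).tendsto 0).mono_left nhdsWithin_le_nhds
  rw [mul_zero, add_zero] at hlim
  refine ge_of_tendsto hlim ?_
  filter_upwards [Ioc_mem_nhdsGT hs₀] with s hs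
  exact h s hs.1 hs.2

theorem tendsto_setIntegral_compl_of_exhaustion {X : Type*} [MeasurableSpace X] {μ : Measure X}
    {f : X → ℝ} (hf : Integrable f μ) {s : ℕ → Set X} (hs : ∀ n, MeasurableSet (s n))
    (hmono : Monotone s) (hU : ⋃ n, s n = univ) :
    Tendsto (fun n => ∫ x in (s n)ᶜ, f x ∂μ) atTop (𝓝 0) := by
  have h := tendsto_setIntegral_of_antitone (μ := μ) (f := f) (fun n => (hs n).compl)
    (fun m n hmn => compl_subset_compl.2 (hmono hmn)) ⟨0, hf.integrableOn⟩
  rw [← compl_iUnion, hU, compl_univ] at h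
  simpa using h

theorem monotone_closedBall_natCast :
    Monotone fun n : ℕ => Metric.closedBall (0 : Space N) (n : ℝ) := fun m n hmn =>
  Metric.closedBall_subset_closedBall (by exact_mod_cast hmn)

theorem iUnion_closedBall_natCast :
    ⋃ n : ℕ, Metric.closedBall (0 : Space N) (n : ℝ) = univ := Metric.iUnion_closedBall_nat 0

section Core

variable {α p q γ μ lam : ℝ}

theorem inner_sub_eq {E : Type*} [NormedAddCommGroup E] [InnerProductSpace ℝ E] (x y : E) :
    inner ℝ x (y - x) = (‖y‖ ^ 2 - ‖x‖ ^ 2 - ‖y - x‖ ^ 2) / 2 := by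
  rw [inner_sub_right, real_inner_self_eq_norm_sq]
  have := norm_sub_sq_real y x
  rw [real_inner_comm] at this
  linarith

/-- The bookkeeping of the comparison argument: `Ev - Eu` bounded below by convexity and above by
the transport estimates, both to first order in `σ`. -/
theorem le_of_energy_comparison {lam g r σ x₀ y₀ w y x x₁ y₁ A M B Du Dv Qu Qv L I Eu Ev c : ℝ}
    (hσ : 0 < σ) (hg : g ≤ 0) (hr : r ≤ 0) (hEu : Eu = 1 / 2 * x₁ ^ 2 - g * Du - r * Qu)
    (hEv : Ev = 1 / 2 * y₁ ^ 2 - g * Dv - r * Qv) (hconv : L ≤ Ev - Eu) (hcrit : L + lam * I = 0)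
    (hI : I = (y ^ 2 - x ^ 2 - w ^ 2) / 2) (hy0 : 0 ≤ y) (hyx : y ≤ x) (hw0 : 0 ≤ w)
    (hw : w ≤ c * σ * x₀) (hmass : x ^ 2 - y ^ 2 ≤ σ * M)
    (hdir : y₁ ^ 2 ≤ x₁ ^ 2 - σ / 4 * A) (hD : Dv ≤ Du + y₀ * σ * B) (hQ : Qv ≤ Qu) :
    1 / 8 * A ≤ |lam| / 2 * M + -g * (y₀ * B) + |lam| / 2 * (c * x₀) ^ 2 * σ := by
  have c1 : y ^ 2 ≤ x ^ 2 := pow_le_pow_left₀ hy0 hyx 2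
  have c2 : w ^ 2 ≤ (c * σ * x₀) ^ 2 := pow_le_pow_left₀ hw0 hw 2
  have d5 := mul_le_mul_of_nonneg_left hD (neg_nonneg.2 hg)
  have d6 := mul_le_mul_of_nonneg_left hQ (neg_nonneg.2 hr)
  have f1 : lam * (y ^ 2 - x ^ 2 - w ^ 2) ≤ |lam| * ((x ^ 2 - y ^ 2) + w ^ 2) := by
    have a1 : lam * (y ^ 2 - x ^ 2 - w ^ 2) ≤ |lam| * |y ^ 2 - x ^ 2 - w ^ 2| := by
      rw [← abs_mul]; exact le_abs_self _
    have a2 : |y ^ 2 - x ^ 2 - w ^ 2| = (x ^ 2 - y ^ 2) + w ^ 2 := by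
      rw [abs_of_nonpos (by linarith [sq_nonneg w])]; ring
    rwa [a2] at a1
  have f2 : |lam| * ((x ^ 2 - y ^ 2) + w ^ 2) ≤ |lam| * (σ * M + (c * σ * x₀) ^ 2) :=
    mul_le_mul_of_nonneg_left (add_le_add hmass c2) (abs_nonneg _)
  have f3 : σ * (1 / 8 * A) ≤ σ * (|lam| / 2 * M + -g * (y₀ * B) +
      |lam| / 2 * (c * x₀) ^ 2 * σ) := by
    rw [hI] at hcrit
    linarith
  exact le_of_mul_le_mul_left f3 hσ

/-- Comparing a constrained critical point of the convex energy with its transport. -/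
theorem dirichlet_ball_le_of_constrained (h : HartreeExponents N α p) (hq : SobolevExponent N q)
    (hγ : γ ≤ 0) (hμ : μ ≤ 0) {u : H1 N}
    (hu : ∀ w : H1 N, energyDeriv h hq γ μ u w + lam * inner ℝ u.1.fst w.1.fst = 0)
    (η : Profile) {ρ κ : ℝ} (hη : ∀ r, |r| ≤ ρ → κ ≤ η.slope r) (hκ : 1 / 2 ≤ κ) (hκ1 : κ ≤ 1)
    (hκp : (2 * (N : ℝ) - N * p) / (N - α) ≤ κ) :
    1 / 8 * (∫ y in Metric.closedBall (0 : Space N) ρ, ‖grad u y‖ ^ 2) ≤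
      |lam| / 2 * (N * ((1 - κ) * ‖u.1.fst‖ ^ 2 +
        ∫ y in (Metric.closedBall (0 : Space N) ρ)ᶜ, fn u y ^ 2)) +
      -γ / (2 * p) * (2 ^ N *
        ∫ z in (Metric.closedBall (0 : Space N) ρ ×ˢ Metric.closedBall (0 : Space N) ρ)ᶜ,
          rieszKernel α (z.1 - z.2) * (powMul p u u z.1 * powMul p u u z.2)) := by
  refine le_of_forall_small (Z := |lam| / 2 * (η.moveConst N * ‖u‖) ^ 2) one_pos
    fun σ hσ0 hσ1 => ?_
  have hσ := hσ0.le
  have hp0 : 0 < p := by linarith [h.one_lt]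
  have hq0 : 0 < q := by linarith [hq.one_lt]
  obtain ⟨v, hv⟩ : ∃ v, v = η.transport hσ u := ⟨_, rfl⟩
  have hI : inner ℝ u.1.fst (v - u).1.fst =
      (‖v.1.fst‖ ^ 2 - ‖u.1.fst‖ ^ 2 - ‖v.1.fst - u.1.fst‖ ^ 2) / 2 := inner_sub_eq _ _
  have hmass := η.norm_sq_fst_sub_transport_le hσ hη hκ1 u
  have hyx := η.norm_fst_transport_le hσ u
  have hdir := η.norm_sq_snd_transport_le hσ hσ1 hη hκ u
  have hD := η.rieszForm_transport_le h hσ hσ1 hη (by linarith) hκp u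
  have hQ := η.integral_powMul_transport_le hσ hq u
  have hw := η.norm_fst_transport_sub_le hσ hσ1 u
  rw [← hv] at hmass hyx hdir hD hQ hw
  have hg : γ / (2 * p) ≤ 0 := div_nonpos_of_nonpos_of_nonneg hγ (by linarith)
  have := le_of_energy_comparison hσ0 hg (div_nonpos_of_nonpos_of_nonneg hμ hq0.le)
    (energy_eq h hq u) (energy_eq h hq v) (energy_sub_ge h hq hγ hμ u v) (hu (v - u)) hI
    (norm_nonneg _) hyx (norm_nonneg _) hw hmass hdir hD hQ
  rw [neg_div]
  exact this

/-- A constrained critical point of the repulsive energy vanishes. -/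
theorem fn_ae_eq_zero_of_constrained (h : HartreeExponents N α p) (hq : SobolevExponent N q)
    (hγ : γ ≤ 0) (hμ : μ ≤ 0) {u : H1 N}
    (hu : ∀ w : H1 N, energyDeriv h hq γ μ u w + lam * inner ℝ u.1.fst w.1.fst = 0) :
    fn u =ᵐ[volume] 0 := by
  have hβ : 0 < (N : ℝ) - α := by linarith [h.lt_dim]
  have hN : (0 : ℝ) < N := by linarith [h.pos, h.lt_dim]
  have he : (2 * (N : ℝ) - N * p) / (N - α) < 1 := by
    rw [div_lt_one hβ]
    have := (div_lt_iff₀ hN).1 h.lower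
    linarith
  have hball : ∀ ρ : ℝ,
      1 / 8 * (∫ y in Metric.closedBall (0 : Space N) ρ, ‖grad u y‖ ^ 2) ≤
      |lam| / 2 * (N * ∫ y in (Metric.closedBall (0 : Space N) ρ)ᶜ, fn u y ^ 2) +
      -γ / (2 * p) * (2 ^ N *
        ∫ z in (Metric.closedBall (0 : Space N) ρ ×ˢ Metric.closedBall (0 : Space N) ρ)ᶜ,
          rieszKernel α (z.1 - z.2) * (powMul p u u z.1 * powMul p u u z.2)) := by
    intro ρ
    refine le_of_forall_small (Z := |lam| / 2 * (N * ‖u.1.fst‖ ^ 2))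
      (s₀ := min (1 / 2) (1 - (2 * (N : ℝ) - N * p) / (N - α)))
      (lt_min (by norm_num) (by linarith)) fun s hs0 hs => ?_
    have hs1 := hs.trans (min_le_left _ _)
    have hs2 := hs.trans (min_le_right _ _)
    obtain ⟨η, hη⟩ := exists_profile_le_slope (κ := 1 - s) (ρ := ρ) (by linarith) (by linarith)
    have := dirichlet_ball_le_of_constrained h hq hγ hμ hu η hη (by linarith) (by linarith)
      (by linarith)
    refine this.trans_eq ?_
    ring
  have hW : Integrable (fun z : Space N × Space N =>
      rieszKernel α (z.1 - z.2) * (powMul p u u z.1 * powMul p u u z.2)) :=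
    (h.finiteEnergy u u).integrable h.one_le h.pos h.lt_dim (h.finiteEnergy u u)
  have l1 := tendsto_setIntegral_compl_of_exhaustion (integrable_sq_fn u)
    (s := fun n : ℕ => Metric.closedBall (0 : Space N) n) (fun n => measurableSet_closedBall)
    monotone_closedBall_natCast iUnion_closedBall_natCast
  have l2 := tendsto_setIntegral_compl_of_exhaustion hW
    (s := fun n : ℕ => Metric.closedBall (0 : Space N) n ×ˢ Metric.closedBall (0 : Space N) n)
    (fun n => measurableSet_closedBall.prod measurableSet_closedBall)
    (fun m n hmn => prod_mono (monotone_closedBall_natCast hmn) (monotone_closedBall_natCast hmn))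
    (by rw [iUnion_prod_of_monotone monotone_closedBall_natCast monotone_closedBall_natCast,
          iUnion_closedBall_natCast, univ_prod_univ])
  have l3 : Tendsto (fun n : ℕ => ∫ y in Metric.closedBall (0 : Space N) (n : ℝ), ‖grad u y‖ ^ 2)
      atTop (𝓝 (∫ y, ‖grad u y‖ ^ 2)) := by
    have := tendsto_setIntegral_of_monotone (μ := volume) (f := fun y => ‖grad u y‖ ^ 2)
      (s := fun n : ℕ => Metric.closedBall (0 : Space N) n) (fun n => measurableSet_closedBall)
      monotone_closedBall_natCast (integrable_norm_sq_grad u).integrableOn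
    rwa [iUnion_closedBall_natCast, setIntegral_univ] at this
  have key := le_of_tendsto_of_tendsto' (l3.const_mul (1 / 8))
    (((l1.const_mul (N : ℝ)).const_mul (|lam| / 2)).add
      ((l2.const_mul ((2 : ℝ) ^ N)).const_mul (-γ / (2 * p)))) (fun n => hball n)
  rw [integral_norm_sq_grad] at key
  simp only [mul_zero, add_zero] at key
  have h0 : ‖u.1.snd‖ = 0 := by
    have := sq_nonneg ‖u.1.snd‖
    exact pow_eq_zero_iff two_ne_zero |>.1 (by linarith)
  exact fn_ae_eq_zero_of_snd_eq_zero h.two_le (norm_eq_zero.1 h0)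

end Core

/-! ### Multipliers, weak solutions and the fibering map -/

section Constrained

variable {α p q γ μ c lam : ℝ}

theorem integral_fn_mul_fn (u w : H1 N) : ∫ x, fn u x * fn w x = inner ℝ u.1.fst w.1.fst := by
  rw [L2.inner_def]
  refine integral_congr_ae (ae_of_all _ fun x => ?_)
  simp only [RCLike.inner_apply, conj_trivial]
  exact mul_comm _ _

theorem mem_massSphere_iff (u : H1 N) : u ∈ massSphere N c ↔ ‖u.1.fst‖ ^ 2 = c := by
  rw [norm_sq_fst]
  simp [massSphere]

theorem not_fn_ae_eq_zero_of_mem_massSphere (hc : 0 < c) {u : H1 N} (hu : u ∈ massSphere N c) :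
    ¬ fn u =ᵐ[volume] 0 := by
  intro h
  have h1 : ∫ x, fn u x ^ 2 = 0 := by
    refine integral_eq_zero_of_ae ?_
    filter_upwards [h] with x hx
    rw [hx]; simp
  rw [mem_massSphere_iff, norm_sq_fst, h1] at hu
  exact hc.ne hu

set_option maxHeartbeats 1000000 in
/-- The Lagrange multiplier rule on the mass sphere. -/
theorem IsCriticalPoint.exists_multiplier (h : HartreeExponents N α p) (hq : SobolevExponent N q)
    (hc : 0 < c) {u : H1 N} (hu : IsCriticalPoint α p q γ μ c u) :
    ∃ lam : ℝ, ∀ w : H1 N, energyDeriv h hq γ μ u w + lam * inner ℝ u.1.fst w.1.fst = 0 := by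
  obtain ⟨hmem, hcrit⟩ := hu
  rw [(hasFDerivAt_energy h hq u).fderiv] at hcrit
  rw [mem_massSphere_iff] at hmem
  obtain ⟨L, hL⟩ : ∃ L, L = energyDeriv h hq γ μ u := ⟨_, rfl⟩
  rw [← hL] at hcrit ⊢
  refine ⟨-(L u / c), fun w => ?_⟩
  obtain ⟨t, ht⟩ : ∃ t, t = inner ℝ u.1.fst w.1.fst / c := ⟨_, rfl⟩
  have h1 : L (w - t • u) = 0 := by
    refine hcrit _ ?_
    rw [integral_fn_mul_fn]
    have h2 : (w - t • u).1.fst = w.1.fst - t • u.1.fst := rfl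
    rw [h2, inner_sub_right, inner_smul_right, real_inner_self_eq_norm_sq, hmem, ht,
      div_mul_cancel₀ _ hc.ne', sub_self]
  rw [map_sub, map_smul, smul_eq_mul, ht] at h1
  have h3 : L u / c * inner ℝ u.1.fst w.1.fst = inner ℝ u.1.fst w.1.fst / c * L u := by ring
  linarith

theorem energyDeriv_testH1 (h : HartreeExponents N α p) (hq : SobolevExponent N q) (u : H1 N)
    {φ : Space N → ℝ} (hφ : IsTest φ) :
    energyDeriv h hq γ μ u (testH1 φ hφ) = (∫ x, fderiv ℝ φ x (grad u x))
      - γ * (∫ x, hartree α p (fn u) x * (|fn u x| ^ (p - 2) * fn u x) * φ x)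
      - μ * (∫ x, |fn u x| ^ (q - 2) * fn u x * φ x) := by
  have e1 : dirichletDeriv u (testH1 φ hφ) = ∫ x, fderiv ℝ φ x (grad u x) := by
    rw [dirichletDeriv_apply_eq_integral]
    refine integral_congr_ae ?_
    filter_upwards [grad_testH1 hφ] with x hx
    rw [hx, real_inner_comm, inner_gradient]
  have e2 : hartreeDeriv h u (testH1 φ hφ)
      = ∫ x, hartree α p (fn u) x * (|fn u x| ^ (p - 2) * fn u x) * φ x := by
    rw [hartreeDeriv_apply, rieszForm_eq_integral h.one_le h.pos h.lt_dim
      (h.finiteEnergy_oddMul u _) (h.finiteEnergy u u), powMul_self h.one_lt]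
    refine integral_congr_ae ?_
    filter_upwards [fn_testH1 hφ] with x hx
    simp only [oddMul, oddPow, hartree, hx]
    ring
  have e3 : powerDeriv hq u (testH1 φ hφ) = ∫ x, |fn u x| ^ (q - 2) * fn u x * φ x := by
    rw [powerDeriv_apply]
    refine integral_congr_ae ?_
    filter_upwards [fn_testH1 hφ] with x hx
    simp only [oddMul, oddPow, hx]
  rw [← e1, ← e2, ← e3]
  rfl

/-- A weak solution satisfies the equation tested against all of `H¹`. -/
theorem IsWeakSolution.energyDeriv_add_eq_zero (h : HartreeExponents N α p)
    (hq : SobolevExponent N q) {u : H1 N} (hu : IsWeakSolution α p q γ μ lam u) (w : H1 N) :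
    energyDeriv h hq γ μ u w + lam * inner ℝ u.1.fst w.1.fst = 0 := by
  have hfst : Continuous fun w : H1 N => w.1.fst :=
    (WithLp.prod_continuous_ofLp ..).fst.comp continuous_subtype_val
  have hcont : Continuous fun w : H1 N =>
      energyDeriv h hq γ μ u w + lam * inner ℝ u.1.fst w.1.fst :=
    (energyDeriv h hq γ μ u).continuous.add
      (continuous_const.mul (continuous_const.inner hfst))
  have heq := (denseRange_testH1 (N := N)).equalizer hcont
    (continuous_const (y := (0 : ℝ))) (funext fun φ => ?_)
  · exact congrFun heq w
  obtain ⟨φ, hφ⟩ := φ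
  simp only [Function.comp_apply]
  have h1 := hu φ hφ
  have h2 : ∫ x, fn u x * φ x = inner ℝ u.1.fst (testH1 φ hφ).1.fst := by
    rw [← integral_fn_mul_fn]
    refine integral_congr_ae ?_
    filter_upwards [fn_testH1 hφ] with x hx
    rw [hx]
  rw [energyDeriv_testH1, ← h2]
  linarith

end Constrained

section Fibering

variable {α p q γ μ c : ℝ}

theorem fn_dilate {t : ℝ} (ht : 0 < t) (u : H1 N) :
    fn (dilate t ht u) =ᵐ[volume] fun x => t ^ ((N : ℝ) / 2) * fn u (t • x) :=
  fn_mkH1 ((memLp_comp_dilation (Lp.memLp u.1.fst) ht).const_mul _)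
    ((memLp_comp_dilation (Lp.memLp u.1.snd) ht).const_smul (t ^ ((N : ℝ) / 2) * t))
    (IsWeakGradient.dilation u.2 ht _)

theorem grad_dilate {t : ℝ} (ht : 0 < t) (u : H1 N) :
    grad (dilate t ht u) =ᵐ[volume] fun x => (t ^ ((N : ℝ) / 2) * t) • grad u (t • x) :=
  grad_mkH1 ((memLp_comp_dilation (Lp.memLp u.1.fst) ht).const_mul _)
    ((memLp_comp_dilation (Lp.memLp u.1.snd) ht).const_smul (t ^ ((N : ℝ) / 2) * t))
    (IsWeakGradient.dilation u.2 ht _)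

theorem integral_comp_dilation {t : ℝ} (ht : 0 < t) (g : Space N → ℝ) :
    ∫ x, g (t • x) = t ^ (-(N : ℝ)) * ∫ x, g x := by
  rw [Measure.integral_comp_smul, smul_eq_mul, finrank_euclideanSpace, Fintype.card_fin,
    abs_of_pos (by positivity), Real.rpow_neg ht.le, Real.rpow_natCast]

theorem integral_norm_sq_grad_dilate {t : ℝ} (ht : 0 < t) (u : H1 N) :
    ∫ x, ‖grad (dilate t ht u) x‖ ^ 2 = t ^ 2 * ∫ x, ‖grad u x‖ ^ 2 := by
  have e : ∫ x, ‖grad (dilate t ht u) x‖ ^ 2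
      = ∫ x, (t ^ ((N : ℝ) / 2) * t) ^ 2 * ‖grad u (t • x)‖ ^ 2 := by
    refine integral_congr_ae ?_
    filter_upwards [grad_dilate ht u] with x hx
    rw [hx, norm_smul, mul_pow, Real.norm_eq_abs, sq_abs]
  rw [e, integral_const_mul, integral_comp_dilation ht (fun x => ‖grad u x‖ ^ 2), ← mul_assoc]
  congr 1
  have h1 : (t ^ ((N : ℝ) / 2)) ^ 2 * t ^ (-(N : ℝ)) = 1 := by
    rw [← Real.rpow_natCast, ← Real.rpow_mul ht.le, ← Real.rpow_add ht]
    norm_num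
  rw [mul_pow, mul_right_comm, h1, one_mul]

theorem abs_fn_dilate_rpow {t : ℝ} (ht : 0 < t) (u : H1 N) (r : ℝ) :
    (fun x => |fn (dilate t ht u) x| ^ r) =ᵐ[volume]
      fun x => t ^ ((N : ℝ) / 2 * r) * |fn u (t • x)| ^ r := by
  filter_upwards [fn_dilate ht u] with x hx
  rw [hx, abs_mul, abs_of_pos (by positivity), Real.mul_rpow (by positivity) (abs_nonneg _),
    ← Real.rpow_mul ht.le]

theorem integral_abs_fn_dilate_rpow {t : ℝ} (ht : 0 < t) (u : H1 N) (r : ℝ) :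
    ∫ x, |fn (dilate t ht u) x| ^ r = t ^ ((N : ℝ) / 2 * r - N) * ∫ x, |fn u x| ^ r := by
  rw [integral_congr_ae (abs_fn_dilate_rpow ht u r), integral_const_mul,
    integral_comp_dilation ht (fun x => |fn u x| ^ r), ← mul_assoc, ← Real.rpow_add ht]
  rfl

theorem rieszKernel_smul {t : ℝ} (ht : 0 < t) (x : Space N) :
    rieszKernel α x = t ^ ((N : ℝ) - α) * rieszKernel α (t • x) := by
  rw [rieszKernel_eq, rieszKernel_eq, norm_smul, Real.norm_eq_abs, abs_of_pos ht,
    Real.mul_rpow ht.le (norm_nonneg _), Real.rpow_neg ht.le]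
  have : t ^ ((N : ℝ) - α) ≠ 0 := (Real.rpow_pos_of_pos ht _).ne'
  field_simp

theorem hartree_dilate {t : ℝ} (ht : 0 < t) (u : H1 N) (x : Space N) :
    hartree α p (fn (dilate t ht u)) x
      = t ^ ((N : ℝ) / 2 * p - α) * hartree α p (fn u) (t • x) := by
  unfold hartree
  have e : ∫ y, rieszKernel α (x - y) * |fn (dilate t ht u) y| ^ p = ∫ y,
      (t ^ ((N : ℝ) / 2 * p) * t ^ ((N : ℝ) - α)) *
        (rieszKernel α (t • x - t • y) * |fn u (t • y)| ^ p) := by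
    refine integral_congr_ae ?_
    filter_upwards [abs_fn_dilate_rpow ht u p] with y hy
    rw [hy, rieszKernel_smul ht (x - y), smul_sub]
    ring
  rw [e, integral_const_mul,
    integral_comp_dilation ht (fun y => rieszKernel α (t • x - y) * |fn u y| ^ p), ← mul_assoc,
    ← Real.rpow_add ht, ← Real.rpow_add ht]
  congr 2
  ring

theorem integral_hartree_dilate {t : ℝ} (ht : 0 < t) (u : H1 N) :
    ∫ x, hartree α p (fn (dilate t ht u)) x * |fn (dilate t ht u) x| ^ p
      = t ^ ((N : ℝ) * p - N - α) * ∫ x, hartree α p (fn u) x * |fn u x| ^ p := by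
  have e : ∫ x, hartree α p (fn (dilate t ht u)) x * |fn (dilate t ht u) x| ^ p
      = ∫ x, (t ^ ((N : ℝ) / 2 * p - α) * t ^ ((N : ℝ) / 2 * p)) *
        (hartree α p (fn u) (t • x) * |fn u (t • x)| ^ p) := by
    refine integral_congr_ae ?_
    filter_upwards [abs_fn_dilate_rpow ht u p] with x hx
    rw [hx, hartree_dilate ht u x]
    ring
  rw [e, integral_const_mul,
    integral_comp_dilation ht (fun x => hartree α p (fn u) x * |fn u x| ^ p), ← mul_assoc,
    ← Real.rpow_add ht, ← Real.rpow_add ht]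
  congr 2
  ring

/-- The energy along the mass-preserving dilations is a sum of powers of `t`. -/
theorem energy_dilate {t : ℝ} (ht : 0 < t) (u : H1 N) :
    energy α p q γ μ (dilate t ht u) = 1 / 2 * (t ^ 2 * ∫ x, ‖grad u x‖ ^ 2)
      - γ / (2 * p) * (t ^ ((N : ℝ) * p - N - α) * ∫ x, hartree α p (fn u) x * |fn u x| ^ p)
      - μ / q * (t ^ ((N : ℝ) / 2 * q - N) * ∫ x, |fn u x| ^ q) := by
  unfold energy
  rw [integral_norm_sq_grad_dilate, integral_hartree_dilate, integral_abs_fn_dilate_rpow]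

theorem energy_dilate_strictMono (h : HartreeExponents N α p) (hq : SobolevExponent N q)
    (hγ : γ ≤ 0) (hμ : μ ≤ 0) (hc : 0 < c) {u : H1 N} (hu : u ∈ massSphere N c) :
    StrictMono fun t : Set.Ioi (0 : ℝ) => energy α p q γ μ (dilate t.1 t.2 u) := by
  rintro ⟨s, hs⟩ ⟨t, ht⟩ hst
  have hst' : s < t := hst
  have hs0 : 0 < s := hs
  change energy α p q γ μ (dilate s hs0 u) < energy α p q γ μ (dilate t (hs0.trans hst') u)
  rw [energy_dilate, energy_dilate]
  have hN : (0 : ℝ) < N := by linarith [h.pos, h.lt_dim]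
  have hp0 : 0 < p := by linarith [h.one_lt]
  have hq0 : 0 < q := by linarith [hq.one_lt]
  have hA : 0 < ∫ x, ‖grad u x‖ ^ 2 := by
    rw [integral_norm_sq_grad]
    refine pow_pos (norm_pos_iff.2 fun h0 => ?_) 2
    exact not_fn_ae_eq_zero_of_mem_massSphere hc hu (fn_ae_eq_zero_of_snd_eq_zero h.two_le h0)
  have hB : 0 ≤ ∫ x, hartree α p (fn u) x * |fn u x| ^ p := by
    refine integral_nonneg fun x => mul_nonneg (integral_nonneg fun y => ?_) (by positivity)
    exact mul_nonneg (rieszKernel_nonneg h.pos h.lt_dim _) (by positivity)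
  have hC : 0 ≤ ∫ x, |fn u x| ^ q := integral_nonneg fun x => by positivity
  have e1 : 0 ≤ (N : ℝ) * p - N - α := by
    have := (div_lt_iff₀ hN).1 h.lower
    linarith
  have e2 : 0 ≤ (N : ℝ) / 2 * q - N := by nlinarith [hq.lower]
  have i1 : s ^ 2 * ∫ x, ‖grad u x‖ ^ 2 < t ^ 2 * ∫ x, ‖grad u x‖ ^ 2 :=
    mul_lt_mul_of_pos_right (pow_lt_pow_left₀ hst' hs0.le two_ne_zero) hA
  have i2 := mul_le_mul_of_nonneg_left (mul_le_mul_of_nonneg_right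
    (Real.rpow_le_rpow hs0.le hst'.le e1) hB)
    (div_nonneg (neg_nonneg.2 hγ) (show 0 ≤ 2 * p by linarith))
  have i3 := mul_le_mul_of_nonneg_left (mul_le_mul_of_nonneg_right
    (Real.rpow_le_rpow hs0.le hst'.le e2) hC) (div_nonneg (neg_nonneg.2 hμ) hq0.le)
  rw [neg_div] at i2 i3
  linarith

end Fibering

end Choquard

end

theorem theorem1p7 (N : ℕ) (hN : 2 ≤ N) (α p q γ μ c : ℝ)
    (hα : 0 < α) (hαN : α < N) (hγ : γ < 0) (hμ : μ < 0) (hc : 0 < c)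
    (hp : ((N : ℝ) + α) / N < p) (hp' : 3 ≤ N → p < ((N : ℝ) + α) / ((N : ℝ) - 2))
    (hq : 2 < q) (hq' : 3 ≤ N → q < 2 * (N : ℝ) / ((N : ℝ) - 2)) :
    (¬ ∃ u : Choquard.H1 N, Choquard.IsCriticalPoint α p q γ μ c u) ∧
    (¬ ∃ (lam : ℝ) (u : Choquard.H1 N), Choquard.IsNormalizedSolution α p q γ μ c lam u) ∧
    (∀ u ∈ Choquard.massSphere N c,
      StrictMono fun t : Set.Ioi (0 : ℝ) =>
        Choquard.energy α p q γ μ (Choquard.dilate t.1 t.2 u)) := by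
  have h : Choquard.HartreeExponents N α p := ⟨hN, hα, hαN, hp, hp'⟩
  have h' : Choquard.SobolevExponent N q := ⟨hN, hq, hq'⟩
  refine ⟨?_, ?_, fun u hu => Choquard.energy_dilate_strictMono h h' hγ.le hμ.le hc hu⟩
  · rintro ⟨u, hu⟩
    obtain ⟨lam, hlam⟩ := hu.exists_multiplier h h' hc
    exact Choquard.not_fn_ae_eq_zero_of_mem_massSphere hc hu.1
      (Choquard.fn_ae_eq_zero_of_constrained h h' hγ.le hμ.le hlam)
  · rintro ⟨lam, u, hu, hmass⟩
    exact Choquard.not_fn_ae_eq_zero_of_mem_massSphere hc hmass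
      (Choquard.fn_ae_eq_zero_of_constrained h h' hγ.le hμ.le (hu.energyDeriv_add_eq_zero h h'))
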